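/- Let $\Bbbk$ be an algebraically closed field of characteristic zero. Let $G$ be a finite group, $\chi: G\to\Bbbk^\times$ a linear character, $g$ a central element of $G$ and $\mu\in\Bbbk$; let $n$ be the order of $\chi(g)$, and suppose that $n\ge 2$, $\chi^n=1$ and $\mu(g^n-1)\neq 0$ in the group algebra $\Bbbk G$. Let $H$ be the associated finite dimensional pointed Hopf algebra of rank one of non-nilpotent type, that is, the $\Bbbk$-algebra generated by $y$ and the elements of $G$ subject to the relations of $G$ and $$y^n=\mu(g^n-1),\qquad yh=\chi(h)hy\quad(h\in G),$$ with $\Delta(y)=y\otimes g+1\otimes y$, $\varepsilon(y)=0$, $S(y)=-yg^{-1}$, and $\Delta(h)=h\otimes h$, $\varepsilon(h)=1$, $S(h)=h^{-1}$ for $h\in G$. Let $r(H)$ be the Green ring of $H$: the free abelian group on the isomorphism classes $[M]$ of finite dimensional left $H$-modules, with multiplication $[M][N]=[M\otimes N]$ and identity $[\Bbbk]$, modulo the relations $[M\oplus N]=[M]+[N]$. Then $r(H)$ has no idempotents other than $0$ and $1$. -/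

import Mathlib

open scoped TensorProduct

universe u v

namespace PointedHopf

/-! ### Finite dimensional modules over an algebra and the Green ring of a bialgebra -/

section Modules

/-- A finite dimensional left module over a `k`-algebra `A`: a finite dimensional `k`-vector space
together with an algebra homomorphism from `A` to its endomorphism algebra, where `action a` is
the map `v ↦ a • v`. -/
structure FDModule (k : Type u) (A : Type v) [Field k] [Ring A] [Algebra k A] where
  /-- the underlying space -/
  carrier : Type u
  [addCommGroup : AddCommGroup carrier]
  [module : Module k carrier]
  [finite : Module.Finite k carrier]
  /-- the action of `A` -/
  action : A →ₐ[k] Module.End k carrier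

attribute [instance] FDModule.addCommGroup FDModule.module FDModule.finite

variable {k : Type u} {A : Type v} [Field k] [Ring A]

namespace FDModule

/-- `M` and `N` are isomorphic as `A`-modules. -/
def Iso [Algebra k A] (M N : FDModule k A) : Prop :=
  ∃ f : M.carrier ≃ₗ[k] N.carrier, ∀ (a : A) (m : M.carrier),
    f (M.action a m) = N.action a (f m)

/-- Isomorphism of modules is an equivalence relation. -/
instance isoSetoid (k : Type u) (A : Type v) [Field k] [Ring A] [Algebra k A] :
    Setoid (FDModule k A) where
  r := Iso
  iseqv :=
    { refl := fun _ => ⟨LinearEquiv.refl k _, fun _ _ => rfl⟩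
      symm := by
        rintro M N ⟨f, hf⟩
        refine ⟨f.symm, fun a n => ?_⟩
        apply f.injective
        rw [hf]
        simp
      trans := by
        rintro M N P ⟨f, hf⟩ ⟨g, hg⟩
        exact ⟨f.trans g, fun a m => by simp [hf, hg]⟩ }

/-- The direct sum `M ⊕ N`, with `a (m, n) = (a m, a n)`. -/
def directSum [Algebra k A] (M N : FDModule k A) : FDModule k A where
  carrier := M.carrier × N.carrier
  action := AlgHom.ofLinearMap
    { toFun := fun a => (M.action a).prodMap (N.action a)
      map_add' := fun a b => by ext <;> simp
      map_smul' := fun c a => by ext <;> simp }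
    (by ext <;> simp)
    (fun a b => by ext <;> simp)

/-- The trivial module `k`, on which `a` acts as the scalar `ε(a)`. -/
noncomputable def trivial (k : Type u) (A : Type v) [Field k] [Ring A] [Bialgebra k A] :
    FDModule k A where
  carrier := k
  action := (Algebra.lmul k k).comp (Bialgebra.counitAlgHom k A)

/-- The tensor product `M ⊗ N` over `k`, on which `A` acts through its comultiplication:
`a (m ⊗ n) = ∑ a₁ m ⊗ a₂ n`. -/
noncomputable def tensor [Bialgebra k A] (M N : FDModule k A) : FDModule k A where
  carrier := M.carrier ⊗[k] N.carrier
  action := (Module.endTensorEndAlgHom (R := k) (S := k) (A := k)).comp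
    ((Algebra.TensorProduct.map M.action N.action).comp (Bialgebra.comulAlgHom k A))

variable [Bialgebra k A]

/-- The map `a ↦ a m`. -/
def orbit (M : FDModule k A) (m : M.carrier) : A →ₗ[k] M.carrier :=
  M.action.toLinearMap.flip m

theorem orbit_apply (M : FDModule k A) (m : M.carrier) (a : A) : M.orbit m a = M.action a m :=
  rfl

theorem orbit_tmul (M N : FDModule k A) (m : M.carrier) (n : N.carrier) :
    (M.tensor N).orbit (m ⊗ₜ[k] n) =
      TensorProduct.map (M.orbit m) (N.orbit n) ∘ₗ Coalgebra.comul := by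
  ext a
  change Module.endTensorEndAlgHom (R := k) (S := k) (A := k)
    (Algebra.TensorProduct.map M.action N.action (Coalgebra.comul (R := k) a)) (m ⊗ₜ[k] n) =
      TensorProduct.map (M.orbit m) (N.orbit n) (Coalgebra.comul (R := k) a)
  induction Coalgebra.comul (R := k) a using TensorProduct.induction_on with
  | zero => simp
  | tmul x y => rfl
  | add x y hx hy => simp only [map_add, LinearMap.add_apply, hx, hy]

theorem tensor_congr {M M' N N' : FDModule k A} (h : Iso M M') (h' : Iso N N') :
    Iso (M.tensor N) (M'.tensor N') := by
  obtain ⟨f, hf⟩ := h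
  obtain ⟨f', hf'⟩ := h'
  refine ⟨TensorProduct.congr f f', fun a x => ?_⟩
  revert x
  suffices h : (TensorProduct.congr f f').toLinearMap ∘ₗ (M.tensor N).action a =
      (M'.tensor N').action a ∘ₗ (TensorProduct.congr f f').toLinearMap from
    fun x => LinearMap.congr_fun h x
  refine TensorProduct.ext' fun m n => ?_
  have h1 : M'.orbit (f m) = f.toLinearMap ∘ₗ M.orbit m :=
    LinearMap.ext fun a => (hf a m).symm
  have h2 : N'.orbit (f' n) = f'.toLinearMap ∘ₗ N.orbit n :=
    LinearMap.ext fun a => (hf' a n).symm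
  have h3 : (M'.tensor N').orbit (f m ⊗ₜ[k] f' n) =
      TensorProduct.map f.toLinearMap f'.toLinearMap ∘ₗ (M.tensor N).orbit (m ⊗ₜ[k] n) := by
    rw [orbit_tmul, orbit_tmul, h1, h2, TensorProduct.map_comp, LinearMap.comp_assoc]
  exact (LinearMap.congr_fun h3 a).symm

theorem tensor_assoc (M N P : FDModule k A) :
    Iso ((M.tensor N).tensor P) (M.tensor (N.tensor P)) := by
  refine ⟨TensorProduct.assoc k M.carrier N.carrier P.carrier, fun a x => ?_⟩
  revert x
  suffices h : (TensorProduct.assoc k M.carrier N.carrier P.carrier).toLinearMap ∘ₗ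
      ((M.tensor N).tensor P).action a = (M.tensor (N.tensor P)).action a ∘ₗ
        (TensorProduct.assoc k M.carrier N.carrier P.carrier).toLinearMap from
    fun x => LinearMap.congr_fun h x
  refine TensorProduct.ext_threefold fun m n p => ?_
  have h1 : (TensorProduct.assoc k M.carrier N.carrier P.carrier).toLinearMap ∘ₗ
      ((M.tensor N).tensor P).orbit ((m ⊗ₜ[k] n) ⊗ₜ[k] p) =
        (M.tensor (N.tensor P)).orbit (m ⊗ₜ[k] (n ⊗ₜ[k] p)) := by
    have e1 : ((M.tensor N).tensor P).orbit ((m ⊗ₜ[k] n) ⊗ₜ[k] p) =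
        TensorProduct.map (TensorProduct.map (M.orbit m) (N.orbit n)) (P.orbit p) ∘ₗ
          Coalgebra.comul.rTensor A ∘ₗ Coalgebra.comul := by
      refine (orbit_tmul (M.tensor N) P (m ⊗ₜ[k] n) p).trans ?_
      rw [orbit_tmul, ← LinearMap.comp_assoc]
      congr 1
      ext x y
      rfl
    have e2 : (M.tensor (N.tensor P)).orbit (m ⊗ₜ[k] (n ⊗ₜ[k] p)) =
        TensorProduct.map (M.orbit m) (TensorProduct.map (N.orbit n) (P.orbit p)) ∘ₗ
          Coalgebra.comul.lTensor A ∘ₗ Coalgebra.comul := by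
      refine (orbit_tmul M (N.tensor P) m (n ⊗ₜ[k] p)).trans ?_
      rw [orbit_tmul, ← LinearMap.comp_assoc]
      congr 1
      ext x y
      rfl
    have e3 : (TensorProduct.assoc k M.carrier N.carrier P.carrier).toLinearMap ∘ₗ
        TensorProduct.map (TensorProduct.map (M.orbit m) (N.orbit n)) (P.orbit p) =
        TensorProduct.map (M.orbit m) (TensorProduct.map (N.orbit n) (P.orbit p)) ∘ₗ
          (TensorProduct.assoc k A A A).toLinearMap :=
      TensorProduct.ext_threefold fun x y z => rfl
    rw [e1, e2, ← Coalgebra.coassoc]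
    exact congrArg (fun t => t ∘ₗ Coalgebra.comul.rTensor A ∘ₗ Coalgebra.comul) e3
  exact LinearMap.congr_fun h1 a

theorem trivial_tensor (M : FDModule k A) : Iso ((trivial k A).tensor M) M := by
  refine ⟨TensorProduct.lid k M.carrier, fun a x => ?_⟩
  revert x
  suffices h : (TensorProduct.lid k M.carrier).toLinearMap ∘ₗ
      ((trivial k A).tensor M).action a =
        M.action a ∘ₗ (TensorProduct.lid k M.carrier).toLinearMap from
    fun x => LinearMap.congr_fun h x
  refine TensorProduct.ext' fun (c : k) m => ?_
  have h1 : (TensorProduct.lid k M.carrier).toLinearMap ∘ₗ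
      ((trivial k A).tensor M).orbit (c ⊗ₜ[k] m) = c • M.orbit m := by
    have e1 : (TensorProduct.lid k M.carrier).toLinearMap ∘ₗ
        TensorProduct.map ((trivial k A).orbit c) (M.orbit m) =
          c • (M.orbit m ∘ₗ (TensorProduct.lid k A).toLinearMap ∘ₗ
            Coalgebra.counit.rTensor A) := by
      ext x y
      change (Coalgebra.counit (R := k) x * c) • M.action y m =
        c • M.action (Coalgebra.counit (R := k) x • y) m
      rw [map_smul, LinearMap.smul_apply, smul_smul, mul_comm]
    refine (congrArg (fun t => (TensorProduct.lid k M.carrier).toLinearMap ∘ₗ t)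
      (orbit_tmul (trivial k A) M c m)).trans ?_
    refine (congrArg (fun t => t ∘ₗ Coalgebra.comul) e1).trans ?_
    ext a
    simp
  refine (LinearMap.congr_fun h1 a).trans ?_
  change c • M.action a m = M.action a (c • m)
  rw [map_smul]

theorem tensor_trivial (M : FDModule k A) : Iso (M.tensor (trivial k A)) M := by
  refine ⟨TensorProduct.rid k M.carrier, fun a x => ?_⟩
  revert x
  suffices h : (TensorProduct.rid k M.carrier).toLinearMap ∘ₗ
      (M.tensor (trivial k A)).action a =
        M.action a ∘ₗ (TensorProduct.rid k M.carrier).toLinearMap from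
    fun x => LinearMap.congr_fun h x
  refine TensorProduct.ext' fun m (c : k) => ?_
  have h1 : (TensorProduct.rid k M.carrier).toLinearMap ∘ₗ
      (M.tensor (trivial k A)).orbit (m ⊗ₜ[k] c) = c • M.orbit m := by
    have e1 : (TensorProduct.rid k M.carrier).toLinearMap ∘ₗ
        TensorProduct.map (M.orbit m) ((trivial k A).orbit c) =
          c • (M.orbit m ∘ₗ (TensorProduct.rid k A).toLinearMap ∘ₗ
            Coalgebra.counit.lTensor A) := by
      ext x y
      change (Coalgebra.counit (R := k) y * c) • M.action x m =
        c • M.action (Coalgebra.counit (R := k) y • x) m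
      rw [map_smul, LinearMap.smul_apply, smul_smul, mul_comm]
    refine (congrArg (fun t => (TensorProduct.rid k M.carrier).toLinearMap ∘ₗ t)
      (orbit_tmul M (trivial k A) m c)).trans ?_
    refine (congrArg (fun t => t ∘ₗ Coalgebra.comul) e1).trans ?_
    ext a
    simp
  refine (LinearMap.congr_fun h1 a).trans ?_
  change c • M.action a m = M.action a (c • m)
  rw [map_smul]

end FDModule

/-- The set of isomorphism classes `[M]` of finite dimensional `A`-modules. -/
def IsoClass (k : Type u) (A : Type v) [Field k] [Ring A] [Algebra k A] : Type (max (u + 1) v) :=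
  Quotient (FDModule.isoSetoid k A)

/-- The isomorphism class `[M]`. -/
def IsoClass.mk [Algebra k A] (M : FDModule k A) : IsoClass k A :=
  Quotient.mk _ M

/-- Isomorphism classes form a monoid under `[M] [N] = [M ⊗ N]`, with identity `[k]`. -/
noncomputable instance [Bialgebra k A] : Monoid (IsoClass k A) where
  mul := Quotient.map₂ FDModule.tensor fun _ _ h _ _ h' => FDModule.tensor_congr h h'
  one := IsoClass.mk (FDModule.trivial k A)
  mul_assoc := by
    rintro ⟨M⟩ ⟨N⟩ ⟨P⟩
    exact Quotient.sound (FDModule.tensor_assoc M N P)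
  one_mul := by
    rintro ⟨M⟩
    exact Quotient.sound (FDModule.trivial_tensor M)
  mul_one := by
    rintro ⟨M⟩
    exact Quotient.sound (FDModule.tensor_trivial M)

/-- The relations `[M ⊕ N] = [M] + [N]` in the free abelian group on the isomorphism classes. -/
inductive GreenRel (k : Type u) (A : Type v) [Field k] [Ring A] [Algebra k A] :
    FreeAbelianGroup (IsoClass k A) → FreeAbelianGroup (IsoClass k A) → Prop
  | directSum (M N : FDModule k A) :
      GreenRel k A (FreeAbelianGroup.of (IsoClass.mk (M.directSum N)))
        (FreeAbelianGroup.of (IsoClass.mk M) + FreeAbelianGroup.of (IsoClass.mk N))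

/-- The Green ring `r(A)`: the free abelian group on the isomorphism classes of finite dimensional
`A`-modules, with multiplication `[M] [N] = [M ⊗ N]`, modulo `[M ⊕ N] = [M] + [N]`. -/
def GreenRing (k : Type u) (A : Type v) [Field k] [Ring A] [Bialgebra k A] :
    Type (max (u + 1) v) :=
  RingQuot (GreenRel k A)

noncomputable instance [Bialgebra k A] : Ring (GreenRing k A) :=
  inferInstanceAs (Ring (RingQuot (GreenRel k A)))

end Modules

/-! ### The quantum binomial formula at a root of unity -/

section QuantumBinomial

variable {k : Type u} [Field k]

/-- Quantum binomial coefficients. -/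
def qbinom (q : k) : ℕ → ℕ → k
  | _, 0 => 1
  | 0, _ + 1 => 0
  | n + 1, j + 1 => qbinom q n j + q ^ (j + 1) * qbinom q n (j + 1)

theorem qbinom_zero_right (q : k) (n : ℕ) : qbinom q n 0 = 1 := by
  cases n <;> rfl

theorem qbinom_of_lt (q : k) (n : ℕ) : ∀ j, n < j → qbinom q n j = 0 := by
  induction n with
  | zero =>
    intro j hj
    obtain ⟨i, rfl⟩ := Nat.exists_eq_succ_of_ne_zero hj.ne'
    rfl
  | succ n ih =>
    intro j hj
    obtain ⟨i, rfl⟩ := Nat.exists_eq_succ_of_ne_zero (by omega : j ≠ 0)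
    change qbinom q n i + q ^ (i + 1) * qbinom q n (i + 1) = 0
    rw [ih i (by omega), ih (i + 1) (by omega)]
    ring

theorem qbinom_self (q : k) (n : ℕ) : qbinom q n n = 1 := by
  induction n with
  | zero => rfl
  | succ n ih =>
    change qbinom q n n + q ^ (n + 1) * qbinom q n (n + 1) = 1
    rw [ih, qbinom_of_lt q n (n + 1) (by omega)]
    ring

theorem qbinom_step (q : k) (n : ℕ) : ∀ j, (1 - q ^ (j + 1)) * q ^ j * qbinom q n (j + 1) =
    (q ^ j - q ^ n) * qbinom q n j := by
  induction n with
  | zero =>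
    intro j
    cases j with
    | zero => simp [qbinom]
    | succ j => simp [qbinom]
  | succ n ih =>
    intro j
    cases j with
    | zero =>
      have h := ih 0
      have e : qbinom q (n + 1) (0 + 1) =
        qbinom q n 0 + q ^ (0 + 1) * qbinom q n (0 + 1) := rfl
      rw [e]
      rw [qbinom_zero_right] at h ⊢
      rw [qbinom_zero_right]
      linear_combination q * h
    | succ j =>
      have h := ih j
      have h' := ih (j + 1)
      have e : qbinom q (n + 1) (j + 1 + 1) =
        qbinom q n (j + 1) + q ^ (j + 1 + 1) * qbinom q n (j + 1 + 1) := rfl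
      have e' : qbinom q (n + 1) (j + 1) =
        qbinom q n j + q ^ (j + 1) * qbinom q n (j + 1) := rfl
      rw [e, e']
      linear_combination q * h + q ^ (j + 2) * h'

theorem qbinom_eq_zero {q : k} {n : ℕ} (hq : IsPrimitiveRoot q n) :
    ∀ j, j + 1 < n → qbinom q n (j + 1) = 0 := by
  intro j
  induction j with
  | zero =>
    intro hj
    have h := qbinom_step q n 0
    rw [hq.pow_eq_one] at h
    have h1 : (1 - q ^ (0 + 1)) ≠ 0 := sub_ne_zero.2
      (hq.pow_ne_one_of_pos_of_lt (by omega) hj).symm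
    simp only [pow_zero, mul_one, sub_self, zero_mul] at h
    exact (mul_eq_zero.1 h).resolve_left h1
  | succ j ih =>
    intro hj
    have h := qbinom_step q n (j + 1)
    rw [ih (by omega), mul_zero] at h
    have h1 : (1 - q ^ (j + 1 + 1)) ≠ 0 := sub_ne_zero.2
      (hq.pow_ne_one_of_pos_of_lt (by omega) hj).symm
    have h2 : q ^ (j + 1) ≠ 0 := pow_ne_zero _ (hq.ne_zero (by omega))
    exact (mul_eq_zero.1 h).resolve_left (mul_ne_zero h1 h2)

variable {B : Type v} [Ring B] [Algebra k B]

theorem mul_pow_of_qcomm {q : k} {a b : B} (h : b * a = q • (a * b)) (j : ℕ) :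
    b * a ^ j = q ^ j • (a ^ j * b) := by
  induction j with
  | zero => simp
  | succ j ih =>
    rw [pow_succ, ← mul_assoc, ih, smul_mul_assoc, mul_assoc, h, mul_smul_comm, smul_smul,
      ← mul_assoc, ← pow_succ]

theorem add_pow_of_qcomm {q : k} {a b : B} (h : b * a = q • (a * b)) (n : ℕ) :
    (a + b) ^ n = ∑ j ∈ Finset.range (n + 1), qbinom q n j • (a ^ j * b ^ (n - j)) := by
  induction n with
  | zero => simp [qbinom]
  | succ n ih =>
    rw [pow_succ', ih, add_mul, Finset.mul_sum, Finset.mul_sum]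
    have h2 : ∀ j ∈ Finset.range (n + 1), b * qbinom q n j • (a ^ j * b ^ (n - j)) =
        (q ^ j * qbinom q n j) • (a ^ j * b ^ (n + 1 - j)) := by
      intro j hj
      have : n + 1 - j = (n - j) + 1 := by have := Finset.mem_range.1 hj; omega
      rw [mul_smul_comm, ← mul_assoc, mul_pow_of_qcomm h, smul_mul_assoc, smul_smul, this,
        pow_succ', mul_assoc, mul_comm]
    rw [Finset.sum_congr rfl h2, Finset.sum_range_succ' (n := n + 1),
      Finset.sum_range_succ' (fun j => (q ^ j * qbinom q n j) • (a ^ j * b ^ (n + 1 - j)))]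
    have h3 : ∑ j ∈ Finset.range (n + 1),
        qbinom q (n + 1) (j + 1) • (a ^ (j + 1) * b ^ (n + 1 - (j + 1))) =
        ∑ j ∈ Finset.range (n + 1), a * qbinom q n j • (a ^ j * b ^ (n - j)) +
        ∑ j ∈ Finset.range (n + 1),
          (q ^ (j + 1) * qbinom q n (j + 1)) • (a ^ (j + 1) * b ^ (n + 1 - (j + 1))) := by
      rw [← Finset.sum_add_distrib]
      refine Finset.sum_congr rfl fun j _ => ?_
      rw [Nat.add_sub_add_right, mul_smul_comm, ← mul_assoc, ← pow_succ', ← add_smul]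
      rfl
    rw [h3, Finset.sum_range_succ (n := n) (fun j =>
      (q ^ (j + 1) * qbinom q n (j + 1)) • (a ^ (j + 1) * b ^ (n + 1 - (j + 1)))),
      qbinom_of_lt q n (n + 1) (by omega)]
    simp [qbinom_zero_right, add_assoc]

theorem add_pow_of_primitiveRoot {q : k} {n : ℕ} (hq : IsPrimitiveRoot q n) (hn : 0 < n)
    {a b : B} (h : b * a = q • (a * b)) : (a + b) ^ n = a ^ n + b ^ n := by
  rw [add_pow_of_qcomm h]
  obtain ⟨m, rfl⟩ := Nat.exists_eq_succ_of_ne_zero hn.ne'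
  rw [Finset.sum_range_succ, Finset.sum_range_succ', Finset.sum_eq_zero]
  · simp [qbinom_zero_right, qbinom_self, add_comm]
  · intro j hj
    rw [qbinom_eq_zero hq j (by have := Finset.mem_range.1 hj; omega), zero_smul]

end QuantumBinomial

/-! ### The Hopf algebra of a group datum -/

/-- A group datum `(G, χ, g, μ)` over `k`: a linear character `χ` of `G`, a central element `g` of
`G` and a scalar `μ` such that, with `n` the order of `χ(g)`, either `χ ^ n = 1` or
`μ (g ^ n - 1) = 0` in the group algebra. -/
structure GroupDatum (k : Type u) (G : Type v) [Field k] [Group G] where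
  /-- the linear character -/
  χ : G →* kˣ
  /-- the central element -/
  g : G
  g_mem_center : g ∈ Subgroup.center G
  /-- the scalar -/
  μ : k
  condition : χ ^ orderOf (χ g) = 1 ∨
    μ • (MonoidAlgebra.of k G (g ^ orderOf (χ g)) - 1) = 0

section HopfAlgebra

variable {k : Type u} {G : Type v} [Field k] [Group G]

namespace GroupDatum

/-- The order `n` of `χ(g)`. -/
noncomputable def n (D : GroupDatum k G) : ℕ :=
  orderOf (D.χ D.g)

/-- The datum is of non-nilpotent type: `μ (g ^ n - 1) ≠ 0` in the group algebra and
`χ ^ n = 1`. -/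
def IsNonNilpotent (D : GroupDatum k G) : Prop :=
  D.μ • (MonoidAlgebra.of k G (D.g ^ D.n) - 1) ≠ 0 ∧ D.χ ^ D.n = 1

/-- The generators of the Hopf algebra of a group datum: `y` and the elements of `G`. -/
inductive Gen (G : Type v) : Type v
  | y : Gen G
  | grp (h : G) : Gen G

/-- The defining relations: those of `G`, together with `y ^ n = μ (g ^ n - 1)` and
`y h = χ(h) h y` for `h ∈ G`. -/
inductive Rel (D : GroupDatum k G) : FreeAlgebra k (Gen G) → FreeAlgebra k (Gen G) → Prop
  | one : Rel D (FreeAlgebra.ι k (Gen.grp 1)) 1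
  | mul (h h' : G) : Rel D (FreeAlgebra.ι k (Gen.grp (h * h')))
      (FreeAlgebra.ι k (Gen.grp h) * FreeAlgebra.ι k (Gen.grp h'))
  | y_pow : Rel D (FreeAlgebra.ι k Gen.y ^ D.n)
      (D.μ • (FreeAlgebra.ι k (Gen.grp (D.g ^ D.n)) - 1))
  | y_mul (h : G) : Rel D (FreeAlgebra.ι k Gen.y * FreeAlgebra.ι k (Gen.grp h))
      ((D.χ h : k) • (FreeAlgebra.ι k (Gen.grp h) * FreeAlgebra.ι k Gen.y))

/-- The Hopf algebra `H_D` of a group datum `D`, as an algebra. -/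
def Hopf (D : GroupDatum k G) : Type (max u v) :=
  RingQuot (Rel D)

variable (D : GroupDatum k G)

noncomputable instance : Ring (Hopf D) :=
  inferInstanceAs (Ring (RingQuot (Rel D)))

noncomputable instance : Algebra k (Hopf D) :=
  inferInstanceAs (Algebra k (RingQuot (Rel D)))

namespace Hopf

/-- The quotient map from the free algebra. -/
noncomputable def proj : FreeAlgebra k (Gen G) →ₐ[k] Hopf D :=
  RingQuot.mkAlgHom k (Rel D)

/-- The generator `y`. -/
noncomputable def Y : Hopf D :=
  proj D (FreeAlgebra.ι k Gen.y)

/-- The inclusion of `G`. -/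
noncomputable def grp : G →* Hopf D where
  toFun h := proj D (FreeAlgebra.ι k (Gen.grp h))
  map_one' := (RingQuot.mkAlgHom_rel k Rel.one).trans (map_one (proj D))
  map_mul' h h' := (RingQuot.mkAlgHom_rel k (Rel.mul h h')).trans (map_mul (proj D) _ _)

theorem Y_pow : Y D ^ D.n = D.μ • (grp D (D.g ^ D.n) - 1) := by
  have h : proj D _ = proj D _ := RingQuot.mkAlgHom_rel k (Rel.y_pow (D := D))
  rw [map_pow, map_smul, map_sub, map_one] at h
  exact h

theorem Y_mul_grp (h : G) : Y D * grp D h = (D.χ h : k) • (grp D h * Y D) := by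
  have h : proj D _ = proj D _ := RingQuot.mkAlgHom_rel k (Rel.y_mul (D := D) h)
  simpa only [map_mul, map_smul] using! h

theorem grp_comm (h : G) : grp D D.g * grp D h = grp D h * grp D D.g := by
  rw [← map_mul, ← map_mul, Subgroup.mem_center_iff.1 D.g_mem_center h]

variable {D}

/-- Algebra homomorphisms out of `H_D` are given by the images of the generators. -/
noncomputable def lift {B : Type*} [Ring B] [Algebra k B] (y : B) (t : G →* B)
    (hy : y ^ D.n = D.μ • (t (D.g ^ D.n) - 1))
    (hyt : ∀ h, y * t h = (D.χ h : k) • (t h * y)) : Hopf D →ₐ[k] B :=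
  RingQuot.liftAlgHom k ⟨FreeAlgebra.lift k (fun x => match x with
    | Gen.y => y
    | Gen.grp h => t h), by
    intro a b hab
    cases hab with
    | one => simp
    | mul h h' => simp
    | y_pow => simpa using! hy
    | y_mul h => simpa using! hyt h⟩

section lift
variable {B : Type*} [Ring B] [Algebra k B] (y : B) (t : G →* B)
    (hy : y ^ D.n = D.μ • (t (D.g ^ D.n) - 1))
    (hyt : ∀ h, y * t h = (D.χ h : k) • (t h * y))

theorem lift_Y : lift y t hy hyt (Y D) = y := by
  refine (RingQuot.liftAlgHom_mkAlgHom_apply k _ _ _).trans ?_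
  simp

theorem lift_grp (h : G) : lift y t hy hyt (grp D h) = t h := by
  refine (RingQuot.liftAlgHom_mkAlgHom_apply k _ _ _).trans ?_
  simp

end lift

theorem induction {p : Hopf D → Prop} (hs : ∀ c : k, p (algebraMap k _ c)) (hY : p (Y D))
    (hg : ∀ h, p (grp D h)) (ha : ∀ a b, p a → p b → p (a + b))
    (hm : ∀ a b, p a → p b → p (a * b)) (x : Hopf D) : p x := by
  obtain ⟨x, rfl⟩ := RingQuot.mkAlgHom_surjective k (Rel D) x
  change p (proj D x)
  induction x using FreeAlgebra.induction with
  | grade0 c => rw [AlgHom.commutes]; exact hs c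
  | grade1 x =>
    cases x with
    | y => exact hY
    | grp h => exact hg h
  | mul a b h h' => rw [map_mul]; exact hm _ _ h h'
  | add a b h h' => rw [map_add]; exact ha _ _ h h'

theorem algHom_ext {B : Type*} [Ring B] [Algebra k B] {f f' : Hopf D →ₐ[k] B}
    (hY : f (Y D) = f' (Y D)) (hg : ∀ h, f (grp D h) = f' (grp D h)) : f = f' :=
  AlgHom.ext fun x => by
    induction x using induction with
    | hs c => rw [AlgHom.commutes, AlgHom.commutes]
    | hY => exact hY
    | hg h => exact hg h
    | ha a b h h' => rw [map_add, map_add, h, h']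
    | hm a b h h' => rw [map_mul, map_mul, h, h']

theorem isPrimitiveRoot : IsPrimitiveRoot (D.χ D.g : k) D.n :=
  IsPrimitiveRoot.coe_units_iff.2 (IsPrimitiveRoot.orderOf (D.χ D.g))

variable (D)

/-- The homomorphism `h ↦ h ⊗ h`. -/
noncomputable def grpTensor : G →* Hopf D ⊗[k] Hopf D where
  toFun h := grp D h ⊗ₜ[k] grp D h
  map_one' := by simp [Algebra.TensorProduct.one_def]
  map_mul' h h' := by simp

theorem grpTensor_apply (h : G) : grpTensor D h = grp D h ⊗ₜ[k] grp D h :=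
  rfl

theorem grp_inv_mul_Y (h : G) : grp D h⁻¹ * Y D = (D.χ h : k) • (Y D * grp D h⁻¹) := by
  rw [Y_mul_grp, smul_smul, ← Units.val_mul, ← map_mul]
  simp

theorem neg_one_pow_mul_pow_sum {q : k} {n : ℕ} (hq : IsPrimitiveRoot q n) (hn : 0 < n) :
    (-1) ^ n * q ^ (∑ i ∈ Finset.range n, i) = -1 := by
  have hs := Finset.sum_range_id_mul_two n
  rcases Nat.even_or_odd' n with ⟨m, rfl | rfl⟩
  · have h1 : ∑ i ∈ Finset.range (2 * m), i = m * (2 * m - 1) := by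
      refine Nat.eq_of_mul_eq_mul_right (by norm_num : 0 < 2) (hs.trans ?_)
      ring
    have h2 : q ^ m = -1 := by
      have h3 : q ^ m * q ^ m = 1 := by rw [← pow_add, ← two_mul, hq.pow_eq_one]
      exact (mul_self_eq_one_iff.1 h3).resolve_left
        (hq.pow_ne_one_of_pos_of_lt (by omega) (by omega))
    rw [h1, pow_mul q, h2, ← pow_add]
    exact Odd.neg_one_pow ⟨2 * m - 1, by omega⟩
  · have h1 : ∑ i ∈ Finset.range (2 * m + 1), i = (2 * m + 1) * m := by
      refine Nat.eq_of_mul_eq_mul_right (by norm_num : 0 < 2) (hs.trans ?_)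
      rw [Nat.add_sub_cancel]
      ring
    rw [h1, pow_mul q, hq.pow_eq_one, one_pow, mul_one]
    exact Odd.neg_one_pow ⟨m, rfl⟩

theorem Y_mul_grp_inv_pow (j : ℕ) : (Y D * grp D D.g⁻¹) ^ j =
    (D.χ D.g : k) ^ (∑ i ∈ Finset.range j, i) • (Y D ^ j * grp D D.g⁻¹ ^ j) := by
  induction j with
  | zero => simp
  | succ j ih =>
    rw [pow_succ', ih, mul_smul_comm, mul_assoc, ← mul_assoc (grp D D.g⁻¹),
      mul_pow_of_qcomm (grp_inv_mul_Y D D.g), smul_mul_assoc, mul_smul_comm, smul_smul,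
      Finset.sum_range_succ, pow_add, mul_assoc, ← pow_succ', ← mul_assoc, ← pow_succ']

open MulOpposite in
/-- The homomorphism `h ↦ h⁻¹` to the opposite algebra. -/
noncomputable def grpInv : G →* (Hopf D)ᵐᵒᵖ where
  toFun h := op (grp D h⁻¹)
  map_one' := by simp
  map_mul' h h' := by simp

variable [Finite G]

theorem n_pos : 0 < D.n :=
  orderOf_pos_iff.2 (D.χ.isOfFinOrder (isOfFinOrder_of_finite D.g))

/-- The comultiplication: `Δ(y) = y ⊗ g + 1 ⊗ y` and `Δ(h) = h ⊗ h`. -/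
noncomputable def comul : Hopf D →ₐ[k] Hopf D ⊗[k] Hopf D :=
  lift (Y D ⊗ₜ[k] grp D D.g + 1 ⊗ₜ[k] Y D) (grpTensor D)
    (by
      rw [add_pow_of_primitiveRoot isPrimitiveRoot (n_pos D)]
      · rw [Algebra.TensorProduct.tmul_pow, Algebra.TensorProduct.tmul_pow, Y_pow, one_pow,
          ← map_pow, grpTensor_apply, ← TensorProduct.smul_tmul', TensorProduct.tmul_smul,
          ← smul_add, TensorProduct.sub_tmul, TensorProduct.tmul_sub,
          Algebra.TensorProduct.one_def]
        congr 1
        abel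
      · simp only [Algebra.TensorProduct.tmul_mul_tmul, one_mul, mul_one, Y_mul_grp,
          TensorProduct.tmul_smul])
    (by
      intro h
      rw [grpTensor_apply]
      simp only [add_mul, mul_add,
        Algebra.TensorProduct.tmul_mul_tmul, one_mul, mul_one, Y_mul_grp, grp_comm,
        TensorProduct.tmul_smul, ← TensorProduct.smul_tmul', smul_add])

theorem comul_Y : comul D (Y D) = Y D ⊗ₜ[k] grp D D.g + 1 ⊗ₜ[k] Y D :=
  lift_Y _ _ _ _

theorem comul_grp (h : G) : comul D (grp D h) = grp D h ⊗ₜ[k] grp D h :=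
  lift_grp _ _ _ _ h

/-- The counit: `ε(y) = 0` and `ε(h) = 1`. -/
noncomputable def counit : Hopf D →ₐ[k] k :=
  lift 0 1 (by simp [(n_pos D).ne']) (by simp)

theorem counit_Y : counit D (Y D) = 0 :=
  lift_Y _ _ _ _

theorem counit_grp (h : G) : counit D (grp D h) = 1 :=
  lift_grp _ _ _ _ h

noncomputable instance : Bialgebra k (Hopf D) :=
  Bialgebra.ofAlgHom (comul D) (counit D)
    (algHom_ext
      (by simp [comul_Y, comul_grp, TensorProduct.add_tmul, TensorProduct.tmul_add,
        Algebra.TensorProduct.one_def, add_assoc])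
      (fun h => by simp [comul_grp]))
    (algHom_ext (by simp [comul_Y, counit_Y])
      (fun h => by simp [comul_grp, counit_grp]))
    (algHom_ext (by simp [comul_Y, counit_Y, counit_grp])
      (fun h => by simp [comul_grp, counit_grp]))

open MulOpposite in
/-- The antipode as a homomorphism to the opposite algebra: `S(y) = -y g⁻¹` and `S(h) = h⁻¹`. -/
noncomputable def antipodeOp : Hopf D →ₐ[k] (Hopf D)ᵐᵒᵖ :=
  lift (op (-(Y D * grp D D.g⁻¹))) (grpInv D)
    (by
      change op ((-(Y D * grp D D.g⁻¹)) ^ D.n) =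
        op (D.μ • (grp D (D.g ^ D.n)⁻¹ - 1))
      congr 1
      have h1 : (-(Y D * grp D D.g⁻¹)) ^ D.n =
          ((-1) ^ D.n * (D.χ D.g : k) ^ (∑ i ∈ Finset.range D.n, i)) •
            (Y D ^ D.n * grp D D.g⁻¹ ^ D.n) := by
        rw [← neg_one_smul k, smul_pow, Y_mul_grp_inv_pow, smul_smul]
      rw [h1, neg_one_pow_mul_pow_sum isPrimitiveRoot (n_pos D), Y_pow, smul_mul_assoc,
        ← map_pow, sub_mul, ← map_mul, inv_pow, mul_inv_cancel, map_one, one_mul, neg_one_smul,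
        ← smul_neg, neg_sub])
    (by
      intro h
      change op (grp D h⁻¹ * -(Y D * grp D D.g⁻¹)) =
        op ((D.χ h : k) • (-(Y D * grp D D.g⁻¹) * grp D h⁻¹))
      congr 1
      have hc : grp D D.g⁻¹ * grp D h⁻¹ = grp D h⁻¹ * grp D D.g⁻¹ := by
        rw [← map_mul, ← map_mul, ← mul_inv_rev, ← mul_inv_rev,
          Subgroup.mem_center_iff.1 D.g_mem_center h]
      rw [mul_neg, neg_mul, ← mul_assoc, grp_inv_mul_Y, mul_assoc (Y D) (grp D D.g⁻¹), hc,
        smul_mul_assoc, smul_neg, mul_assoc])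

/-- The antipode. -/
noncomputable def antipode : Hopf D →ₗ[k] Hopf D :=
  (MulOpposite.opLinearEquiv k).symm.toLinearMap ∘ₗ (antipodeOp D).toLinearMap

theorem antipode_Y : antipode D (Y D) = -(Y D * grp D D.g⁻¹) :=
  congrArg MulOpposite.unop (lift_Y _ _ _ _)

theorem antipode_grp (h : G) : antipode D (grp D h) = grp D h⁻¹ :=
  congrArg MulOpposite.unop (lift_grp _ _ _ _ h)

theorem antipode_mul (a b : Hopf D) : antipode D (a * b) = antipode D b * antipode D a :=
  congrArg MulOpposite.unop (map_mul (antipodeOp D) a b)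

theorem antipode_algebraMap (c : k) : antipode D (algebraMap k _ c) = algebraMap k _ c :=
  congrArg MulOpposite.unop ((antipodeOp D).commutes c)

theorem antipode_one : antipode D 1 = 1 :=
  congrArg MulOpposite.unop (map_one (antipodeOp D))

theorem mul_antipode_left (x : Hopf D) :
    LinearMap.mul' k _ ((antipode D).rTensor _ (comul D x)) = algebraMap k _ (counit D x) := by
  induction x using induction with
  | hs c => simp [Algebra.TensorProduct.algebraMap_apply, antipode_algebraMap]
  | hY =>
    rw [comul_Y, counit_Y]
    simp [antipode_Y, antipode_one, mul_assoc, ← map_mul]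
  | hg h =>
    rw [comul_grp, counit_grp]
    simp [antipode_grp, ← map_mul]
  | ha a b h h' => simp only [map_add, h, h']
  | hm a b h h' =>
    have key : ∀ t u : Hopf D ⊗[k] Hopf D,
        LinearMap.mul' k _ ((antipode D).rTensor _ t) = algebraMap k _ (counit D a) →
        LinearMap.mul' k _ ((antipode D).rTensor _ (t * u)) =
          algebraMap k _ (counit D a) * LinearMap.mul' k _ ((antipode D).rTensor _ u) := by
      intro t u ht
      induction u using TensorProduct.induction_on with
      | zero => simp
      | add u w hu hw => simp only [mul_add, map_add, hu, hw]
      | tmul b c =>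
        have h2 : LinearMap.mul' k _ ((antipode D).rTensor _ (t * b ⊗ₜ[k] c)) =
            antipode D b * LinearMap.mul' k _ ((antipode D).rTensor _ t) * c := by
          clear ht
          induction t using TensorProduct.induction_on with
          | zero => simp
          | add u w hu hw => simp only [map_add, add_mul, mul_add, hu, hw]
          | tmul x z => simp [antipode_mul, mul_assoc]
        rw [h2, ht, ← Algebra.commutes, mul_assoc]
        simp
    rw [map_mul, key _ _ h, h', map_mul, map_mul]

theorem mul_antipode_right (x : Hopf D) :
    LinearMap.mul' k _ ((antipode D).lTensor _ (comul D x)) = algebraMap k _ (counit D x) := by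
  induction x using induction with
  | hs c => simp [Algebra.TensorProduct.algebraMap_apply, antipode_one]
  | hY =>
    rw [comul_Y, counit_Y]
    simp [antipode_Y, antipode_grp]
  | hg h =>
    rw [comul_grp, counit_grp]
    simp [antipode_grp, ← map_mul]
  | ha a b h h' => simp only [map_add, h, h']
  | hm a b h h' =>
    have key : ∀ t u : Hopf D ⊗[k] Hopf D,
        LinearMap.mul' k _ ((antipode D).lTensor _ u) = algebraMap k _ (counit D b) →
        LinearMap.mul' k _ ((antipode D).lTensor _ (t * u)) =
          LinearMap.mul' k _ ((antipode D).lTensor _ t) * algebraMap k _ (counit D b) := by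
      intro t u hu
      induction t using TensorProduct.induction_on with
      | zero => simp
      | add t w ht hw => simp only [add_mul, map_add, ht, hw]
      | tmul x z =>
        have h2 : LinearMap.mul' k _ ((antipode D).lTensor _ (x ⊗ₜ[k] z * u)) =
            x * LinearMap.mul' k _ ((antipode D).lTensor _ u) * antipode D z := by
          clear hu
          induction u using TensorProduct.induction_on with
          | zero => simp
          | add u w hu hw => simp only [map_add, add_mul, mul_add, hu, hw]
          | tmul b c => simp [antipode_mul, mul_assoc]
        rw [h2, hu, mul_assoc, Algebra.commutes, ← mul_assoc]
        simp
    rw [map_mul, key _ _ h', h, map_mul, map_mul]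

noncomputable instance : HopfAlgebra k (Hopf D) where
  antipode := antipode D
  mul_antipode_rTensor_comul := LinearMap.ext (mul_antipode_left D)
  mul_antipode_lTensor_comul := LinearMap.ext (mul_antipode_right D)

end Hopf
end GroupDatum
end HopfAlgebra

end PointedHopf

/-! Write q = χ(g), a primitive n-th root of unity, and let R be the ring of virtual characters of
G. A module splits into a part on which g ^ n = 1 and a part on which g ^ n - 1 is injective
(`exists_splitting`). On the second part y is injective, and this part is induced from G
(`iso_ind_of_injective`). On the first part y ^ n = 0, and it is a sum of modules of Jordan type
(`jord`), each having a length l ≤ n and a representation V of G as coefficients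
(`exists_jord_summand`); those of length n are again induced. The induced modules span an ideal I,
because ind W ⊗ M ≅ ind (W ⊗ res M) and similarly on the other side (`ind_tensor`, `tensor_ind`).

The coefficients at the lengths 1, ..., n - 1 define additive maps from r(H) to R that vanish on I
(`multiplicity`). Let U_l be the module of length l with trivial coefficients (`uniserial`). The
fusion rule U_2 ⊗ U_l ≅ U_(l+1) ⊕ χ U_(l-1) for 1 < l < n (`uniserial_two_tensor`) shows that each
element of r(H) acts on R ^ (n-1) by a polynomial in one tridiagonal matrix T, with 1 below the
diagonal and χ above it (`mem_matrixActionSubring`). Since χ* χ = 1, the adjoint of T is χ* T, so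
all these matrices are normal. An idempotent E therefore gives a normal idempotent matrix A, whose
first column is the vector of multiplicities of E. Let ε be the multiplicity of the trivial
character; the form ε(a* b) on R is positive definite. Normality gives A₀₀ = (A* A)₀₀, hence t² ≤ t
for the integer t = ε(A₀₀). If t = 0, the first column of A vanishes (`matrix_idempotent_corner`);
if t = 1, the same applies to 1 - E.

So E may be assumed to lie in I. The character of an induced module vanishes at g, so E restricts to
an idempotent virtual character of G with a zero; the size of its support is divisible by |G|, hence
it is 0. Then E = [M] - [N] with M and N isomorphic over G, so every induced class times E is 0. As
E is itself a combination of induced classes, E = E * E = 0. -/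

namespace PointedHopf

/-! ### The Green ring: classes of modules and additive maps out of it. -/

section GreenRingAPI

variable {k : Type u} {A : Type v} [Field k] [Ring A] [Bialgebra k A]

namespace FDModule

theorem Iso.refl (M : FDModule k A) : Iso M M :=
  (isoSetoid k A).iseqv.refl M

theorem Iso.symm {M N : FDModule k A} (h : Iso M N) : Iso N M :=
  (isoSetoid k A).iseqv.symm h

theorem Iso.trans {M N P : FDModule k A} (h : Iso M N) (h' : Iso N P) : Iso M P :=
  (isoSetoid k A).iseqv.trans h h'

theorem tensor_directSum (M N P : FDModule k A) :
    Iso (M.tensor (N.directSum P)) ((M.tensor N).directSum (M.tensor P)) := by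
  refine ⟨TensorProduct.prodRight k k M.carrier N.carrier P.carrier, fun a x => ?_⟩
  revert x
  suffices h : (TensorProduct.prodRight k k M.carrier N.carrier P.carrier).toLinearMap ∘ₗ
      (M.tensor (N.directSum P)).action a = ((M.tensor N).directSum (M.tensor P)).action a ∘ₗ
        (TensorProduct.prodRight k k M.carrier N.carrier P.carrier).toLinearMap from
    fun x => LinearMap.congr_fun h x
  refine TensorProduct.ext' fun m x => ?_
  obtain ⟨n, p⟩ := x
  have h1 : (TensorProduct.prodRight k k M.carrier N.carrier P.carrier).toLinearMap ∘ₗ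
      (M.tensor (N.directSum P)).orbit (m ⊗ₜ[k] (n, p)) =
      ((M.tensor N).orbit (m ⊗ₜ[k] n)).prod ((M.tensor P).orbit (m ⊗ₜ[k] p)) := by
    have h2 : (TensorProduct.prodRight k k M.carrier N.carrier P.carrier).toLinearMap ∘ₗ
        TensorProduct.map (M.orbit m) ((N.directSum P).orbit (n, p)) =
        (TensorProduct.map (M.orbit m) (N.orbit n)).prod
          (TensorProduct.map (M.orbit m) (P.orbit p)) := by
      ext x y <;> rfl
    have h3 := congrArg (fun t => t ∘ₗ Coalgebra.comul) h2
    rw [orbit_tmul M N, orbit_tmul M P]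
    exact (congrArg (fun t => (TensorProduct.prodRight k k M.carrier N.carrier
      P.carrier).toLinearMap ∘ₗ t) (orbit_tmul M (N.directSum P) m (n, p))).trans h3
  exact LinearMap.congr_fun h1 a

theorem directSum_tensor (M N P : FDModule k A) :
    Iso ((M.directSum N).tensor P) ((M.tensor P).directSum (N.tensor P)) := by
  refine ⟨TensorProduct.prodLeft k k M.carrier N.carrier P.carrier, fun a x => ?_⟩
  revert x
  suffices h : (TensorProduct.prodLeft k k M.carrier N.carrier P.carrier).toLinearMap ∘ₗ
      ((M.directSum N).tensor P).action a = ((M.tensor P).directSum (N.tensor P)).action a ∘ₗ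
        (TensorProduct.prodLeft k k M.carrier N.carrier P.carrier).toLinearMap from
    fun x => LinearMap.congr_fun h x
  refine TensorProduct.ext' fun x p => ?_
  obtain ⟨m, n⟩ := x
  have h1 : (TensorProduct.prodLeft k k M.carrier N.carrier P.carrier).toLinearMap ∘ₗ
      ((M.directSum N).tensor P).orbit ((m, n) ⊗ₜ[k] p) =
      ((M.tensor P).orbit (m ⊗ₜ[k] p)).prod ((N.tensor P).orbit (n ⊗ₜ[k] p)) := by
    have h2 : (TensorProduct.prodLeft k k M.carrier N.carrier P.carrier).toLinearMap ∘ₗ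
        TensorProduct.map ((M.directSum N).orbit (m, n)) (P.orbit p) =
        (TensorProduct.map (M.orbit m) (P.orbit p)).prod
          (TensorProduct.map (N.orbit n) (P.orbit p)) := by
      ext x y <;> rfl
    have h3 := congrArg (fun t => t ∘ₗ Coalgebra.comul) h2
    rw [orbit_tmul M P, orbit_tmul N P]
    exact (congrArg (fun t => (TensorProduct.prodLeft k k M.carrier N.carrier
      P.carrier).toLinearMap ∘ₗ t) (orbit_tmul (M.directSum N) P (m, n) p)).trans h3
  exact LinearMap.congr_fun h1 a

end FDModule

open FDModule

theorem IsoClass.exists_rep (c : IsoClass k A) : ∃ M, IsoClass.mk M = c :=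
  Quotient.exists_rep c

theorem IsoClass.mk_tensor (M N : FDModule k A) :
    IsoClass.mk (M.tensor N) = IsoClass.mk M * IsoClass.mk N :=
  rfl

/-- The class of a module in the Green ring. -/
noncomputable def greenClass (M : FDModule k A) : GreenRing k A :=
  RingQuot.mkRingHom (GreenRel k A) (FreeAbelianGroup.of (IsoClass.mk M))

theorem greenClass_congr {M N : FDModule k A} (h : Iso M N) : greenClass M = greenClass N := by
  have : IsoClass.mk M = IsoClass.mk N := Quotient.sound h
  rw [greenClass, this, greenClass]

theorem greenClass_directSum (M N : FDModule k A) :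
    greenClass (M.directSum N) = greenClass M + greenClass N :=
  (RingQuot.mkRingHom_rel (GreenRel.directSum M N)).trans (map_add _ _ _)

theorem greenClass_tensor (M N : FDModule k A) :
    greenClass (M.tensor N) = greenClass M * greenClass N := by
  rw [greenClass, IsoClass.mk_tensor, FreeAbelianGroup.of_mul]
  exact map_mul (RingQuot.mkRingHom (GreenRel k A)) _ _

theorem greenClass_trivial : greenClass (trivial k A) = 1 :=
  map_one (RingQuot.mkRingHom (GreenRel k A))

theorem GreenRing.exists_eq_sub (x : GreenRing k A) :
    ∃ M N : FDModule k A, x = greenClass M - greenClass N := by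
  obtain ⟨x, rfl⟩ := RingQuot.mkRingHom_surjective (GreenRel k A) x
  induction x using FreeAbelianGroup.induction_on with
  | zero =>
    exact ⟨trivial k A, trivial k A, (map_zero _).trans (sub_self _).symm⟩
  | of x =>
    obtain ⟨M, rfl⟩ := x.exists_rep
    refine ⟨M.directSum (trivial k A), trivial k A, ?_⟩
    rw [greenClass_directSum, add_sub_cancel_right]
    rfl
  | neg x h =>
    obtain ⟨M, N, h⟩ := h
    exact ⟨N, M, (map_neg _ _).trans ((congrArg (fun t => -t) h).trans (neg_sub _ _))⟩
  | add x y h h' =>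
    obtain ⟨M, N, h⟩ := h
    obtain ⟨M', N', h'⟩ := h'
    refine ⟨M.directSum M', N.directSum N', ?_⟩
    refine (map_add _ _ _).trans ((congrArg₂ (fun s t => s + t) h h').trans ?_)
    rw [greenClass_directSum, greenClass_directSum]
    abel

theorem GreenRing.induction {p : GreenRing k A → Prop} (hm : ∀ M, p (greenClass M))
    (hs : ∀ x y, p x → p y → p (x - y)) (x : GreenRing k A) : p x := by
  obtain ⟨M, N, rfl⟩ := x.exists_eq_sub
  exact hs _ _ (hm M) (hm N)

section lift

variable {B : Type*} [AddCommGroup B] (f : FDModule k A → B)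
  (hf : ∀ M N, Iso M N → f M = f N) (hs : ∀ M N, f (M.directSum N) = f M + f N)

/-- The extension of a function of isomorphism classes to the free abelian group. -/
noncomputable def freeLift : FreeAbelianGroup (IsoClass k A) →+ B :=
  FreeAbelianGroup.lift (Quotient.lift f hf)

theorem freeLift_of (M : FDModule k A) :
    freeLift f hf (FreeAbelianGroup.of (IsoClass.mk M)) = f M :=
  FreeAbelianGroup.lift_apply_of _ _

include hs in
-- The map is only additive, while the quotient is by a two-sided ideal. The factors c and d make
-- the induction over the ring congruence work; for classes of modules, distributivity of ⊗ turns a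
-- multiplied relation into a direct sum relation again.
theorem freeLift_rel {x y : FreeAbelianGroup (IsoClass k A)}
    (h : RingQuot.Rel (GreenRel k A) x y) :
    ∀ c d, freeLift f hf (c * x * d) = freeLift f hf (c * y * d) := by
  induction h with
  | of h =>
    obtain ⟨M, N⟩ := h
    intro c d
    induction c using FreeAbelianGroup.induction_on with
    | zero => simp
    | neg c h => simp only [neg_mul, map_neg, h]
    | add c c' h h' => simp only [add_mul, map_add, h, h']
    | of c =>
      induction d using FreeAbelianGroup.induction_on with
      | zero => simp
      | neg d h => simp only [mul_neg, map_neg, h]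
      | add d d' h h' => simp only [mul_add, map_add, h, h']
      | of d =>
        obtain ⟨P, rfl⟩ := c.exists_rep
        obtain ⟨Q, rfl⟩ := d.exists_rep
        rw [mul_add, add_mul, map_add]
        simp only [← FreeAbelianGroup.of_mul, ← IsoClass.mk_tensor]
        rw [freeLift_of, freeLift_of, freeLift_of, ← hs]
        exact hf _ _ ((tensor_congr (tensor_directSum P M N) (Iso.refl Q)).trans
          (directSum_tensor _ _ Q))
  | add_left _ ih => intro c d; simp only [mul_add, add_mul, map_add, ih]
  | mul_left _ ih =>
    intro c d
    rw [← mul_assoc, mul_assoc _ _ d, ih, ← mul_assoc, mul_assoc _ _ d, ← mul_assoc, mul_assoc]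
    simp only [mul_assoc]
  | mul_right _ ih =>
    intro c d
    rw [← mul_assoc, ih, mul_assoc]
    simp only [mul_assoc]

/-- The additive map on the Green ring given by a function of isomorphism classes which is additive
on direct sums. -/
noncomputable def GreenRing.lift : GreenRing k A →+ B where
  toFun x := Quot.lift (freeLift f hf)
    (fun a b h => by simpa using freeLift_rel f hf hs h 1 1) x.toQuot
  map_zero' := by
    have : (0 : GreenRing k A) = ⟨Quot.mk _ 0⟩ := (RingQuot.zero_quot _).symm
    rw [this]
    exact map_zero (freeLift f hf)
  map_add' := by
    rintro ⟨⟨x⟩⟩ ⟨⟨y⟩⟩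
    have : (⟨Quot.mk _ x⟩ + ⟨Quot.mk _ y⟩ : GreenRing k A) = ⟨Quot.mk _ (x + y)⟩ :=
      RingQuot.add_quot _
    refine (congrArg (fun t : GreenRing k A => Quot.lift (freeLift f hf)
      (fun a b h => by simpa using freeLift_rel f hf hs h 1 1) t.toQuot) this).trans ?_
    exact map_add (freeLift f hf) x y

theorem GreenRing.lift_greenClass (M : FDModule k A) :
    GreenRing.lift f hf hs (greenClass M) = f M := by
  rw [greenClass, RingQuot.mkRingHom_def]
  exact FreeAbelianGroup.lift_apply_of _ _

end lift

end GreenRingAPI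

/-! ### Splitting by a linear section. -/

section Splitting

variable {k V L : Type*} [Field k] [AddCommGroup V] [Module k V] [AddCommGroup L] [Module k L]

/-- A linear map with a section splits its source. -/
def splitEquiv (θ : V →ₗ[k] L) (s : L →ₗ[k] V) (h : ∀ x, θ (s x) = x) :
    V ≃ₗ[k] L × LinearMap.ker θ where
  toFun v := (θ v, ⟨v - s (θ v), by simp [h]⟩)
  map_add' v w := by
    ext
    · simp
    · simp only [map_add, Prod.snd_add, Submodule.coe_add]; abel
  map_smul' c v := by
    ext
    · simp
    · simp [smul_sub]
  invFun x := s x.1 + x.2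
  left_inv v := by simp
  right_inv x := by
    have := x.2.2
    rw [LinearMap.mem_ker] at this
    ext <;> simp [h, this]

end Splitting

/-! ### Representations of a finite group and complete reducibility. -/

section Representations

variable {k : Type u} {G : Type v} [Field k] [Group G]

section Average

variable {V W : Type*} [AddCommGroup V] [Module k V] [AddCommGroup W] [Module k W]
  (ρ : Representation k G V) (σ : Representation k G W)

/-- The average of the conjugates of a linear map between two representations. -/
noncomputable def averageHom [Fintype G] (s : V →ₗ[k] W) : V →ₗ[k] W :=
  (Fintype.card G : k)⁻¹ • ∑ h : G, σ h ∘ₗ s ∘ₗ ρ h⁻¹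

theorem averageHom_apply [Fintype G] (s : V →ₗ[k] W) (v : V) :
    averageHom ρ σ s v = (Fintype.card G : k)⁻¹ • ∑ h : G, σ h (s (ρ h⁻¹ v)) := by
  simp [averageHom]

theorem averageHom_equivariant [Fintype G] (s : V →ₗ[k] W) (h : G) (v : V) :
    averageHom ρ σ s (ρ h v) = σ h (averageHom ρ σ s v) := by
  rw [averageHom_apply, averageHom_apply, map_smul, map_sum]
  congr 1
  refine Fintype.sum_equiv (Equiv.mulLeft h⁻¹) _ _ fun x => ?_
  rw [Equiv.coe_mulLeft, ← Module.End.mul_apply (σ h), ← map_mul, ← Module.End.mul_apply (ρ x⁻¹),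
    ← map_mul]
  simp

variable [CharZero k] [Finite G]

/-- A surjective equivariant map has an equivariant section. -/
theorem exists_equivariant_section (f : V →ₗ[k] W) (hf : ∀ h v, f (ρ h v) = σ h (f v))
    (hs : Function.Surjective f) :
    ∃ s : W →ₗ[k] V, (∀ h w, s (σ h w) = ρ h (s w)) ∧ ∀ w, f (s w) = w := by
  have := Fintype.ofFinite G
  obtain ⟨s, hs⟩ := f.exists_rightInverse_of_surjective (LinearMap.range_eq_top.2 hs)
  refine ⟨averageHom σ ρ s, averageHom_equivariant σ ρ s, fun w => ?_⟩
  have hs' : ∀ w, f (s w) = w := LinearMap.congr_fun hs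
  rw [averageHom_apply, map_smul, map_sum]
  have : ∀ h : G, f (ρ h (s (σ h⁻¹ w))) = w := fun h => by
    rw [hf, hs', ← Module.End.mul_apply, ← map_mul]
    simp
  simp only [this, Finset.sum_const, Finset.card_univ, ← Nat.cast_smul_eq_nsmul k, smul_smul]
  rw [inv_mul_cancel₀ (Nat.cast_ne_zero.2 Fintype.card_ne_zero), one_smul]

/-- An injective equivariant map has an equivariant retraction. -/
theorem exists_equivariant_retraction (f : V →ₗ[k] W) (hf : ∀ h v, f (ρ h v) = σ h (f v))
    (hi : Function.Injective f) :
    ∃ s : W →ₗ[k] V, (∀ h w, s (σ h w) = ρ h (s w)) ∧ ∀ v, s (f v) = v := by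
  have := Fintype.ofFinite G
  obtain ⟨s, hs⟩ := f.exists_leftInverse_of_injective (LinearMap.ker_eq_bot.2 hi)
  refine ⟨averageHom σ ρ s, averageHom_equivariant σ ρ s, fun v => ?_⟩
  have hs' : ∀ v, s (f v) = v := LinearMap.congr_fun hs
  rw [averageHom_apply]
  have : ∀ h : G, ρ h (s (σ h⁻¹ (f v))) = v := fun h => by
    rw [← hf, hs', ← Module.End.mul_apply, ← map_mul]
    simp
  simp only [this, Finset.sum_const, Finset.card_univ, ← Nat.cast_smul_eq_nsmul k, smul_smul]
  rw [inv_mul_cancel₀ (Nat.cast_ne_zero.2 Fintype.card_ne_zero), one_smul]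

end Average

/-- A finite dimensional representation of a group. -/
structure GroupRep (k : Type u) (G : Type v) [Field k] [Group G] where
  /-- the underlying space -/
  carrier : Type u
  [addCommGroup : AddCommGroup carrier]
  [module : Module k carrier]
  [finite : Module.Finite k carrier]
  /-- the action -/
  ρ : Representation k G carrier

attribute [instance] GroupRep.addCommGroup GroupRep.module GroupRep.finite

namespace GroupRep

/-- Isomorphism of representations. -/
def Iso (V W : GroupRep k G) : Prop :=
  ∃ e : V.carrier ≃ₗ[k] W.carrier, ∀ h v, e (V.ρ h v) = W.ρ h (e v)

theorem Iso.refl (V : GroupRep k G) : Iso V V :=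
  ⟨LinearEquiv.refl _ _, fun _ _ => rfl⟩

theorem Iso.symm {V W : GroupRep k G} (h : Iso V W) : Iso W V := by
  obtain ⟨e, he⟩ := h
  refine ⟨e.symm, fun h w => e.injective ?_⟩
  rw [he]
  simp

theorem Iso.trans {V W U : GroupRep k G} (h : Iso V W) (h' : Iso W U) : Iso V U := by
  obtain ⟨e, he⟩ := h
  obtain ⟨e', he'⟩ := h'
  exact ⟨e.trans e', fun h v => by simp [he, he']⟩

/-- The direct sum. -/
noncomputable abbrev prod (V W : GroupRep k G) : GroupRep k G where
  carrier := V.carrier × W.carrier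
  ρ := V.ρ.prod W.ρ

/-- The tensor product. -/
noncomputable abbrev tensor (V W : GroupRep k G) : GroupRep k G where
  carrier := V.carrier ⊗[k] W.carrier
  ρ := V.ρ.tprod W.ρ

/-- The dual representation. -/
noncomputable abbrev dual (V : GroupRep k G) : GroupRep k G where
  carrier := Module.Dual k V.carrier
  ρ := V.ρ.dual

/-- The one dimensional representation given by a linear character. -/
noncomputable abbrev ofChar (χ : G →* kˣ) : GroupRep k G where
  carrier := k
  ρ := ((Algebra.lmul k k : k →* Module.End k k).comp (Units.coeHom k)).comp χ

theorem ofChar_apply (χ : G →* kˣ) (h : G) (c : k) : (ofChar χ).ρ h c = (χ h : k) * c :=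
  rfl

/-- A stable subspace. -/
abbrev sub (V : GroupRep k G) (p : Submodule k V.carrier) (hp : ∀ h, ∀ v ∈ p, V.ρ h v ∈ p) :
    GroupRep k G where
  carrier := p
  ρ := V.ρ.subrepresentation p hp

/-- The character. -/
noncomputable def char (V : GroupRep k G) : G → k :=
  V.ρ.character

theorem Iso.char_eq {V W : GroupRep k G} (h : Iso V W) : V.char = W.char := by
  obtain ⟨e, he⟩ := h
  exact Representation.char_iso (Representation.Equiv.mk e fun h => LinearMap.ext fun v => he h v)

theorem char_prod (V W : GroupRep k G) : (V.prod W).char = V.char + W.char := by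
  ext h
  exact LinearMap.trace_prodMap' (V.ρ h) (W.ρ h)

theorem char_tensor (V W : GroupRep k G) : (V.tensor W).char = V.char * W.char :=
  Representation.char_tensor V.ρ W.ρ

theorem char_dual (V : GroupRep k G) (h : G) : V.dual.char h = V.char h⁻¹ :=
  Representation.char_dual V.ρ h

theorem char_ofChar (χ : G →* kˣ) (h : G) : (ofChar χ).char h = χ h := by
  have h1 : (ofChar χ).ρ h = (χ h : k) • LinearMap.id := LinearMap.ext fun c => rfl
  refine (congrArg (LinearMap.trace k k) h1).trans
    ((map_smul (LinearMap.trace k k) (χ h : k) LinearMap.id).trans ?_)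
  rw [LinearMap.trace_id]
  simp

theorem char_one (V : GroupRep k G) : V.char 1 = Module.finrank k V.carrier :=
  Representation.char_one V.ρ

theorem prod_assoc (U V W : GroupRep k G) : Iso (U.prod (V.prod W)) ((U.prod V).prod W) :=
  ⟨(LinearEquiv.prodAssoc k U.carrier V.carrier W.carrier).symm, fun _ _ => rfl⟩

theorem prod_congr {V V' : GroupRep k G} (U : GroupRep k G) (h : Iso V V') :
    Iso (U.prod V) (U.prod V') := by
  obtain ⟨e, he⟩ := h
  refine ⟨(LinearEquiv.refl k _).prodCongr e, fun h v => ?_⟩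
  exact Prod.ext rfl (he h v.2)

theorem tensor_congr {V V' U U' : GroupRep k G} (h : Iso V V') (h' : Iso U U') :
    Iso (V.tensor U) (V'.tensor U') := by
  obtain ⟨e, he⟩ := h
  obtain ⟨f, hf⟩ := h'
  refine ⟨TensorProduct.congr e f, fun h x => ?_⟩
  induction x using TensorProduct.induction_on with
  | zero => simp
  | tmul v u =>
    change e (V.ρ h v) ⊗ₜ[k] f (U.ρ h u) = V'.ρ h (e v) ⊗ₜ[k] U'.ρ h (f u)
    rw [he, hf]
  | add x y hx hy => rw [map_add, map_add, hx, hy, map_add, map_add]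

theorem tensor_apply_eq {V U : GroupRep k G} {h : G} (hV : ∀ v, V.ρ h v = v)
    (hU : ∀ v, U.ρ h v = v) (v) : (V.tensor U).ρ h v = v := by
  have h1 : V.ρ h = LinearMap.id := LinearMap.ext hV
  have h2 : U.ρ h = LinearMap.id := LinearMap.ext hU
  change TensorProduct.map (V.ρ h) (U.ρ h) v = v
  rw [h1, h2, TensorProduct.map_id, LinearMap.id_apply]

theorem Iso.apply_eq {V U : GroupRep k G} (e : Iso V U) {h : G} (hV : ∀ v, V.ρ h v = v) (v) :
    U.ρ h v = v := by
  obtain ⟨e, he⟩ := e.symm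
  apply e.injective
  rw [he, hV]

/-- An equivariant map with an equivariant section splits off its target. -/
theorem iso_prod_ker {V L : GroupRep k G} (θ : V.carrier →ₗ[k] L.carrier)
    (hθ : ∀ h v, θ (V.ρ h v) = L.ρ h (θ v)) (s : L.carrier →ₗ[k] V.carrier)
    (hs : ∀ h x, s (L.ρ h x) = V.ρ h (s x)) (h : ∀ x, θ (s x) = x) :
    Iso V (L.prod (V.sub (LinearMap.ker θ) fun h v hv => by
      rw [LinearMap.mem_ker] at hv ⊢
      rw [hθ, hv, map_zero])) := by
  refine ⟨splitEquiv θ s h, fun g v => Prod.ext (hθ g v) (Subtype.ext ?_)⟩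
  change V.ρ g v - s (θ (V.ρ g v)) = V.ρ g (v - s (θ v))
  rw [hθ, hs, map_sub]

variable [CharZero k] [Finite G]

/-- Two representations have decompositions with a common summand and disjoint complements. -/
theorem exists_common_summand (n : ℕ) : ∀ V W : GroupRep k G, Module.finrank k V.carrier = n →
    ∃ U V' W' : GroupRep k G, Iso V (U.prod V') ∧ Iso W (U.prod W') ∧
      ∀ f : Representation.IntertwiningMap V'.ρ W'.ρ, f = 0 := by
  induction n using Nat.strong_induction_on with
  | _ n ih =>
    intro V W hV
    by_cases h0 : ∀ f : Representation.IntertwiningMap V.ρ W.ρ, f = 0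
    · let Z : GroupRep k G := V.sub ⊥ fun h v hv => by
        rw [Submodule.mem_bot] at hv ⊢
        rw [hv, map_zero]
      have hZ : ∀ X : GroupRep k G, Iso X (Z.prod X) := fun X => by
        refine Iso.symm ⟨⟨LinearMap.snd k Z.carrier X.carrier, fun x => (0, x),
          fun x => ?_, fun x => rfl⟩, fun h x => rfl⟩
        exact Prod.ext (Subsingleton.elim (α := (⊥ : Submodule k V.carrier)) _ _) rfl
      exact ⟨Z, V, W, hZ V, hZ W, h0⟩
    · push Not at h0
      obtain ⟨f, hf⟩ := h0
      have he : ∀ h v, f.toLinearMap (V.ρ h v) = W.ρ h (f.toLinearMap v) := f.isIntertwining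
      -- By averaging, the image of a nonzero intertwiner is a summand of both V and W. Splitting it
      -- off lowers the dimension of V, so no decomposition into simple modules is needed.
      let U : GroupRep k G := W.sub (LinearMap.range f.toLinearMap) (by
        rintro h _ ⟨v, rfl⟩
        exact ⟨V.ρ h v, he h v⟩)
      let θ : V.carrier →ₗ[k] U.carrier := f.toLinearMap.rangeRestrict
      have hθ : ∀ h v, θ (V.ρ h v) = U.ρ h (θ v) := fun h v => Subtype.ext (he h v)
      obtain ⟨s, hs, hs'⟩ := exists_equivariant_section V.ρ U.ρ θ hθ
        f.toLinearMap.surjective_rangeRestrict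
      let i : U.carrier →ₗ[k] W.carrier := (LinearMap.range f.toLinearMap).subtype
      have hi : ∀ h v, i (U.ρ h v) = W.ρ h (i v) := fun h v => rfl
      obtain ⟨r, hr, hr'⟩ := exists_equivariant_retraction U.ρ W.ρ i hi
        (Submodule.subtype_injective _)
      have hV' := iso_prod_ker θ hθ s hs hs'
      have hW' := iso_prod_ker r hr i hi hr'
      generalize hA : V.sub (LinearMap.ker θ) _ = A at hV'
      generalize W.sub (LinearMap.ker r) _ = C at hW'
      have hlt : Module.finrank k A.carrier < n := by
        obtain ⟨e, -⟩ := hV'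
        have h1 := e.finrank_eq
        have h2 : Module.finrank k (U.prod A).carrier =
          Module.finrank k U.carrier + Module.finrank k A.carrier := Module.finrank_prod
        have h3 : 0 < Module.finrank k U.carrier := by
          refine Nat.pos_of_ne_zero fun h => hf ?_
          have := Module.finrank_zero_iff.1 h
          refine Representation.IntertwiningMap.ext (LinearMap.ext fun v => ?_)
          exact congrArg Subtype.val (Subsingleton.elim (θ v) 0)
        omega
      obtain ⟨U', V', W', h1, h2, h3⟩ := ih _ hlt A C rfl
      exact ⟨U.prod U', V', W', hV'.trans ((prod_congr U h1).trans (prod_assoc U U' V')),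
        hW'.trans ((prod_congr U h2).trans (prod_assoc U U' W')), h3⟩

end GroupRep

end Representations

/-! ### The ring of virtual characters and its inner product. -/

section VirtualCharacters

variable {k : Type u} {G : Type v} [Field k] [Group G]

open GroupRep

variable (k G) in
/-- The ring of virtual characters of a group. -/
noncomputable def virtualChar : Subring (G → k) where
  carrier := {f | ∃ V W : GroupRep k G, f = V.char - W.char}
  zero_mem' := ⟨ofChar 1, ofChar 1, (sub_self _).symm⟩
  one_mem' := by
    -- Writing 1 = (1 + 1) - 1 avoids a zero representation.
    refine ⟨(ofChar 1).prod (ofChar 1), ofChar 1, ?_⟩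
    rw [char_prod]
    ext h
    simp [char_ofChar]
  add_mem' := by
    rintro _ _ ⟨V, W, rfl⟩ ⟨V', W', rfl⟩
    refine ⟨V.prod V', W.prod W', ?_⟩
    rw [char_prod, char_prod]
    ring
  neg_mem' := by
    rintro _ ⟨V, W, rfl⟩
    exact ⟨W, V, by ring⟩
  mul_mem' := by
    rintro _ _ ⟨V, W, rfl⟩ ⟨V', W', rfl⟩
    refine ⟨(V.tensor V').prod (W.tensor W'), (V.tensor W').prod (W.tensor V'), ?_⟩
    simp only [char_prod, char_tensor]
    ring

/-- The character of a representation as a virtual character. -/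
noncomputable def GroupRep.vchar (V : GroupRep k G) : virtualChar k G :=
  ⟨V.char, V.prod (ofChar 1), ofChar 1, by rw [char_prod]; ring⟩

theorem GroupRep.coe_vchar (V : GroupRep k G) : (V.vchar : G → k) = V.char :=
  rfl

theorem GroupRep.Iso.vchar_eq {V W : GroupRep k G} (h : Iso V W) : V.vchar = W.vchar :=
  Subtype.ext h.char_eq

theorem GroupRep.vchar_prod (V W : GroupRep k G) : (V.prod W).vchar = V.vchar + W.vchar :=
  Subtype.ext (char_prod V W)

theorem GroupRep.vchar_tensor (V W : GroupRep k G) : (V.tensor W).vchar = V.vchar * W.vchar :=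
  Subtype.ext (char_tensor V W)

theorem GroupRep.vchar_ofChar_one : (ofChar 1 : GroupRep k G).vchar = 1 :=
  Subtype.ext (funext fun h => by simp [coe_vchar, char_ofChar])

theorem virtualChar.exists_eq_sub (f : virtualChar k G) :
    ∃ V W : GroupRep k G, f = V.vchar - W.vchar := by
  obtain ⟨f, V, W, rfl⟩ := f
  exact ⟨V, W, rfl⟩

/-- The conjugate `f(h⁻¹)` of a virtual character. -/
noncomputable instance : StarRing (virtualChar k G) where
  star f := ⟨fun h => f.1 h⁻¹, by
    obtain ⟨f, V, W, rfl⟩ := f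
    exact ⟨V.dual, W.dual, funext fun h => by simp [char_dual]⟩⟩
  star_involutive f := Subtype.ext (funext fun h => congrArg f.1 (inv_inv h))
  star_mul f f' := Subtype.ext (funext fun h => mul_comm _ _)
  star_add _ _ := rfl

theorem virtualChar.star_apply (f : virtualChar k G) (h : G) : (star f).1 h = f.1 h⁻¹ :=
  rfl

/-- The identity is an intertwiner, so it is 0 here and the space itself is zero. -/
theorem GroupRep.finrank_intertwining_self_eq_zero {V : GroupRep k G}
    (h : Module.finrank k (Representation.IntertwiningMap V.ρ V.ρ) = 0) : V.char = 0 := by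
  have h1 := Module.finrank_zero_iff.1 h
  have h2 : ∀ v, v = (0 : V.carrier) := fun v =>
    congrArg (fun f : Representation.IntertwiningMap V.ρ V.ρ => f v)
      (Subsingleton.elim (Representation.IntertwiningMap.id V.ρ) 0)
  ext g
  have h3 : V.ρ g = 0 := LinearMap.ext fun v => h2 _
  change LinearMap.trace k _ (V.ρ g) = 0
  rw [h3, map_zero]

variable [CharZero k]

theorem GroupRep.finrank_carrier_eq_zero_of_char_eq_zero {V : GroupRep k G} (h : V.char = 0) :
    Module.finrank k V.carrier = 0 := by
  have h1 := char_one V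
  rw [h] at h1
  exact Nat.cast_eq_zero.1 h1.symm

variable [Finite G]

/-- The inner product of characters is the dimension of the space of equivariant maps. -/
theorem GroupRep.sum_char_mul_char_inv [Fintype G] (V W : GroupRep k G) :
    ∑ h, W.char h * V.char h⁻¹ =
      Nat.card G * Module.finrank k (Representation.IntertwiningMap V.ρ W.ρ) := by
  have h0 : (Nat.card G : k) ≠ 0 := Nat.cast_ne_zero.2 Nat.card_pos.ne'
  have := invertibleOfNonzero h0
  have h := Representation.card_inv_mul_sum_char_mul_char_eq_finrank V.ρ W.ρ
  rw [← h, mul_inv_cancel_left₀ h0]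
  rfl

/-- Representations with the same character are isomorphic. -/
theorem GroupRep.iso_of_char_eq {V W : GroupRep k G} (h : V.char = W.char) : Iso V W := by
  have := Fintype.ofFinite G
  obtain ⟨U, V', W', h1, h2, h3⟩ := exists_common_summand _ V W rfl
  have e : V'.char = W'.char := by
    rw [h1.char_eq, h2.char_eq, char_prod, char_prod] at h
    exact add_left_cancel h
  have h4 : Module.finrank k (Representation.IntertwiningMap V'.ρ W'.ρ) = 0 :=
    Module.finrank_zero_iff.2 ⟨fun f f' => (h3 f).trans (h3 f').symm⟩
  have h5 : Module.finrank k (Representation.IntertwiningMap V'.ρ V'.ρ) = 0 := by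
    have a1 := sum_char_mul_char_inv V' W'
    have a2 := sum_char_mul_char_inv V' V'
    rw [← e, h4, a2, Nat.cast_zero, mul_zero, mul_eq_zero] at a1
    exact_mod_cast a1.resolve_left (Nat.cast_ne_zero.2 Nat.card_pos.ne')
  have h6 := finrank_intertwining_self_eq_zero h5
  have h7 := Module.finrank_zero_iff.1 (finrank_carrier_eq_zero_of_char_eq_zero h6)
  have h8 := Module.finrank_zero_iff.1 (finrank_carrier_eq_zero_of_char_eq_zero (e ▸ h6))
  have h9 : Iso V' W' := ⟨⟨0, 0, fun _ => Subsingleton.elim _ _, fun _ => Subsingleton.elim _ _⟩,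
    fun _ _ => Subsingleton.elim _ _⟩
  exact h1.trans ((prod_congr U h9).trans h2.symm)

/-- The inner product with the trivial character is a difference of two dimensions of spaces of
intertwiners, hence an integer. -/
theorem virtualChar.exists_mean [Fintype G] (f : virtualChar k G) :
    ∃ t : ℤ, ∑ h, f.1 h = Nat.card G * (t : k) := by
  obtain ⟨V, W, rfl⟩ := virtualChar.exists_eq_sub f
  have h1 : ∀ X : GroupRep k G, ∑ h, X.char h = Nat.card G * Module.finrank k
      (Representation.IntertwiningMap (ofChar 1 : GroupRep k G).ρ X.ρ) := fun X => by
    rw [← sum_char_mul_char_inv]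
    simp [char_ofChar]
  refine ⟨(Module.finrank k (Representation.IntertwiningMap (ofChar 1 : GroupRep k G).ρ V.ρ) : ℤ) -
    Module.finrank k (Representation.IntertwiningMap (ofChar 1 : GroupRep k G).ρ W.ρ), ?_⟩
  have h2 : ∀ h, (V.vchar - W.vchar : virtualChar k G).1 h = V.char h - W.char h := fun h => rfl
  simp only [h2, Finset.sum_sub_distrib, h1]
  push_cast
  ring

/-- The multiplicity of the trivial character in a virtual character. -/
noncomputable def virtualChar.mean : virtualChar k G →+ ℤ :=
  letI := Fintype.ofFinite G
  AddMonoidHom.mk' (fun f => (virtualChar.exists_mean f).choose) fun f f' => by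
    have h : ∑ h, (f + f').1 h = ∑ h, f.1 h + ∑ h, f'.1 h := Finset.sum_add_distrib
    rw [(virtualChar.exists_mean (f + f')).choose_spec, (virtualChar.exists_mean f).choose_spec,
      (virtualChar.exists_mean f').choose_spec, ← mul_add] at h
    exact_mod_cast mul_left_cancel₀ (Nat.cast_ne_zero.2 Nat.card_pos.ne') h

theorem virtualChar.sum_eq [Fintype G] (f : virtualChar k G) :
    ∑ h, f.1 h = Nat.card G * (virtualChar.mean f : k) := by
  let _ := Fintype.ofFinite G
  refine Eq.trans ?_ (virtualChar.exists_mean f).choose_spec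
  -- The two sums differ only in the `Fintype` instance.
  congr!

theorem virtualChar.mean_eq_of_sum_eq [Fintype G] {f : virtualChar k G} {t : ℤ}
    (h : ∑ h, f.1 h = Nat.card G * (t : k)) : virtualChar.mean f = t := by
  rw [virtualChar.sum_eq f] at h
  exact_mod_cast mul_left_cancel₀ (Nat.cast_ne_zero.2 Nat.card_pos.ne') h

theorem virtualChar.mean_one : virtualChar.mean (1 : virtualChar k G) = 1 := by
  have := Fintype.ofFinite G
  refine mean_eq_of_sum_eq ?_
  have : ∀ h, (1 : virtualChar k G).1 h = 1 := fun h => rfl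
  simp [this]

theorem virtualChar.mean_star (f : virtualChar k G) :
    virtualChar.mean (star f) = virtualChar.mean f := by
  have := Fintype.ofFinite G
  refine mean_eq_of_sum_eq ?_
  rw [← virtualChar.sum_eq f]
  exact Fintype.sum_equiv (Equiv.inv G) _ _ fun h => star_apply f h

/-- The inner product is positive definite on virtual characters. -/
theorem virtualChar.mean_star_mul_self (f : virtualChar k G) :
    0 ≤ virtualChar.mean (star f * f) ∧ (virtualChar.mean (star f * f) = 0 → f = 0) := by
  have := Fintype.ofFinite G
  obtain ⟨V, W, rfl⟩ := virtualChar.exists_eq_sub f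
  -- After removal of the common part the cross terms vanish, so the norm is dim End V' + dim End
  -- W'.
  obtain ⟨U, V', W', h1, h2, h3⟩ := exists_common_summand _ V W rfl
  have e : V.vchar - W.vchar = V'.vchar - W'.vchar := by
    rw [h1.vchar_eq, h2.vchar_eq, vchar_prod, vchar_prod]
    ring
  rw [e]
  have h4 : Module.finrank k (Representation.IntertwiningMap V'.ρ W'.ρ) = 0 :=
    Module.finrank_zero_iff.2 ⟨fun f f' => (h3 f).trans (h3 f').symm⟩
  have h5 := sum_char_mul_char_inv V' W'
  rw [h4, Nat.cast_zero, mul_zero] at h5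
  have h6 : ∑ h, V'.char h * W'.char h⁻¹ = 0 := by
    rw [← h5]
    refine Fintype.sum_equiv (Equiv.inv G) _ _ fun h => ?_
    simp [mul_comm]
  have h7 : virtualChar.mean (star (V'.vchar - W'.vchar) * (V'.vchar - W'.vchar)) =
      (Module.finrank k (Representation.IntertwiningMap V'.ρ V'.ρ) : ℤ) +
        Module.finrank k (Representation.IntertwiningMap W'.ρ W'.ρ) := by
    refine mean_eq_of_sum_eq ?_
    have h8 : ∀ h, (star (V'.vchar - W'.vchar) * (V'.vchar - W'.vchar) : virtualChar k G).1 h =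
      V'.char h * V'.char h⁻¹ - W'.char h * V'.char h⁻¹ - V'.char h * W'.char h⁻¹ +
        W'.char h * W'.char h⁻¹ := fun h => by
      change (V'.char h⁻¹ - W'.char h⁻¹) * (V'.char h - W'.char h) = _
      ring
    simp only [h8, Finset.sum_add_distrib, Finset.sum_sub_distrib, h5, h6, sum_char_mul_char_inv]
    push_cast
    ring
  rw [h7]
  refine ⟨by positivity, fun h => ?_⟩
  have a1 := finrank_intertwining_self_eq_zero (V := V') (by omega)
  have a2 := finrank_intertwining_self_eq_zero (V := W') (by omega)
  refine Subtype.ext ?_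
  change V'.char - W'.char = 0
  rw [a1, a2, sub_zero]

/-- A proper idempotent virtual character which vanishes somewhere is zero. -/
theorem virtualChar.eq_zero_of_idempotent {f : virtualChar k G} (h : f * f = f) {g : G}
    (hg : f.1 g = 0) : f = 0 := by
  classical
  have := Fintype.ofFinite G
  have h1 : ∀ x, f.1 x = if f.1 x = 0 then 0 else 1 := fun x => by
    split_ifs with hx
    · exact hx
    · have h2 : f.1 x * f.1 x = f.1 x := congrFun (congrArg Subtype.val h) x
      exact mul_left_cancel₀ hx (h2.trans (mul_one _).symm)
  have h2 := virtualChar.sum_eq f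
  have h3 : ∑ x, f.1 x = ((Finset.univ.filter fun x => f.1 x ≠ 0).card : k) := by
    rw [Finset.card_filter, Nat.cast_sum]
    refine Finset.sum_congr rfl fun x _ => ?_
    by_cases hx : f.1 x = 0
    · rw [hx, if_neg (not_not.2 rfl), Nat.cast_zero]
    · rw [if_pos hx, h1 x, if_neg hx, Nat.cast_one]
  -- The values are 0 or 1, so the sum counts the support. The zero at g makes this count smaller
  -- than |G|, while integrality of the mean makes it a multiple of |G|.
  have h4 : (Finset.univ.filter fun x => f.1 x ≠ 0).card < Nat.card G := by
    rw [Nat.card_eq_fintype_card]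
    exact Finset.card_lt_univ_of_notMem (x := g) (by simp [hg])
  rw [h3] at h2
  have h5 : ((Finset.univ.filter fun x => f.1 x ≠ 0).card : ℤ) = Nat.card G * virtualChar.mean f := by
    exact_mod_cast h2
  have h6 : ((Finset.univ.filter fun x => f.1 x ≠ 0).card : ℤ) = 0 := by
    refine Int.eq_zero_of_dvd_of_nonneg_of_lt ?_ ?_ ⟨virtualChar.mean f, h5⟩ <;> omega
  have h7 : ∀ x, f.1 x = 0 := by
    have := Finset.card_eq_zero.1 (by exact_mod_cast h6)
    intro x
    by_contra hx
    exact Finset.eq_empty_iff_forall_notMem.1 this x (Finset.mem_filter.2 ⟨Finset.mem_univ x, hx⟩)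
  exact Subtype.ext (funext h7)

end VirtualCharacters

/-! ### Normal idempotent matrices over a ring with a positive definite trace. -/

section IdempotentMatrices

variable {R : Type*} [CommRing R] [StarRing R] {m : ℕ}

open Matrix

/-- An idempotent matrix which commutes with its adjoint, over a ring with a positive definite
integral trace: the trace of its corner entry is `0` or `1`, and in the first case its first column
vanishes. -/
theorem matrix_idempotent_corner (ε : R →+ ℤ) (h1 : ε 1 = 1) (hstar : ∀ a, ε (star a) = ε a)
    (hpos : ∀ a, 0 ≤ ε (star a * a) ∧ (ε (star a * a) = 0 → a = 0))
    (p : Matrix (Fin (m + 1)) (Fin (m + 1)) R) (hp : p * p = p) (hc : Commute p pᴴ) :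
    (ε (p 0 0) = 0 ∧ ∀ i, p i 0 = 0) ∨ ε (p 0 0) = 1 := by
  have hp' : pᴴ * pᴴ = pᴴ := by rw [← conjTranspose_mul, hp]
  have hcol : ∀ a : Matrix (Fin (m + 1)) (Fin (m + 1)) R,
      ε ((aᴴ * a) 0 0) = ∑ i, ε (star (a i 0) * a i 0) := fun a => by
    simp [Matrix.mul_apply]
  -- For normal p the element u = p - p pᴴ satisfies uᴴ u = 0. Its corner entry is a sum of squares,
  -- so positivity kills the first column of u; only the corner is needed, and it gives p₀₀ = (pᴴ
  -- p)₀₀.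
  have hu : (p - p * pᴴ)ᴴ * (p - p * pᴴ) = 0 := by
    rw [conjTranspose_sub, conjTranspose_mul, conjTranspose_conjTranspose]
    have e1 : pᴴ * p = p * pᴴ := hc.eq.symm
    have e2 : p * pᴴ * p = p * pᴴ := by rw [mul_assoc, e1, ← mul_assoc, hp]
    have e3 : p * pᴴ * (p * pᴴ) = p * pᴴ := by rw [← mul_assoc, e2, mul_assoc, hp']
    have e4 : pᴴ * (p * pᴴ) = p * pᴴ := by rw [← mul_assoc, e1, mul_assoc, hp']
    rw [sub_mul, mul_sub, mul_sub, e1, e2, e3, e4]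
    abel
  have hu0 : (p - p * pᴴ) 0 0 = 0 := by
    have h := hcol (p - p * pᴴ)
    rw [hu, Matrix.zero_apply, map_zero] at h
    exact (hpos _).2 ((Finset.sum_eq_zero_iff_of_nonneg fun i _ => (hpos _).1).1 h.symm 0
      (Finset.mem_univ _))
  have ht : ε (p 0 0) = ∑ i, ε (star (p i 0) * p i 0) := by
    rw [Matrix.sub_apply, sub_eq_zero, hc.eq] at hu0
    rw [← hcol, ← hu0]
  set t := ε (p 0 0) with ht'
  have hle : ε (star (p 0 0) * p 0 0) ≤ t := by
    rw [ht]
    exact Finset.single_le_sum (f := fun i => ε (star (p i 0) * p i 0)) (fun i _ => (hpos _).1)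
      (Finset.mem_univ 0)
  -- Cauchy-Schwarz against the unit: expand the nonnegative norm of p₀₀ - t, using ε(1) = 1.
  have hcs : t * t ≤ ε (star (p 0 0) * p 0 0) := by
    have h := (hpos (p 0 0 - t • (1 : R))).1
    have e : star (p 0 0 - t • (1 : R)) * (p 0 0 - t • (1 : R)) =
        star (p 0 0) * p 0 0 - t • star (p 0 0) - t • p 0 0 + (t * t) • (1 : R) := by
      simp only [star_sub, zsmul_eq_mul, mul_one, star_intCast, Int.cast_mul]
      ring
    rw [e, map_add, map_sub, map_sub, map_zsmul, map_zsmul, map_zsmul, hstar, h1, ← ht'] at h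
    simp only [smul_eq_mul, mul_one] at h
    linarith
  -- Together the two bounds give t² ≤ t for the integer t.
  have h01 : t = 0 ∨ t = 1 := by
    have h0 : 0 ≤ t := le_trans (hpos _).1 hle
    have h1 : t ≤ 1 := by nlinarith
    omega
  rcases h01 with h | h
  · refine Or.inl ⟨h, fun i => (hpos _).2 ?_⟩
    rw [h] at ht
    exact (Finset.sum_eq_zero_iff_of_nonneg fun i _ => (hpos _).1).1 ht.symm i (Finset.mem_univ _)
  · exact Or.inr h

end IdempotentMatrices

/-! ### Modules described by the actions of y and G. -/

section HopfModules

variable {k : Type u} {G : Type v} [Field k] [Group G] {D : GroupDatum k G}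

open GroupDatum GroupDatum.Hopf GroupRep

/-- The action of `y`. -/
noncomputable def yAct (M : FDModule k D.Hopf) : Module.End k M.carrier :=
  M.action (Y D)

/-- The action of the group. -/
noncomputable def grpAct (M : FDModule k D.Hopf) : Representation k G M.carrier :=
  (M.action : D.Hopf →* Module.End k M.carrier).comp (grp D)

/-- The restriction of a module to the group. -/
noncomputable abbrev res (M : FDModule k D.Hopf) : GroupRep k G where
  carrier := M.carrier
  ρ := grpAct M

theorem yAct_grpAct (M : FDModule k D.Hopf) (h : G) (m : M.carrier) :
    yAct M (grpAct M h m) = (D.χ h : k) • grpAct M h (yAct M m) := by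
  have := congrArg (fun a => M.action a m) (Y_mul_grp D h)
  simpa only [map_mul, map_smul] using! this

theorem yAct_pow_grpAct (M : FDModule k D.Hopf) (j : ℕ) (h : G) (m : M.carrier) :
    (yAct M ^ j) (grpAct M h m) = ((D.χ h : k) ^ j) • grpAct M h ((yAct M ^ j) m) := by
  induction j generalizing m with
  | zero => simp
  | succ j ih => rw [pow_succ, Module.End.mul_apply, yAct_grpAct, map_smul, ih, smul_smul, ← pow_succ',
      Module.End.mul_apply]

theorem yAct_pow_n (M : FDModule k D.Hopf) (m : M.carrier) :
    (yAct M ^ D.n) m = D.μ • (grpAct M (D.g ^ D.n) m - m) := by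
  have := congrArg (fun a => M.action a m) (Y_pow D)
  rw [map_pow, map_smul, map_sub, map_one] at this
  exact this

/-- A linear map which commutes with `y` and the group is a homomorphism of modules. -/
theorem map_action {M N : FDModule k D.Hopf} (f : M.carrier →ₗ[k] N.carrier)
    (hy : ∀ m, f (yAct M m) = yAct N (f m)) (hg : ∀ h m, f (grpAct M h m) = grpAct N h (f m))
    (a : D.Hopf) (m : M.carrier) : f (M.action a m) = N.action a (f m) := by
  induction a using Hopf.induction generalizing m with
  | hs c =>
    rw [AlgHom.commutes, AlgHom.commutes]
    exact map_smul f c m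
  | hY => exact hy m
  | hg h => exact hg h m
  | ha a b h h' => rw [map_add, map_add, LinearMap.add_apply, LinearMap.add_apply, map_add, h, h']
  | hm a b h h' => rw [map_mul, map_mul, Module.End.mul_apply, Module.End.mul_apply, h, h']

theorem iso_of_bijective {M N : FDModule k D.Hopf} (f : M.carrier →ₗ[k] N.carrier)
    (hy : ∀ m, f (yAct M m) = yAct N (f m)) (hg : ∀ h m, f (grpAct M h m) = grpAct N h (f m))
    (h : Function.Bijective f) : FDModule.Iso M N :=
  ⟨LinearEquiv.ofBijective f h, map_action f hy hg⟩

/-- The module given by a representation of the group and the action of `y`. -/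
noncomputable abbrev ofGen (V : GroupRep k G) (y : Module.End k V.carrier)
    (hy : ∀ v, (y ^ D.n) v = D.μ • (V.ρ (D.g ^ D.n) v - v))
    (hyt : ∀ h v, y (V.ρ h v) = (D.χ h : k) • V.ρ h (y v)) : FDModule k D.Hopf where
  carrier := V.carrier
  action := Hopf.lift y V.ρ (LinearMap.ext hy) (fun h => LinearMap.ext (hyt h))

section ofGen

variable (V : GroupRep k G) (y : Module.End k V.carrier)
    (hy : ∀ v, (y ^ D.n) v = D.μ • (V.ρ (D.g ^ D.n) v - v))
    (hyt : ∀ h v, y (V.ρ h v) = (D.χ h : k) • V.ρ h (y v))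

theorem yAct_ofGen : yAct (ofGen V y hy hyt) = y :=
  lift_Y (D := D) y V.ρ (LinearMap.ext hy) (fun h => LinearMap.ext (hyt h))

theorem grpAct_ofGen (h : G) (v : V.carrier) : grpAct (ofGen V y hy hyt) h v = V.ρ h v :=
  LinearMap.congr_fun (lift_grp (D := D) y V.ρ (LinearMap.ext hy)
    (fun h => LinearMap.ext (hyt h)) h) v

end ofGen

section tensor

variable [Finite G]

theorem yAct_tensor (M N : FDModule k D.Hopf) (x : M.carrier ⊗[k] N.carrier) :
    yAct (M.tensor N) x = TensorProduct.map (yAct M) (grpAct N D.g) x +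
      TensorProduct.map LinearMap.id (yAct N) x := by
  have h : yAct (M.tensor N) = Module.endTensorEndAlgHom (R := k) (S := k) (A := k)
    (Algebra.TensorProduct.map M.action N.action (comul D (Y D))) := rfl
  rw [h, comul_Y, map_add, map_add, Algebra.TensorProduct.map_tmul, Algebra.TensorProduct.map_tmul,
    map_one]
  rfl

theorem grpAct_tensor_apply (M N : FDModule k D.Hopf) (h : G) (x : M.carrier ⊗[k] N.carrier) :
    grpAct (M.tensor N) h x = TensorProduct.map (grpAct M h) (grpAct N h) x := by
  have e : grpAct (M.tensor N) h = Module.endTensorEndAlgHom (R := k) (S := k) (A := k)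
    (Algebra.TensorProduct.map M.action N.action (comul D (grp D h))) := rfl
  rw [e, comul_grp, Algebra.TensorProduct.map_tmul]
  rfl

theorem res_tensor (M N : FDModule k D.Hopf) : Iso (res (M.tensor N)) ((res M).tensor (res N)) :=
  ⟨LinearEquiv.refl _ _, fun h x => grpAct_tensor_apply M N h x⟩

theorem yAct_trivial : yAct (FDModule.trivial k D.Hopf) = 0 := by
  refine LinearMap.ext fun (c : k) => ?_
  change counit D (Y D) * c = 0
  rw [counit_Y, zero_mul]

theorem grpAct_trivial (h : G) (c : k) : grpAct (FDModule.trivial k D.Hopf) h c = c := by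
  change counit D (grp D h) * c = c
  rw [counit_grp, one_mul]

end tensor

/-! ### Modules of sequences -/

/-- The sequences in `V` with `f (j + l) = lam (f j)`. -/
def seqSpace {U : Type*} [AddCommGroup U] [Module k U] (l : ℕ) (lam : Module.End k U) :
    Submodule k (ℕ → U) where
  carrier := {f | ∀ j, f (j + l) = lam (f j)}
  zero_mem' := fun j => by simp
  add_mem' := fun hf hf' j => by
    rw [Pi.add_apply, Pi.add_apply, map_add, hf j, hf' j]
  smul_mem' := fun c f hf j => by
    rw [Pi.smul_apply, Pi.smul_apply, map_smul, hf j]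

section seqSpace

variable {U : Type*} [AddCommGroup U] [Module k U] {l : ℕ} {lam : Module.End k U}

theorem seqSpace_apply_add_mul {f : ℕ → U} (hf : f ∈ seqSpace l lam) (j i : ℕ) :
    f (j + l * i) = (lam ^ i) (f j) := by
  induction i with
  | zero => simp
  | succ i ih => rw [mul_add, mul_one, ← add_assoc, hf, ih, pow_succ', Module.End.mul_apply]

variable (lam) in
/-- The sequences are determined by their first terms. -/
def seqEquiv (hl : 0 < l) : seqSpace l lam ≃ₗ[k] (Fin l → U) where
  toFun f j := f.1 j
  map_add' _ _ := rfl
  map_smul' _ _ := rfl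
  invFun u := ⟨fun j => (lam ^ (j / l)) (u ⟨j % l, Nat.mod_lt j hl⟩), fun j => by
    have h1 : (j + l) / l = j / l + 1 := Nat.add_div_right j hl
    simp only [h1, Nat.add_mod_right, pow_succ', Module.End.mul_apply]⟩
  left_inv f := by
    refine Subtype.ext (funext fun j => ?_)
    change (lam ^ (j / l)) (f.1 (j % l)) = f.1 j
    rw [← seqSpace_apply_add_mul f.2, Nat.mod_add_div]
  right_inv u := by
    funext j
    simp [Nat.div_eq_of_lt j.2, Nat.mod_eq_of_lt j.2]

instance [Module.Finite k U] [NeZero l] : Module.Finite k (seqSpace l lam) :=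
  Module.Finite.equiv (seqEquiv lam (Nat.pos_of_neZero l)).symm

theorem finrank_seqSpace [Module.Finite k U] (hl : 0 < l) :
    Module.finrank k (seqSpace l lam) = l * Module.finrank k U := by
  rw [(seqEquiv lam hl).finrank_eq, Module.finrank_pi_fintype]
  simp

/-- The `j`-th term. -/
def seqEval (l : ℕ) (lam : Module.End k U) (j : ℕ) : seqSpace l lam →ₗ[k] U :=
  (LinearMap.proj j).comp (seqSpace l lam).subtype

/-- A sequence is determined by its first l terms. Stating this as a decomposition of the identity
through the evaluations lets it survive tensoring with another space. -/
theorem exists_sum_seqEval (hl : 0 < l) : ∃ s : Fin l → U →ₗ[k] seqSpace l lam,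
    ∑ j, s j ∘ₗ seqEval l lam j = LinearMap.id := by
  refine ⟨fun j => (seqEquiv lam hl).symm.toLinearMap ∘ₗ LinearMap.single k (fun _ => U) j, ?_⟩
  refine LinearMap.ext fun f => (seqEquiv lam hl).injective ?_
  rw [LinearMap.sum_apply, map_sum]
  funext i
  simp only [LinearMap.comp_apply, LinearEquiv.coe_coe, LinearEquiv.apply_symm_apply,
    Finset.sum_apply, LinearMap.single_apply, LinearMap.id_apply]
  rw [Finset.sum_pi_single]
  simp [seqEquiv, seqEval]

theorem eq_zero_of_rTensor_seqEval {W : Type*} [AddCommGroup W] [Module k W] (hl : 0 < l)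
    (x : seqSpace l lam ⊗[k] W)
    (h : ∀ j < l, TensorProduct.map (seqEval l lam j) (LinearMap.id : W →ₗ[k] W) x = 0) :
    x = 0 := by
  obtain ⟨s, hs⟩ := exists_sum_seqEval (lam := lam) hl
  have h1 : x = TensorProduct.map (∑ j, s j ∘ₗ seqEval l lam j) (LinearMap.id : W →ₗ[k] W) x := by
    rw [hs, TensorProduct.map_id, LinearMap.id_apply]
  rw [h1]
  change LinearMap.rTensorHom W _ x = 0
  rw [map_sum, LinearMap.sum_apply]
  refine Finset.sum_eq_zero fun j _ => ?_
  rw [LinearMap.coe_rTensorHom, LinearMap.rTensor_comp, LinearMap.comp_apply]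
  exact (congrArg _ (h j j.2)).trans (map_zero _)

theorem eq_zero_of_lTensor_seqEval {W : Type*} [AddCommGroup W] [Module k W] (hl : 0 < l)
    (x : W ⊗[k] seqSpace l lam)
    (h : ∀ j < l, TensorProduct.map (LinearMap.id : W →ₗ[k] W) (seqEval l lam j) x = 0) :
    x = 0 := by
  obtain ⟨s, hs⟩ := exists_sum_seqEval (lam := lam) hl
  have h1 : x = TensorProduct.map (LinearMap.id : W →ₗ[k] W) (∑ j, s j ∘ₗ seqEval l lam j) x := by
    rw [hs, TensorProduct.map_id, LinearMap.id_apply]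
  rw [h1]
  change LinearMap.lTensorHom W _ x = 0
  rw [map_sum, LinearMap.sum_apply]
  refine Finset.sum_eq_zero fun j _ => ?_
  rw [LinearMap.coe_lTensorHom, LinearMap.lTensor_comp, LinearMap.comp_apply]
  exact (congrArg _ (h j j.2)).trans (map_zero _)

end seqSpace

/-- The conditions under which the sequences with `f (j + l) = lam (f j)` in a representation form a
module. -/
structure SeqDatum (D : GroupDatum k G) (V : GroupRep k G) where
  /-- the period -/
  l : ℕ
  l_pos : 0 < l
  /-- the monodromy -/
  lam : Module.End k V.carrier
  lam_rho : ∀ h v, lam (V.ρ h v) = (D.χ h : k) ^ l • V.ρ h (lam v)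
  apply_add_n : ∀ f ∈ seqSpace l lam, ∀ j, f (j + D.n) = D.μ • (V.ρ (D.g ^ D.n) (f j) - f j)

namespace SeqDatum

variable {V : GroupRep k G} (S : SeqDatum D V)

instance : NeZero S.l := ⟨S.l_pos.ne'⟩

/-- The action of the group on sequences, `(h f) j = χ(h) ^ j h (f j)`. -/
noncomputable abbrev rep : GroupRep k G where
  carrier := seqSpace S.l S.lam
  -- The term f j stands for π(y ^ j x), and y ^ j h = χ(h) ^ j h y ^ j forces the factor χ(h) ^ j.
  ρ :=
    { toFun := fun h =>
        { toFun := fun f => ⟨fun j => (D.χ h : k) ^ j • V.ρ h (f.1 j), fun j => by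
            change (D.χ h : k) ^ (j + S.l) • V.ρ h (f.1 (j + S.l)) =
              S.lam ((D.χ h : k) ^ j • V.ρ h (f.1 j))
            rw [f.2 j, map_smul, S.lam_rho, smul_smul, pow_add]⟩
          map_add' := fun f f' => Subtype.ext (funext fun j => by
            change (D.χ h : k) ^ j • V.ρ h (f.1 j + f'.1 j) =
              (D.χ h : k) ^ j • V.ρ h (f.1 j) + (D.χ h : k) ^ j • V.ρ h (f'.1 j)
            rw [map_add, smul_add])
          map_smul' := fun c f => Subtype.ext (funext fun j => by
            change (D.χ h : k) ^ j • V.ρ h (c • f.1 j) = c • ((D.χ h : k) ^ j • V.ρ h (f.1 j))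
            rw [map_smul, smul_comm]) }
      map_one' := LinearMap.ext fun f => Subtype.ext (funext fun j => by simp)
      map_mul' := fun h h' => LinearMap.ext fun f => Subtype.ext (funext fun j => by
        change (D.χ (h * h') : k) ^ j • V.ρ (h * h') (f.1 j) =
          (D.χ h : k) ^ j • V.ρ h ((D.χ h' : k) ^ j • V.ρ h' (f.1 j))
        rw [map_mul, map_mul, Units.val_mul, mul_pow, map_smul, smul_smul]
        rfl) }

/-- The shift of sequences. -/
def shift : Module.End k S.rep.carrier where
  toFun f := ⟨fun j => f.1 (j + 1), fun j => by
    rw [← f.2 (j + 1), add_right_comm]⟩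
  map_add' _ _ := rfl
  map_smul' _ _ := rfl

theorem shift_pow_apply (i : ℕ) (f : S.rep.carrier) (j : ℕ) :
    ((S.shift ^ i) f).1 j = f.1 (j + i) := by
  induction i generalizing f with
  | zero => rfl
  | succ i ih =>
    rw [pow_succ, Module.End.mul_apply, ih]
    change f.1 (j + i + 1) = _
    rw [add_assoc]

theorem shift_pow_n (f : S.rep.carrier) :
    (S.shift ^ D.n) f = D.μ • (S.rep.ρ (D.g ^ D.n) f - f) :=
  Subtype.ext (funext fun j => by
    rw [shift_pow_apply, S.apply_add_n _ f.2]
    change _ = D.μ • ((D.χ (D.g ^ D.n) : k) ^ j • V.ρ (D.g ^ D.n) (f.1 j) - f.1 j)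
    -- As n is the order of χ(g), the twist of g ^ n is trivial at every position.
    have : D.χ (D.g ^ D.n) = 1 := (map_pow _ _ _).trans (pow_orderOf_eq_one _)
    rw [this, Units.val_one, one_pow, one_smul])

theorem shift_rho (h : G) (f : S.rep.carrier) :
    S.shift (S.rep.ρ h f) = (D.χ h : k) • S.rep.ρ h (S.shift f) :=
  Subtype.ext (funext fun j => by
    change (D.χ h : k) ^ (j + 1) • V.ρ h (f.1 (j + 1)) =
      (D.χ h : k) • ((D.χ h : k) ^ j • V.ρ h (f.1 (j + 1)))
    rw [smul_smul, pow_succ'])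

/-- The module of sequences, on which `y` acts by the shift. -/
noncomputable abbrev module : FDModule k D.Hopf :=
  ofGen S.rep S.shift S.shift_pow_n S.shift_rho

theorem yAct_module_pow_apply (i : ℕ) (f : S.module.carrier) (j : ℕ) :
    ((yAct S.module ^ i) f).1 j = f.1 (j + i) := by
  have : yAct S.module = S.shift := yAct_ofGen _ _ _ _
  rw [this]
  exact S.shift_pow_apply i f j

theorem yAct_module_apply (f : S.module.carrier) (j : ℕ) :
    (yAct S.module f).1 j = f.1 (j + 1) :=
  S.yAct_module_pow_apply 1 f j

theorem grpAct_module_apply (h : G) (f : S.module.carrier) (j : ℕ) :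
    (grpAct S.module h f).1 j = (D.χ h : k) ^ j • V.ρ h (f.1 j) :=
  congrArg (fun f : seqSpace S.l S.lam => f.1 j)
    (grpAct_ofGen S.rep S.shift S.shift_pow_n S.shift_rho h f)

theorem finrank_module : Module.finrank k S.module.carrier = S.l * Module.finrank k V.carrier :=
  finrank_seqSpace S.l_pos

/-- The homomorphism to a module of sequences given by an equivariant map. -/
noncomputable def coind {X : FDModule k D.Hopf} (π : X.carrier →ₗ[k] V.carrier)
    (hl : ∀ x, π ((yAct X ^ S.l) x) = S.lam (π x)) : X.carrier →ₗ[k] S.module.carrier where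
  toFun x := ⟨fun j => π ((yAct X ^ j) x), fun j => by
    rw [← hl, ← Module.End.mul_apply, ← pow_add, add_comm]⟩
  map_add' x y := Subtype.ext (funext fun j => by
    change π ((yAct X ^ j) (x + y)) = π ((yAct X ^ j) x) + π ((yAct X ^ j) y)
    rw [map_add, map_add])
  map_smul' c x := Subtype.ext (funext fun j => by
    change π ((yAct X ^ j) (c • x)) = c • π ((yAct X ^ j) x)
    rw [map_smul, map_smul])

section coind

variable {X : FDModule k D.Hopf} (π : X.carrier →ₗ[k] V.carrier)
    (hl : ∀ x, π ((yAct X ^ S.l) x) = S.lam (π x))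

theorem coind_apply (x : X.carrier) (j : ℕ) : (S.coind π hl x).1 j = π ((yAct X ^ j) x) :=
  rfl

theorem coind_yAct (x : X.carrier) :
    S.coind π hl (yAct X x) = yAct S.module (S.coind π hl x) :=
  Subtype.ext (funext fun j => by
    rw [yAct_module_apply, coind_apply, coind_apply, pow_succ, Module.End.mul_apply])

theorem coind_grpAct (hπ : ∀ h x, π (grpAct X h x) = V.ρ h (π x)) (h : G) (x : X.carrier) :
    S.coind π hl (grpAct X h x) = grpAct S.module h (S.coind π hl x) :=
  Subtype.ext (funext fun j => by
    rw [grpAct_module_apply, coind_apply, coind_apply, yAct_pow_grpAct, map_smul, hπ])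

include hl in
-- The sequence module is coinduced: an equivariant π compatible with the monodromy extends to x ↦
-- (π(y ^ j x))_j. Injectivity is tested on the first l terms, and equality of dimensions gives the
-- rest. The isomorphisms with a single sequence module below are obtained in this way.
theorem iso_module (hπ : ∀ h x, π (grpAct X h x) = V.ρ h (π x))
    (hi : ∀ x, (∀ j < S.l, π ((yAct X ^ j) x) = 0) → x = 0)
    (hd : Module.finrank k X.carrier = S.l * Module.finrank k V.carrier) :
    FDModule.Iso X S.module := by
  have hinj : Function.Injective (S.coind π hl) := by
    rw [← LinearMap.ker_eq_bot, LinearMap.ker_eq_bot']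
    intro x hx
    refine hi x fun j _ => ?_
    rw [← S.coind_apply π hl, hx]
    rfl
  exact iso_of_bijective (S.coind π hl) (S.coind_yAct π hl) (S.coind_grpAct π hl hπ)
    ⟨hinj, (LinearMap.injective_iff_surjective_of_finrank_eq_finrank
      (hd.trans S.finrank_module.symm)).1 hinj⟩

end coind

end SeqDatum

end HopfModules

/-! ### Modules of Jordan type, induced modules, and their tensor products. -/

section SequenceModules

variable {k : Type u} {G : Type v} [Field k] [Group G] {D : GroupDatum k G}

open GroupDatum GroupDatum.Hopf GroupRep

/-- The sequences in `V` with at most `l` terms, where `g ^ n` acts trivially on `V`. -/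
noncomputable abbrev jord (V : GroupRep k G) (hV : ∀ v, V.ρ (D.g ^ D.n) v = v) (l : ℕ)
    (hl : 0 < l) (hln : l ≤ D.n) : SeqDatum D V where
  l := l
  l_pos := hl
  lam := 0
  lam_rho h v := by simp
  apply_add_n f hf j := by
    -- The position j + n is at least l, so the term there is 0; the other side is 0 because g ^ n
    -- fixes V.
    have := hf (j + (D.n - l))
    rw [add_assoc, Nat.sub_add_cancel hln] at this
    rw [this, hV, sub_self, smul_zero, LinearMap.zero_apply]

theorem seqEval_jord_eq_zero {V : GroupRep k G} {l j : ℕ} (hj : l ≤ j) :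
    seqEval l (0 : Module.End k V.carrier) j = 0 :=
  LinearMap.ext fun f => by
    have := f.2 (j - l)
    rwa [Nat.sub_add_cancel hj] at this

theorem SeqDatum.module_congr {V V' : GroupRep k G} (S : SeqDatum D V) (S' : SeqDatum D V')
    (hl : S.l = S'.l) (e : V.carrier ≃ₗ[k] V'.carrier) (he : ∀ h v, e (V.ρ h v) = V'.ρ h (e v))
    (hlam : ∀ v, e (S.lam v) = S'.lam (e v)) : FDModule.Iso S.module S'.module := by
  refine S'.iso_module (e.toLinearMap ∘ₗ seqEval S.l S.lam 0) (fun f => ?_) (fun h f => ?_)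
    (fun f hf => ?_) ?_
  · change e (((yAct S.module ^ S'.l) f).1 0) = S'.lam (e (f.1 0))
    rw [S.yAct_module_pow_apply, ← hl, f.2 0, hlam]
  · change e ((grpAct S.module h f).1 0) = V'.ρ h (e (f.1 0))
    rw [S.grpAct_module_apply, pow_zero, one_smul, he]
  · refine (seqEquiv S.lam S.l_pos).injective ?_
    rw [map_zero]
    funext j
    have : e (((yAct S.module ^ j.1) f).1 0) = 0 := hf j (hl ▸ j.2)
    rw [S.yAct_module_pow_apply, zero_add] at this
    exact e.map_eq_zero_iff.1 this
  · rw [S.finrank_module, hl, e.finrank_eq]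

theorem jord_congr {V V' : GroupRep k G} (h : Iso V V') (hV : ∀ v, V.ρ (D.g ^ D.n) v = v)
    (hV' : ∀ v, V'.ρ (D.g ^ D.n) v = v) (l : ℕ) (hl : 0 < l) (hln : l ≤ D.n) :
    FDModule.Iso (jord V hV l hl hln).module (jord V' hV' l hl hln).module := by
  obtain ⟨e, he⟩ := h
  exact SeqDatum.module_congr _ _ rfl e he fun v => map_zero e

section

variable {W : GroupRep k G} (S : SeqDatum D W)

theorem seqEval_comp_yAct (j : ℕ) :
    seqEval S.l S.lam j ∘ₗ yAct S.module = seqEval S.l S.lam (j + 1) :=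
  LinearMap.ext fun f => S.yAct_module_apply f j

theorem seqEval_comp_grpAct (j : ℕ) (h : G) :
    seqEval S.l S.lam j ∘ₗ grpAct S.module h =
      (D.χ h : k) ^ j • (W.ρ h ∘ₗ seqEval S.l S.lam j) :=
  LinearMap.ext fun f => S.grpAct_module_apply h f j

end

variable [Finite G]

/-- The sequences in `V` which model the induced module. -/
noncomputable abbrev ind (hχ : D.χ ^ D.n = 1) (V : GroupRep k G) : SeqDatum D V where
  l := D.n
  l_pos := n_pos D
  lam := D.μ • (V.ρ (D.g ^ D.n) - 1)
  lam_rho h v := by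
    -- Since χ ^ n = 1, the twist required of a monodromy of period n is trivial, and commuting with
    -- the central element g ^ n suffices.
    have h1 : (D.χ h : k) ^ D.n = 1 := by
      rw [← Units.val_pow_eq_pow_val, ← MonoidHom.pow_apply, hχ]
      rfl
    have h2 : D.g ^ D.n * h = h * D.g ^ D.n :=
      (Subgroup.mem_center_iff.1 (pow_mem D.g_mem_center _) h).symm
    have h3 : V.ρ (D.g ^ D.n) (V.ρ h v) = V.ρ h (V.ρ (D.g ^ D.n) v) := by
      rw [← Module.End.mul_apply, ← Module.End.mul_apply, ← map_mul, ← map_mul, h2]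
    simp only [LinearMap.smul_apply, LinearMap.sub_apply, Module.End.one_apply, map_smul, map_sub,
      h1, h3, one_smul]
  apply_add_n f hf j := hf j

theorem ind_congr (hχ : D.χ ^ D.n = 1) {V V' : GroupRep k G} (h : Iso V V') :
    FDModule.Iso (ind hχ V).module (ind hχ V').module := by
  obtain ⟨e, he⟩ := h
  refine SeqDatum.module_congr _ _ rfl e he fun v => ?_
  rw [LinearMap.smul_apply, LinearMap.smul_apply, map_smul, LinearMap.sub_apply, map_sub, he]
  rfl

/-- Where g ^ n = 1 the monodromy μ(g ^ n - 1) is zero. Thus length n belongs to the induced ideal,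
and only the lengths below n carry multiplicities. -/
theorem jord_n_iso_ind (hχ : D.χ ^ D.n = 1) (V : GroupRep k G)
    (hV : ∀ v, V.ρ (D.g ^ D.n) v = v) :
    FDModule.Iso (jord V hV D.n (n_pos D) le_rfl).module (ind hχ V).module :=
  SeqDatum.module_congr _ _ rfl (LinearEquiv.refl _ _) (fun _ _ => rfl) fun v => by
    change 0 = D.μ • (V.ρ (D.g ^ D.n) v - v)
    rw [hV, sub_self, smul_zero]

/-- The trivial module. -/
theorem trivial_iso_jord (hV : ∀ v, (ofChar 1 : GroupRep k G).ρ (D.g ^ D.n) v = v) :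
    FDModule.Iso (FDModule.trivial k D.Hopf)
      (jord (ofChar 1 : GroupRep k G) hV 1 one_pos (n_pos D)).module := by
  refine (jord (ofChar 1 : GroupRep k G) hV 1 one_pos (n_pos D)).iso_module
    (X := FDModule.trivial k D.Hopf) (LinearMap.id : k →ₗ[k] k) (fun x => ?_) (fun h x => ?_)
    (fun x hx => ?_) ?_
  · rw [pow_one, yAct_trivial]
    rfl
  · exact (grpAct_trivial (D := D) h x).trans (@one_mul k _ x).symm
  · exact hx 0 one_pos
  · exact (one_mul _).symm

section tensor

variable {W : GroupRep k G} (S : SeqDatum D W) (M : FDModule k D.Hopf)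

/-- Evaluation of the first factor of a tensor product. -/
noncomputable def evalLeft (j : ℕ) :
    (S.module.tensor M).carrier →ₗ[k] W.carrier ⊗[k] M.carrier :=
  TensorProduct.map (seqEval S.l S.lam j) LinearMap.id

/-- Evaluation of the second factor of a tensor product. -/
noncomputable def evalRight (j : ℕ) :
    (M.tensor S.module).carrier →ₗ[k] M.carrier ⊗[k] W.carrier :=
  TensorProduct.map LinearMap.id (seqEval S.l S.lam j)

/-- In Δ(y) = y ⊗ g + 1 ⊗ y the first term shifts the sequence and acts by g on M, and the second
keeps the position. -/
theorem evalLeft_yAct (j : ℕ) (x : (S.module.tensor M).carrier) :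
    evalLeft S M j (yAct (S.module.tensor M) x) =
      TensorProduct.map LinearMap.id (grpAct M D.g) (evalLeft S M (j + 1) x) +
        TensorProduct.map LinearMap.id (yAct M) (evalLeft S M j x) := by
  refine (congrArg (evalLeft S M j) (yAct_tensor S.module M x)).trans
    ((map_add (evalLeft S M j) _ _).trans (congrArg₂ (fun s t => s + t) ?_ ?_))
  · change (TensorProduct.map _ _ ∘ₗ TensorProduct.map _ _) x =
      (TensorProduct.map _ _ ∘ₗ TensorProduct.map _ _) x
    rw [← TensorProduct.map_comp, ← TensorProduct.map_comp, seqEval_comp_yAct]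
    rfl
  · change (TensorProduct.map _ _ ∘ₗ TensorProduct.map _ _) x =
      (TensorProduct.map _ _ ∘ₗ TensorProduct.map _ _) x
    rw [← TensorProduct.map_comp, ← TensorProduct.map_comp]
    rfl

theorem evalLeft_zero_grpAct (h : G) (x : (S.module.tensor M).carrier) :
    evalLeft S M 0 (grpAct (S.module.tensor M) h x) =
      (W.tensor (res M)).ρ h (evalLeft S M 0 x) := by
  refine (congrArg (evalLeft S M 0) (grpAct_tensor_apply S.module M h x)).trans ?_
  change (TensorProduct.map _ _ ∘ₗ TensorProduct.map _ _) x =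
      (TensorProduct.map _ _ ∘ₗ TensorProduct.map _ _) x
  rw [← TensorProduct.map_comp, ← TensorProduct.map_comp, seqEval_comp_grpAct, pow_zero, one_smul]
  rfl

theorem evalRight_yAct (j : ℕ) (x : (M.tensor S.module).carrier) :
    evalRight S M j (yAct (M.tensor S.module) x) =
      (D.χ D.g : k) ^ j • TensorProduct.map (yAct M) (W.ρ D.g) (evalRight S M j x) +
        evalRight S M (j + 1) x := by
  refine (congrArg (evalRight S M j) (yAct_tensor M S.module x)).trans
    ((map_add (evalRight S M j) _ _).trans (congrArg₂ (fun s t => s + t) ?_ ?_))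
  · change (TensorProduct.map _ _ ∘ₗ TensorProduct.map _ _) x =
      _ • (TensorProduct.map _ _ ∘ₗ TensorProduct.map _ _) x
    rw [← TensorProduct.map_comp, ← TensorProduct.map_comp, seqEval_comp_grpAct,
      TensorProduct.map_smul_right]
    rfl
  · change (TensorProduct.map _ _ ∘ₗ TensorProduct.map _ _) x = _
    rw [← TensorProduct.map_comp, seqEval_comp_yAct]
    rfl

theorem evalRight_zero_grpAct (h : G) (x : (M.tensor S.module).carrier) :
    evalRight S M 0 (grpAct (M.tensor S.module) h x) =
      ((res M).tensor W).ρ h (evalRight S M 0 x) := by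
  refine (congrArg (evalRight S M 0) (grpAct_tensor_apply M S.module h x)).trans ?_
  change (TensorProduct.map _ _ ∘ₗ TensorProduct.map _ _) x =
      (TensorProduct.map _ _ ∘ₗ TensorProduct.map _ _) x
  rw [← TensorProduct.map_comp, ← TensorProduct.map_comp, seqEval_comp_grpAct, pow_zero, one_smul]
  rfl

/-- The system is triangular: the evaluation at 0 of y ^ j x is g ^ j applied to the evaluation of x
at j, plus terms from smaller positions. Since g is invertible, the evaluations vanish one after the
other. -/
theorem evalLeft_injective (x : (S.module.tensor M).carrier)
    (h : ∀ j < S.l, evalLeft S M 0 ((yAct (S.module.tensor M) ^ j) x) = 0) : x = 0 := by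
  refine eq_zero_of_rTensor_seqEval S.l_pos x ?_
  suffices H : ∀ j, ∀ x : (S.module.tensor M).carrier,
      (∀ i ≤ j, evalLeft S M 0 ((yAct (S.module.tensor M) ^ i) x) = 0) → evalLeft S M j x = 0 from
    fun j hj => H j x fun i hi => h i (by omega)
  intro j
  induction j with
  | zero => exact fun x hx => hx 0 le_rfl
  | succ j ih =>
    intro x hx
    have h1 := ih (yAct (S.module.tensor M) x) fun i hi => by
      rw [← Module.End.mul_apply, ← pow_succ]
      exact hx (i + 1) (by omega)
    rw [evalLeft_yAct, ih x fun i hi => hx i (by omega), map_zero, add_zero] at h1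
    -- The leading coefficient g is cancelled on the second factor.
    have h2 := congrArg (TensorProduct.map LinearMap.id (grpAct M D.g⁻¹)) h1
    rw [map_zero, ← LinearMap.comp_apply, ← TensorProduct.map_comp,
      ← Module.End.mul_eq_comp (grpAct M D.g⁻¹), ← map_mul, inv_mul_cancel, map_one] at h2
    rw [← h2]
    exact (LinearMap.congr_fun TensorProduct.map_id _).symm

/-- The same triangular argument; here the leading coefficient is 1. -/
theorem evalRight_injective (x : (M.tensor S.module).carrier)
    (h : ∀ j < S.l, evalRight S M 0 ((yAct (M.tensor S.module) ^ j) x) = 0) : x = 0 := by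
  refine eq_zero_of_lTensor_seqEval S.l_pos x ?_
  suffices H : ∀ j, ∀ x : (M.tensor S.module).carrier,
      (∀ i ≤ j, evalRight S M 0 ((yAct (M.tensor S.module) ^ i) x) = 0) → evalRight S M j x = 0 from
    fun j hj => H j x fun i hi => h i (by omega)
  intro j
  induction j with
  | zero => exact fun x hx => hx 0 le_rfl
  | succ j ih =>
    intro x hx
    have h1 := ih (yAct (M.tensor S.module) x) fun i hi => by
      rw [← Module.End.mul_apply, ← pow_succ]
      exact hx (i + 1) (by omega)
    rwa [evalRight_yAct, ih x fun i hi => hx i (by omega), map_zero, smul_zero, zero_add] at h1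

theorem finrank_tensor_left : Module.finrank k (S.module.tensor M).carrier =
    S.l * Module.finrank k (W.tensor (res M)).carrier := by
  have h : Module.finrank k (S.module.tensor M).carrier =
    Module.finrank k S.module.carrier * Module.finrank k M.carrier := Module.finrank_tensorProduct
  rw [h, S.finrank_module, mul_assoc, ← Module.finrank_tensorProduct]

theorem finrank_tensor_right : Module.finrank k (M.tensor S.module).carrier =
    S.l * Module.finrank k ((res M).tensor W).carrier := by
  have h : Module.finrank k (M.tensor S.module).carrier =
    Module.finrank k M.carrier * Module.finrank k S.module.carrier := Module.finrank_tensorProduct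
  rw [h, S.finrank_module, mul_left_comm, ← Module.finrank_tensorProduct]

/-- Evaluation at 0 is equivariant, and the monodromy condition is automatic, because y ^ n acts as
μ(g ^ n - 1) on every module. No expansion of Δ(y) ^ n is required. -/
theorem ind_tensor (hχ : D.χ ^ D.n = 1) : FDModule.Iso ((ind hχ W).module.tensor M)
    (ind hχ (W.tensor (res M))).module := by
  refine (ind hχ (W.tensor (res M))).iso_module (evalLeft (ind hχ W) M 0) (fun x => ?_)
    (evalLeft_zero_grpAct _ M) (evalLeft_injective _ M) (finrank_tensor_left _ M)
  rw [yAct_pow_n, map_smul, map_sub, evalLeft_zero_grpAct]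
  rfl

theorem tensor_ind (hχ : D.χ ^ D.n = 1) : FDModule.Iso (M.tensor (ind hχ W).module)
    (ind hχ ((res M).tensor W)).module := by
  refine (ind hχ ((res M).tensor W)).iso_module (evalRight (ind hχ W) M 0) (fun x => ?_)
    (evalRight_zero_grpAct _ M) (evalRight_injective _ M) (finrank_tensor_right _ M)
  rw [yAct_pow_n, map_smul, map_sub, evalRight_zero_grpAct]
  rfl

theorem evalLeft_zero_yAct_pow (hM : yAct M = 0) (i : ℕ) (x : (S.module.tensor M).carrier) :
    evalLeft S M 0 ((yAct (S.module.tensor M) ^ i) x) =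
      TensorProduct.map LinearMap.id (grpAct M (D.g ^ i)) (evalLeft S M i x) := by
  induction i generalizing x with
  | zero =>
    rw [pow_zero, pow_zero, map_one]
    exact (LinearMap.congr_fun TensorProduct.map_id _).symm
  | succ i ih =>
    rw [pow_succ, Module.End.mul_apply, ih, evalLeft_yAct, hM, TensorProduct.map_zero_right,
      LinearMap.zero_apply, add_zero, ← LinearMap.comp_apply, ← TensorProduct.map_comp,
      pow_succ, map_mul]
    rfl

theorem evalRight_zero_yAct_pow (hM : yAct M = 0) (i : ℕ) (x : (M.tensor S.module).carrier) :
    evalRight S M 0 ((yAct (M.tensor S.module) ^ i) x) = evalRight S M i x := by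
  induction i generalizing x with
  | zero => rfl
  | succ i ih =>
    rw [pow_succ, Module.End.mul_apply, ih, evalRight_yAct, hM, TensorProduct.map_zero_left,
      LinearMap.zero_apply, smul_zero, zero_add]

end tensor

section jord

variable {V U : GroupRep k G} (hV : ∀ v, V.ρ (D.g ^ D.n) v = v)
  (hU : ∀ v, U.ρ (D.g ^ D.n) v = v) (l : ℕ) (hl : 0 < l) (hln : l ≤ D.n)

theorem yAct_jord_one : yAct (jord V hV 1 one_pos (n_pos D)).module = 0 :=
  LinearMap.ext fun f => Subtype.ext (funext fun j => by
    rw [(jord V hV 1 one_pos (n_pos D)).yAct_module_apply]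
    exact LinearMap.congr_fun (seqEval_jord_eq_zero (V := V) (Nat.le_add_left 1 j)) f)

theorem res_jord_one : Iso (res (jord V hV 1 one_pos (n_pos D)).module) V := by
  refine ⟨(seqEquiv (0 : Module.End k V.carrier) one_pos).trans
    (LinearEquiv.funUnique (Fin 1) k V.carrier), fun h f => ?_⟩
  change (grpAct (jord V hV 1 one_pos (n_pos D)).module h f).1 0 = V.ρ h (f.1 0)
  rw [(jord V hV 1 one_pos (n_pos D)).grpAct_module_apply, pow_zero, one_smul]

/-- Since y kills the factor of length one, y ^ l followed by evaluation at 0 is evaluation at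
position l, which is zero. So the length stays l and only the coefficients are tensored. -/
theorem jord_one_tensor_jord : FDModule.Iso
    ((jord V hV 1 one_pos (n_pos D)).module.tensor (jord U hU l hl hln).module)
    (jord (V.tensor U) (tensor_apply_eq hV hU) l hl hln).module := by
  have h0 := res_jord_one hV
  have h1 : ∀ v, ((res (jord V hV 1 one_pos (n_pos D)).module).tensor U).ρ (D.g ^ D.n) v = v :=
    tensor_apply_eq (Iso.apply_eq h0.symm hV) hU
  refine FDModule.Iso.trans ?_ (jord_congr (GroupRep.tensor_congr h0 (Iso.refl U)) h1 _ l hl hln)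
  refine SeqDatum.iso_module _ (evalRight (jord U hU l hl hln) _ 0) (fun x => ?_)
    (evalRight_zero_grpAct _ _) (evalRight_injective _ _) (finrank_tensor_right _ _)
  rw [evalRight_zero_yAct_pow _ _ (yAct_jord_one hV), LinearMap.zero_apply]
  have : evalRight (jord U hU l hl hln) (jord V hV 1 one_pos (n_pos D)).module l = 0 := by
    rw [evalRight, seqEval_jord_eq_zero le_rfl, TensorProduct.map_zero_right]
    rfl
  rw [this, LinearMap.zero_apply]

theorem jord_tensor_jord_one : FDModule.Iso
    ((jord U hU l hl hln).module.tensor (jord V hV 1 one_pos (n_pos D)).module)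
    (jord (U.tensor V) (tensor_apply_eq hU hV) l hl hln).module := by
  have h0 := res_jord_one hV
  have h1 : ∀ v, (U.tensor (res (jord V hV 1 one_pos (n_pos D)).module)).ρ (D.g ^ D.n) v = v :=
    tensor_apply_eq hU (Iso.apply_eq h0.symm hV)
  refine FDModule.Iso.trans ?_ (jord_congr (GroupRep.tensor_congr (Iso.refl U) h0) h1 _ l hl hln)
  refine SeqDatum.iso_module _ (evalLeft (jord U hU l hl hln) _ 0) (fun x => ?_)
    (evalLeft_zero_grpAct _ _) (evalLeft_injective _ _) (finrank_tensor_left _ _)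
  rw [evalLeft_zero_yAct_pow _ _ (yAct_jord_one hV), LinearMap.zero_apply]
  have : evalLeft (jord U hU l hl hln) (jord V hV 1 one_pos (n_pos D)).module l = 0 := by
    rw [evalLeft, seqEval_jord_eq_zero le_rfl, TensorProduct.map_zero_left]
    rfl
  rw [this, LinearMap.zero_apply, map_zero]

end jord

end SequenceModules

/-! ### The fusion rule for the modules of length 2 and l. -/

section Fusion

variable {k : Type u} {G : Type v} [Field k] [Group G] {D : GroupDatum k G}

open GroupDatum GroupDatum.Hopf GroupRep

variable (D) in
theorem ofChar_one_apply (v) : (ofChar 1 : GroupRep k G).ρ (D.g ^ D.n) v = v :=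
  one_mul (M := k) v

variable (D) in
theorem ofChar_chi_apply (v) : (ofChar D.χ : GroupRep k G).ρ (D.g ^ D.n) v = v := by
  have : D.χ (D.g ^ D.n) = 1 := (map_pow _ _ _).trans (pow_orderOf_eq_one _)
  rw [ofChar_apply, this, Units.val_one, one_mul]

section

variable {l₁ l₂ : ℕ}

/-- The evaluation of a tensor product of spaces of sequences at a pair of positions. -/
noncomputable def pairEval (l₁ l₂ i j : ℕ) :
    seqSpace l₁ (0 : Module.End k k) ⊗[k] seqSpace l₂ (0 : Module.End k k) →ₗ[k] k :=
  (TensorProduct.lid k k).toLinearMap ∘ₗ TensorProduct.map (seqEval l₁ 0 i) (seqEval l₂ 0 j)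

theorem eq_zero_of_pairEval (h₁ : 0 < l₁) (h₂ : 0 < l₂)
    (x : seqSpace l₁ (0 : Module.End k k) ⊗[k] seqSpace l₂ (0 : Module.End k k))
    (h : ∀ i < l₁, ∀ j < l₂, pairEval l₁ l₂ i j x = 0) : x = 0 := by
  refine eq_zero_of_rTensor_seqEval h₁ x fun i hi => ?_
  refine eq_zero_of_lTensor_seqEval h₂ _ fun j hj => ?_
  rw [← LinearMap.comp_apply, ← TensorProduct.map_comp, LinearMap.id_comp, LinearMap.comp_id]
  exact (TensorProduct.lid k k).map_eq_zero_iff.1 (h i hi j hj)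

theorem pairEval_eq_zero_left {i : ℕ} (h : l₁ ≤ i) (j : ℕ) (x) :
    pairEval (k := k) l₁ l₂ i j x = 0 := by
  have : seqEval l₁ (0 : Module.End k k) i = 0 :=
    seqEval_jord_eq_zero (V := (ofChar 1 : GroupRep k Unit)) h
  rw [pairEval, this, TensorProduct.map_zero_left, LinearMap.comp_zero, LinearMap.zero_apply]

theorem pairEval_eq_zero_right (i : ℕ) {j : ℕ} (h : l₂ ≤ j) (x) :
    pairEval (k := k) l₁ l₂ i j x = 0 := by
  have : seqEval l₂ (0 : Module.End k k) j = 0 :=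
    seqEval_jord_eq_zero (V := (ofChar 1 : GroupRep k Unit)) h
  rw [pairEval, this, TensorProduct.map_zero_right, LinearMap.comp_zero, LinearMap.zero_apply]

end

section

variable {X : Type*} [AddCommGroup X] [Module k X] (y : Module.End k X) (a b : ℕ → X →ₗ[k] k)
  {q : k} (c : ℕ → k) (h0 : c 0 = 0) (hc : ∀ i, c (i + 1) = c i + q ^ i)
  (ha : ∀ j x, a j (y x) = q ^ j * b j x + a (j + 1) x) (hb : ∀ j x, b j (y x) = b (j + 1) x)

include h0 hc ha hb

/-- Here a j and b j evaluate at the positions (0, j) and (1, j), and b ∘ y has no further term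
since the first factor has length 2. To reach (1, i), exactly one of the i + 1 factors y moves the
first position, at the cost q ^ s if the second position is then s. The costs add up to the
q-integer c (i + 1). -/
theorem apply_pow_succ_of_shift (i : ℕ) (x : X) :
    a 0 ((y ^ (i + 1)) x) = a (i + 1) x + c (i + 1) * b i x := by
  induction i generalizing x with
  | zero =>
    rw [zero_add, pow_one, ha, hc, h0]
    ring
  | succ i ih =>
    rw [pow_succ, Module.End.mul_apply, ih, ha, hb, hc (i + 1)]
    ring

/-- The multiple of b 0 shifts every q-integer by the same constant -t, because c 1 = 1. A suitable
t makes the coefficient of b vanish at a chosen step. -/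
theorem apply_pow_of_shift (t : k) (i : ℕ) (x : X) :
    (a 1 + (1 - t) • b 0) ((y ^ i) x) = a (i + 1) x + (c (i + 1) - t) * b i x := by
  induction i generalizing x with
  | zero =>
    rw [hc, h0, pow_zero, pow_zero, Module.End.one_apply, LinearMap.add_apply,
      LinearMap.smul_apply, smul_eq_mul]
    ring
  | succ i ih =>
    rw [pow_succ, Module.End.mul_apply, ih, ha, hb, hc (i + 1)]
    ring

end

variable [Finite G]

variable (D) in
/-- The uniserial module of length `l` with trivial socle. -/
noncomputable abbrev uniserial (l : ℕ) (hl : 0 < l) (hln : l ≤ D.n) : FDModule k D.Hopf :=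
  (jord (ofChar 1) (ofChar_one_apply D) l hl hln).module

section

variable {l₁ l₂ : ℕ} {h₁ : 0 < l₁} {h₁' : l₁ ≤ D.n} {h₂ : 0 < l₂} {h₂' : l₂ ≤ D.n}

theorem pairEval_yAct (i j : ℕ)
    (x : ((uniserial D l₁ h₁ h₁').tensor (uniserial D l₂ h₂ h₂')).carrier) :
    pairEval l₁ l₂ i j (yAct ((uniserial D l₁ h₁ h₁').tensor (uniserial D l₂ h₂ h₂')) x) =
      (D.χ D.g : k) ^ j * pairEval l₁ l₂ (i + 1) j x + pairEval l₁ l₂ i (j + 1) x := by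
  refine (congrArg (pairEval l₁ l₂ i j) (yAct_tensor _ _ x)).trans
    ((map_add (pairEval l₁ l₂ i j) _ _).trans (congrArg₂ (fun s t => s + t) ?_ ?_))
  · change TensorProduct.lid k k ((TensorProduct.map _ _ ∘ₗ TensorProduct.map _ _) x) = _
    rw [← TensorProduct.map_comp]
    have e1 := seqEval_comp_yAct (jord (ofChar 1) (ofChar_one_apply D) l₁ h₁ h₁') i
    have e2 := seqEval_comp_grpAct (jord (ofChar 1) (ofChar_one_apply D) l₂ h₂ h₂') j D.g
    have e3 : (ofChar 1 : GroupRep k G).ρ D.g = LinearMap.id := LinearMap.ext fun v =>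
      one_mul (M := k) v
    rw [e3, LinearMap.id_comp] at e2
    erw [e1, e2]
    rw [TensorProduct.map_smul_right]
    exact map_smul (TensorProduct.lid k k) ((D.χ D.g : k) ^ j) (TensorProduct.map _ _ x)
  · change TensorProduct.lid k k ((TensorProduct.map _ _ ∘ₗ TensorProduct.map _ _) x) = _
    rw [← TensorProduct.map_comp]
    have e1 := seqEval_comp_yAct (jord (ofChar 1) (ofChar_one_apply D) l₂ h₂ h₂') j
    erw [e1]
    rfl

theorem pairEval_grpAct (i j : ℕ) (h : G)
    (x : ((uniserial D l₁ h₁ h₁').tensor (uniserial D l₂ h₂ h₂')).carrier) :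
    pairEval l₁ l₂ i j (grpAct ((uniserial D l₁ h₁ h₁').tensor (uniserial D l₂ h₂ h₂')) h x) =
      (D.χ h : k) ^ (i + j) * pairEval l₁ l₂ i j x := by
  refine (congrArg (pairEval l₁ l₂ i j) (grpAct_tensor_apply _ _ h x)).trans ?_
  change TensorProduct.lid k k ((TensorProduct.map _ _ ∘ₗ TensorProduct.map _ _) x) = _
  rw [← TensorProduct.map_comp]
  have e1 := seqEval_comp_grpAct (jord (ofChar 1) (ofChar_one_apply D) l₁ h₁ h₁') i h
  have e2 := seqEval_comp_grpAct (jord (ofChar 1) (ofChar_one_apply D) l₂ h₂ h₂') j h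
  have e3 : (ofChar 1 : GroupRep k G).ρ h = LinearMap.id := LinearMap.ext fun v =>
      one_mul (M := k) v
  rw [e3, LinearMap.id_comp] at e1 e2
  erw [e1, e2]
  rw [TensorProduct.map_smul_left, TensorProduct.map_smul_right, smul_smul, ← pow_add]
  exact map_smul (TensorProduct.lid k k) ((D.χ h : k) ^ (i + j)) (TensorProduct.map _ _ x)

end

/-- The tensor product of uniserial modules of lengths `2` and `l`. -/
theorem uniserial_two_tensor (l : ℕ) (hl : 1 < l) (hln : l < D.n) : FDModule.Iso
    ((uniserial D 2 two_pos (by omega)).tensor (uniserial D l (by omega) hln.le))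
    ((uniserial D (l + 1) l.succ_pos hln).directSum
      (jord (ofChar D.χ) (ofChar_chi_apply D) (l - 1) (by omega) (by omega)).module) := by
  set X := (uniserial D 2 two_pos (by omega)).tensor (uniserial D l (by omega) hln.le) with hX
  let q : k := D.χ D.g
  let c : ℕ → k := fun i => ∑ s ∈ Finset.range i, q ^ s
  let ev : ℕ → ℕ → X.carrier →ₗ[k] k := pairEval 2 l
  have hy : ∀ i j x, ev i j (yAct X x) = q ^ j * ev (i + 1) j x + ev i (j + 1) x :=
    fun i j x => pairEval_yAct i j x
  have hg : ∀ i j h x, ev i j (grpAct X h x) = (D.χ h : k) ^ (i + j) * ev i j x :=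
    fun i j h x => pairEval_grpAct i j h x
  have h2 : ∀ j x, ev 2 j x = 0 := fun j x => pairEval_eq_zero_left le_rfl j x
  have hl' : ∀ i j x, l ≤ j → ev i j x = 0 := fun i j x h => pairEval_eq_zero_right i h x
  have hc : ∀ i, c (i + 1) = c i + q ^ i := fun i => Finset.sum_range_succ _ _
  -- The q-integer of l is nonzero since q has order n and 0 < l < n.
  have hcl : c l ≠ 0 := fun h0 => by
    have h1 := geom_sum_mul q l
    change c l * (q - 1) = q ^ l - 1 at h1
    rw [h0, zero_mul] at h1
    exact (isPrimitiveRoot (D := D)).pow_ne_one_of_pos_of_lt (by omega) hln (sub_eq_zero.1 h1.symm)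
  let π₁ : X.carrier →ₗ[k] k := ev 0 0
  -- With t = c l the functional is killed by y ^ (l - 1), which gives the summand of length l - 1.
  -- Both of its terms have i + j = 1, hence the group acts through χ.
  let π₂ : X.carrier →ₗ[k] k := ev 0 1 + (1 - c l) • ev 1 0
  have hb : ∀ j x, ev 1 j (yAct X x) = ev 1 (j + 1) x := fun j x => by
    rw [hy, h2, mul_zero, zero_add]
  have hπ₁ : ∀ i x, π₁ ((yAct X ^ (i + 1)) x) = ev 0 (i + 1) x + c (i + 1) * ev 1 i x :=
    apply_pow_succ_of_shift (yAct X) (ev 0) (ev 1) c rfl hc (hy 0) hb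
  have hπ₂ : ∀ i x, π₂ ((yAct X ^ i) x) = ev 0 (i + 1) x + (c (i + 1) - c l) * ev 1 i x :=
    apply_pow_of_shift (yAct X) (ev 0) (ev 1) c rfl hc (hy 0) hb (c l)
  have a₁ : ∀ x, π₁ ((yAct X ^ (l + 1)) x) = (0 : Module.End k k) (π₁ x) := fun x => by
    rw [hπ₁, hl' _ _ _ (by omega), hl' _ _ _ le_rfl, mul_zero, add_zero, LinearMap.zero_apply]
  have a₂ : ∀ x, π₂ ((yAct X ^ (l - 1)) x) = (0 : Module.End k k) (π₂ x) := fun x => by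
    rw [hπ₂, hl' _ _ _ (by omega), Nat.sub_add_cancel hl.le, sub_self, zero_mul, add_zero,
      LinearMap.zero_apply]
  let S₁ := jord (ofChar 1) (ofChar_one_apply D) (l + 1) l.succ_pos hln
  let S₂ := jord (ofChar D.χ) (ofChar_chi_apply D) (l - 1) (by omega) (by omega)
  let f := (S₁.coind π₁ a₁).prod (S₂.coind π₂ a₂)
  have hinj : Function.Injective f := by
    rw [← LinearMap.ker_eq_bot, LinearMap.ker_eq_bot']
    intro x hx
    have e₁ : ∀ i, π₁ ((yAct X ^ i) x) = 0 := fun i =>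
      congrArg (fun t : S₁.module.carrier × S₂.module.carrier => t.1.1 i) hx
    have e₂ : ∀ i, π₂ ((yAct X ^ i) x) = 0 := fun i =>
      congrArg (fun t : S₁.module.carrier × S₂.module.carrier => t.2.1 i) hx
    have b : ∀ i, ev 1 i x = 0 := fun i => by
      have h3 := e₁ (i + 1)
      have h4 := e₂ i
      rw [hπ₁] at h3
      rw [hπ₂] at h4
      -- The difference of the two equations is c l times the evaluation at (1, i): the nonvanishing
      -- of c l separates the two summands.
      have h5 : c l * ev 1 i x = 0 := by linear_combination h3 - h4
      exact (mul_eq_zero.1 h5).resolve_left hcl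
    have a : ∀ i, ev 0 i x = 0 := fun i => by
      cases i with
      | zero => exact e₁ 0
      | succ i =>
        have h3 := e₁ (i + 1)
        rwa [hπ₁, b, mul_zero, add_zero] at h3
    refine eq_zero_of_pairEval (l₁ := 2) (l₂ := l) two_pos (by omega) x fun i hi j _ => ?_
    interval_cases i
    · exact a j
    · exact b j
  have := S₁.module.finite
  have := S₂.module.finite
  have hd : Module.finrank k X.carrier =
      Module.finrank k (S₁.module.carrier × S₂.module.carrier) := by
    have h1 : Module.finrank k X.carrier = Module.finrank k (uniserial D 2 two_pos (by omega)).carrier *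
      Module.finrank k (uniserial D l (by omega) hln.le).carrier := Module.finrank_tensorProduct
    rw [h1, Module.finrank_prod, SeqDatum.finrank_module, SeqDatum.finrank_module,
      SeqDatum.finrank_module, SeqDatum.finrank_module, Module.finrank_self]
    change 2 * 1 * (l * 1) = (l + 1) * 1 + (l - 1) * 1
    omega
  refine iso_of_bijective (N := S₁.module.directSum S₂.module) f (fun x => ?_) (fun h x => ?_)
    ⟨hinj, (LinearMap.injective_iff_surjective_of_finrank_eq_finrank hd).1 hinj⟩
  · exact Prod.ext (S₁.coind_yAct π₁ a₁ x) (S₂.coind_yAct π₂ a₂ x)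
  · refine Prod.ext (S₁.coind_grpAct π₁ a₁ (fun h x => ?_) h x)
      (S₂.coind_grpAct π₂ a₂ (fun h x => ?_) h x)
    · change ev 0 0 (grpAct X h x) = _
      rw [hg]
      simp [π₁]
    · change ev 0 1 (grpAct X h x) + (1 - c l) * ev 1 0 (grpAct X h x) =
        (D.χ h : k) * (ev 0 1 x + (1 - c l) * ev 1 0 x)
      rw [hg, hg]
      ring

end Fusion

/-! ### Decomposition of the modules on which g ^ n = 1. -/

section Decomposition

variable {k : Type u} {G : Type v} [Field k] [Group G] {D : GroupDatum k G}

open GroupDatum GroupDatum.Hopf GroupRep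

theorem yAct_pow_mem (M : FDModule k D.Hopf) {p : Submodule k M.carrier}
    (hy : ∀ m ∈ p, yAct M m ∈ p) (i : ℕ) : ∀ m ∈ p, (yAct M ^ i) m ∈ p := by
  induction i with
  | zero => exact fun m hm => hm
  | succ i ih =>
    intro m hm
    rw [pow_succ, Module.End.mul_apply]
    exact ih _ (hy m hm)

/-- A submodule. -/
noncomputable abbrev subMod (M : FDModule k D.Hopf) (p : Submodule k M.carrier)
    (hy : ∀ m ∈ p, yAct M m ∈ p) (hg : ∀ h, ∀ m ∈ p, grpAct M h m ∈ p) : FDModule k D.Hopf :=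
  ofGen ((res M).sub p hg) ((yAct M).restrict hy)
    (fun m => Subtype.ext (by
      rw [Module.End.pow_restrict D.n (f' := yAct M) hy (yAct_pow_mem M hy D.n)]
      exact yAct_pow_n M m.1))
    (fun h m => Subtype.ext (yAct_grpAct M h m.1))

section subMod

variable (M : FDModule k D.Hopf) (p : Submodule k M.carrier)
    (hy : ∀ m ∈ p, yAct M m ∈ p) (hg : ∀ h, ∀ m ∈ p, grpAct M h m ∈ p)

theorem coe_yAct_subMod (m : (subMod M p hy hg).carrier) :
    (yAct (subMod M p hy hg) m).1 = yAct M m.1 :=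
  congrArg Subtype.val (LinearMap.congr_fun (yAct_ofGen _ _ _ _) m)

theorem coe_yAct_pow_subMod (i : ℕ) (m : (subMod M p hy hg).carrier) :
    ((yAct (subMod M p hy hg) ^ i) m).1 = (yAct M ^ i) m.1 := by
  induction i generalizing m with
  | zero => rfl
  | succ i ih =>
    rw [pow_succ, Module.End.mul_apply, ih, coe_yAct_subMod, pow_succ, Module.End.mul_apply]

theorem coe_grpAct_subMod (h : G) (m : (subMod M p hy hg).carrier) :
    (grpAct (subMod M p hy hg) h m).1 = grpAct M h m.1 :=
  congrArg Subtype.val (grpAct_ofGen ((res M).sub p hg) _ _ _ h m)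

end subMod

/-- A homomorphism with a section splits off its target. -/
theorem iso_directSum_ker {M L : FDModule k D.Hopf} (θ : M.carrier →ₗ[k] L.carrier)
    (hy : ∀ m, θ (yAct M m) = yAct L (θ m)) (hg : ∀ h m, θ (grpAct M h m) = grpAct L h (θ m))
    (s : L.carrier →ₗ[k] M.carrier) (hsy : ∀ x, s (yAct L x) = yAct M (s x))
    (hsg : ∀ h x, s (grpAct L h x) = grpAct M h (s x)) (h : ∀ x, θ (s x) = x) :
    FDModule.Iso M (L.directSum (subMod M (LinearMap.ker θ)
      (fun m hm => by rw [LinearMap.mem_ker] at hm ⊢; rw [hy, hm, map_zero])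
      (fun h m hm => by rw [LinearMap.mem_ker] at hm ⊢; rw [hg, hm, map_zero]))) := by
  refine iso_of_bijective (N := L.directSum _) (splitEquiv θ s h).toLinearMap (fun m => ?_)
    (fun g m => ?_) (splitEquiv θ s h).bijective
  · refine Prod.ext (hy m) (Subtype.ext ?_)
    refine Eq.trans ?_ (coe_yAct_subMod M _ _ _ _).symm
    change yAct M m - s (θ (yAct M m)) = yAct M (m - s (θ m))
    rw [hy, hsy, map_sub]
  · refine Prod.ext (hg g m) (Subtype.ext ?_)
    refine Eq.trans ?_ (coe_grpAct_subMod M _ _ _ g _).symm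
    change grpAct M g m - s (θ (grpAct M g m)) = grpAct M g (m - s (θ m))
    rw [hg, hsg, map_sub]

/-- A homomorphism which is bijective on the image of another one splits off its target. -/
theorem iso_directSum_ker_of_injective {M L : FDModule k D.Hopf} (θ : M.carrier →ₗ[k] L.carrier)
    (hy : ∀ m, θ (yAct M m) = yAct L (θ m)) (hg : ∀ h m, θ (grpAct M h m) = grpAct L h (θ m))
    (s : L.carrier →ₗ[k] M.carrier) (hsy : ∀ x, s (yAct L x) = yAct M (s x))
    (hsg : ∀ h x, s (grpAct L h x) = grpAct M h (s x)) (h : ∀ x, θ (s x) = 0 → x = 0) :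
    FDModule.Iso M (L.directSum (subMod M (LinearMap.ker θ)
      (fun m hm => by rw [LinearMap.mem_ker] at hm ⊢; rw [hy, hm, map_zero])
      (fun h m hm => by rw [LinearMap.mem_ker] at hm ⊢; rw [hg, hm, map_zero]))) := by
  have hinj : Function.Injective (θ ∘ₗ s) := by
    rw [← LinearMap.ker_eq_bot, LinearMap.ker_eq_bot']
    exact h
  -- An injective endomorphism of the finite dimensional L is invertible; composing s with the
  -- inverse gives a genuine section.
  let e := LinearEquiv.ofInjectiveEndo (θ ∘ₗ s) hinj
  have he : ∀ x, e x = θ (s x) := fun x => rfl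
  refine iso_directSum_ker θ hy hg (s ∘ₗ e.symm.toLinearMap) (fun x => ?_) (fun g x => ?_)
    (fun x => ?_)
  · obtain ⟨x, rfl⟩ := e.surjective x
    have : yAct L (e x) = e (yAct L x) := by rw [he, he, hsy, hy]
    rw [this]
    simp [hsy]
  · obtain ⟨x, rfl⟩ := e.surjective x
    have : grpAct L g (e x) = e (grpAct L g x) := by rw [he, he, hsg, hg]
    rw [this]
    simp [hsg]
  · obtain ⟨x, rfl⟩ := e.surjective x
    change θ (s (e.symm (e x))) = e x
    rw [e.symm_apply_apply, he]

/-- The twist of a representation by a linear character. -/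
noncomputable abbrev twist (ψ : G →* kˣ) (V : GroupRep k G) : GroupRep k G where
  carrier := V.carrier
  ρ :=
    { toFun := fun h => (ψ h : k) • V.ρ h
      map_one' := by simp
      map_mul' := fun h h' => by
        rw [map_mul, map_mul, Units.val_mul, smul_mul_smul_comm] }

/-- For the zero module, M ⊕ M ≅ M. -/
theorem greenClass_eq_zero [Finite G] (M : FDModule k D.Hopf) (h : ∀ m : M.carrier, m = 0) :
    greenClass M = 0 := by
  have h1 : FDModule.Iso (M.directSum M) M :=
    ⟨⟨0, 0, fun _ => Prod.ext ((h _).trans (h _).symm) ((h _).trans (h _).symm),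
      fun _ => (h _).trans (h _).symm⟩, fun _ _ => (h _).trans (h _).symm⟩
  have h2 := (greenClass_directSum M M).symm.trans (greenClass_congr h1)
  exact add_eq_left.1 h2

theorem jord_apply_of_le {V : GroupRep k G} {hV : ∀ v, V.ρ (D.g ^ D.n) v = v} {l : ℕ} {hl : 0 < l}
    {hln : l ≤ D.n} (f : (jord V hV l hl hln).module.carrier) (j : ℕ) (hj : l ≤ j) : f.1 j = 0 :=
  LinearMap.congr_fun (seqEval_jord_eq_zero hj) f

variable [CharZero k] [Finite G]

/-- A module on which `y ^ d` and `g ^ n - 1` vanish has a summand given by the sequences of length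
`d` with a complement on which `y ^ (d - 1)` vanishes. -/
theorem exists_jord_summand (M : FDModule k D.Hopf) (hM : ∀ m, grpAct M (D.g ^ D.n) m = m)
    (d : ℕ) (hd : d + 1 ≤ D.n) (hy : yAct M ^ (d + 1) = 0) :
    ∃ (U : GroupRep k G) (hU : ∀ u, U.ρ (D.g ^ D.n) u = u) (K : FDModule k D.Hopf),
      (∀ m, grpAct K (D.g ^ D.n) m = m) ∧ yAct K ^ d = 0 ∧
      greenClass M = greenClass (jord U hU (d + 1) d.succ_pos hd).module + greenClass K := by
  have hχ : ∀ h : G, (D.χ h : k) ≠ 0 := fun h => (D.χ h).ne_zero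
  let p : Submodule k M.carrier := LinearMap.range (yAct M ^ d)
  have hp : ∀ h, ∀ m ∈ p, grpAct M h m ∈ p := by
    rintro h _ ⟨m, rfl⟩
    refine ⟨((D.χ h : k) ^ d)⁻¹ • grpAct M h m, ?_⟩
    rw [map_smul, yAct_pow_grpAct, smul_smul, inv_mul_cancel₀ (pow_ne_zero _ (hχ h)), one_smul]
  -- The image of y ^ d is the space of ends of the longest Jordan chains; it serves as the
  -- coefficients.
  let U : GroupRep k G := (res M).sub p hp
  have hU : ∀ u, U.ρ (D.g ^ D.n) u = u := fun u => Subtype.ext (hM u.1)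
  obtain ⟨π, hπ, hπ'⟩ := exists_equivariant_retraction U.ρ (grpAct M) p.subtype
    (fun _ _ => rfl) p.subtype_injective
  let f : M.carrier →ₗ[k] p := (yAct M ^ d).rangeRestrict
  -- The map y ^ d is equivariant only after twisting its source by χ ^ (-d), as y ^ d h = χ(h) ^ d
  -- h y ^ d. The section s lifts the ends of the chains to their tops.
  obtain ⟨s, hs, hs'⟩ := exists_equivariant_section (twist (D.χ ^ d)⁻¹ (res M)).ρ U.ρ f
    (fun h m => Subtype.ext (by
      change (yAct M ^ d) ((((D.χ ^ d)⁻¹ h : kˣ) : k) • grpAct M h m) =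
        grpAct M h ((yAct M ^ d) m)
      rw [map_smul, yAct_pow_grpAct, smul_smul, MonoidHom.inv_apply, MonoidHom.pow_apply,
        ← Units.val_pow_eq_pow_val, Units.inv_mul, one_smul]))
    (yAct M ^ d).surjective_rangeRestrict
  have hs1 : ∀ u, (yAct M ^ d) (s u) = u.1 := fun u => congrArg Subtype.val (hs' u)
  have hy' : ∀ i m, d + 1 ≤ i → (yAct M ^ i) m = 0 := fun i m hi => by
    rw [← Nat.sub_add_cancel hi, pow_add, hy, mul_zero, LinearMap.zero_apply]
  let S := jord U hU (d + 1) d.succ_pos hd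
  have hl : ∀ x, π ((yAct M ^ (d + 1)) x) = (0 : Module.End k U.carrier) (π x) := fun x => by
    rw [hy, LinearMap.zero_apply, map_zero, LinearMap.zero_apply]
  -- The term at position j is placed d - j steps down the chain, so that y ^ j brings it to the
  -- end.
  let σ : S.module.carrier →ₗ[k] M.carrier :=
    ∑ j ∈ Finset.range (d + 1), (yAct M ^ (d - j)) ∘ₗ s ∘ₗ seqEval (d + 1) 0 j
  have hσ : ∀ x, σ x = ∑ j ∈ Finset.range (d + 1), (yAct M ^ (d - j)) (s (x.1 j)) := fun x => by
    rw [LinearMap.sum_apply]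
    rfl
  have hiso := iso_directSum_ker_of_injective (S.coind π hl) (S.coind_yAct π hl)
    (S.coind_grpAct π hl hπ) σ (fun x => by
      rw [hσ, hσ, map_sum, Finset.sum_range_succ, Finset.sum_range_succ']
      have e1 : (yAct S.module x).1 d = 0 := by
        rw [S.yAct_module_apply]
        exact jord_apply_of_le x _ le_rfl
      have e2 : yAct M ((yAct M ^ (d - 0)) (s (x.1 0))) = 0 := by
        rw [← Module.End.mul_apply, ← pow_succ']
        exact hy' _ _ (by omega)
      rw [e1, e2, map_zero, map_zero]
      refine congrArg₂ (fun a b => a + b) (Finset.sum_congr rfl fun j hj => ?_) rfl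
      have hj' := Finset.mem_range.1 hj
      rw [S.yAct_module_apply, ← Module.End.mul_apply, ← pow_succ']
      congr 2
      omega) (fun h x => by
      rw [hσ, hσ, map_sum]
      refine Finset.sum_congr rfl fun j hj => ?_
      have hj' := Finset.mem_range.1 hj
      have e1 : s (U.ρ h (x.1 j)) = ((D.χ h : k) ^ d)⁻¹ • grpAct M h (s (x.1 j)) := by
        rw [hs]
        change (((D.χ ^ d)⁻¹ h : kˣ) : k) • grpAct M h (s (x.1 j)) = _
        rw [MonoidHom.inv_apply, MonoidHom.pow_apply, Units.val_inv_eq_inv_val,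
          Units.val_pow_eq_pow_val]
      rw [S.grpAct_module_apply, map_smul, map_smul, e1, map_smul, yAct_pow_grpAct, smul_smul,
        smul_smul]
      have e2 : (D.χ h : k) ^ j * (((D.χ h : k) ^ d)⁻¹ * (D.χ h : k) ^ (d - j)) = 1 := by
        have : (D.χ h : k) ^ d = (D.χ h : k) ^ (d - j) * (D.χ h : k) ^ j := by
          rw [← pow_add]
          congr 1
          omega
        rw [this]
        field_simp [hχ h]
      rw [mul_assoc, e2, one_smul]) (fun x hx => by
      -- Descending induction on the position i. In π(y ^ i σ x) the terms with j < i contain a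
      -- power of y above d, those with j > i vanish by induction, and j = i gives x i.
      have key : ∀ t, ∀ j, d + 1 ≤ j + t → x.1 j = 0 := by
        intro t
        induction t with
        | zero => exact fun j hj => jord_apply_of_le x j hj
        | succ t ih =>
          intro i hi
          by_cases hid : d + 1 ≤ i
          · exact jord_apply_of_le x i hid
          have h1 : π ((yAct M ^ i) (σ x)) = 0 :=
            congrArg (fun t : S.module.carrier => t.1 i) hx
          rw [hσ, map_sum, Finset.sum_eq_single i] at h1
          · rw [← Module.End.mul_apply, ← pow_add, Nat.add_sub_of_le (by omega), hs1] at h1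
            exact (hπ' _).symm.trans h1
          · intro j hj hji
            have hj' := Finset.mem_range.1 hj
            rcases lt_or_gt_of_ne hji with h | h
            · rw [← Module.End.mul_apply, ← pow_add]
              exact hy' _ _ (by omega)
            · rw [ih j (by omega), map_zero, map_zero, map_zero]
          · intro hi'
            exact absurd (Finset.mem_range.2 (by omega)) hi'
      exact Subtype.ext (funext fun j => key (d + 1) j (by omega)))
  refine ⟨U, hU, _, fun m => Subtype.ext ?_, ?_,
    (greenClass_congr hiso).trans (greenClass_directSum _ _)⟩
  · rw [coe_grpAct_subMod]
    exact hM m.1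
  · refine LinearMap.ext fun m => Subtype.ext ?_
    rw [coe_yAct_pow_subMod]
    -- On the kernel π(y ^ d m) = 0, but π is the identity on the image of y ^ d, so y ^ d m = 0.
    have h1 : π ((yAct M ^ d) m.1) = 0 :=
      congrArg (fun t : S.module.carrier => t.1 d) (LinearMap.mem_ker.1 m.2)
    have h2 := hπ' ⟨(yAct M ^ d) m.1, m.1, rfl⟩
    exact congrArg Subtype.val (h2.symm.trans h1)

/-- A module on which `y ^ d` and `g ^ n - 1` vanish is a sum of modules of sequences. -/
theorem greenClass_eq_sum_jord (d : ℕ) (hd : d ≤ D.n) : ∀ (M : FDModule k D.Hopf),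
    (∀ m, grpAct M (D.g ^ D.n) m = m) → yAct M ^ d = 0 →
    ∃ V : Fin d → {V : GroupRep k G // ∀ v, V.ρ (D.g ^ D.n) v = v},
      greenClass M = ∑ j : Fin d,
        greenClass (jord (V j).1 (V j).2 (j + 1) j.1.succ_pos (by omega)).module := by
  induction d with
  | zero =>
    intro M _ hy
    refine ⟨fun j => j.elim0, ?_⟩
    rw [Finset.univ_eq_empty, Finset.sum_empty]
    refine greenClass_eq_zero M fun m => ?_
    rw [pow_zero] at hy
    exact LinearMap.congr_fun hy m
  | succ d ih =>
    intro M hM hy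
    obtain ⟨U, hU, K, hK, hKy, h⟩ := exists_jord_summand M hM d hd hy
    obtain ⟨V, h'⟩ := ih (by omega) K hK hKy
    refine ⟨Fin.snoc (α := fun _ => {V : GroupRep k G // ∀ v, V.ρ (D.g ^ D.n) v = v}) V ⟨U, hU⟩,
      ?_⟩
    rw [Fin.sum_univ_castSucc, h, h', add_comm]
    refine congrArg₂ (fun a b => a + b) (Finset.sum_congr rfl fun j _ => ?_) ?_
    · exact congrArg (fun W : {V : GroupRep k G // ∀ v, V.ρ (D.g ^ D.n) v = v} =>
        greenClass (jord W.1 W.2 (j + 1) j.1.succ_pos (by omega)).module)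
        (Fin.snoc_castSucc (α := fun _ => {V : GroupRep k G // ∀ v, V.ρ (D.g ^ D.n) v = v})
          ⟨U, hU⟩ V j).symm
    · exact congrArg (fun W : {V : GroupRep k G // ∀ v, V.ρ (D.g ^ D.n) v = v} =>
        greenClass (jord W.1 W.2 (d + 1) d.succ_pos hd).module)
        (Fin.snoc_last (α := fun _ => {V : GroupRep k G // ∀ v, V.ρ (D.g ^ D.n) v = v})
          ⟨U, hU⟩ V).symm

end Decomposition

/-! ### Polynomials in operators of finite order. -/

section FiniteOrder

open Polynomial

variable {k : Type u} [Field k]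

/-- For a = y ^ i the relation y g = q g y moves p(q ^ j g) across a as p(q ^ (j + i) g). -/
theorem semiconjBy_aeval {B : Type*} [Ring B] [Algebra k B] {a x y : B} (h : SemiconjBy a x y)
    (p : k[X]) : SemiconjBy a (aeval x p) (aeval y p) := by
  induction p using Polynomial.induction_on' with
  | add p q hp hq => rw [map_add, map_add]; exact hp.add_right hq
  | monomial i c =>
    rw [aeval_monomial, aeval_monomial]
    exact (show SemiconjBy a _ _ from (Algebra.commutes c a).symm).mul_right (h.pow_right i)

theorem aeval_smul_eq_comp {B : Type*} [Ring B] [Algebra k B] (x : B) (c : k) (p : k[X]) :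
    aeval (c • x) p = aeval x (p.comp (C c * X)) := by
  rw [aeval_comp, map_mul, aeval_C, aeval_X, Algebra.smul_def]

variable [IsAlgClosed k] [CharZero k]

/-- A polynomial which vanishes at the roots of unity of order `r` kills the elements of order
`r`. -/
theorem aeval_eq_zero_of_pow_eq_one {B : Type*} [Ring B] [Algebra k B] {x : B} {r : ℕ}
    (hr : 0 < r) (hx : x ^ r = 1) {p : k[X]} (hp : ∀ c, c ^ r = 1 → p.eval c = 0) :
    aeval x p = 0 := by
  have : NeZero (r : k) := ⟨by exact_mod_cast hr.ne'⟩
  obtain ⟨ζ, hζ⟩ := HasEnoughRootsOfUnity.exists_primitiveRoot k r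
  have h : X ^ r - 1 ∣ p := by
    rw [X_pow_sub_one_eq_prod hr hζ]
    refine Finset.prod_dvd_of_coprime
      (fun a _ b _ hab => pairwise_coprime_X_sub_C (s := fun c : k => c) (fun _ _ h => h) hab)
      fun c hc => dvd_iff_isRoot.2 (hp c ((mem_nthRootsFinset hr 1).1 hc))
  obtain ⟨s, rfl⟩ := h
  rw [map_mul, map_sub, map_pow, aeval_X, map_one, hx, sub_self, zero_mul]

theorem aeval_eq_aeval_of_pow_eq_one {B : Type*} [Ring B] [Algebra k B] {x : B} {r : ℕ}
    (hr : 0 < r) (hx : x ^ r = 1) {p p' : k[X]} (hp : ∀ c, c ^ r = 1 → p.eval c = p'.eval c) :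
    aeval x p = aeval x p' := by
  rw [← sub_eq_zero, ← map_sub]
  exact aeval_eq_zero_of_pow_eq_one hr hx fun c hc => by rw [eval_sub, hp c hc, sub_self]

/-- There is a polynomial which is the indicator function on the roots of unity of order `r` of a
set of representatives of the cosets of the roots of unity of order `n`. -/
theorem exists_transversal_polynomial {q : k} {n r : ℕ} (hq : IsPrimitiveRoot q n) (hn : 0 < n)
    (hr : 0 < r) (hqr : q ^ r = 1) : ∃ p : k[X],
      (∀ c, c ^ r = 1 → p.eval c * p.eval c = p.eval c) ∧
      ∀ c, c ^ r = 1 → ∑ j ∈ Finset.range n, p.eval (q ^ j * c) = 1 := by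
  classical
  -- The coset of c modulo the n-th roots of unity is determined by c ^ n, and the chosen n-th root
  -- f (c ^ n) is its representative. Lagrange interpolation turns the indicator of the
  -- representatives into a polynomial.
  choose f hf using fun d : k => IsAlgClosed.exists_pow_nat_eq d hn
  let φ : k → k := fun c => if c = f (c ^ n) then 1 else 0
  let p := Lagrange.interpolate (nthRootsFinset r (1 : k)) id φ
  have hp : ∀ c, c ^ r = 1 → p.eval c = φ c := fun c hc =>
    Lagrange.eval_interpolate_at_node φ (Function.injective_id.injOn)
      ((mem_nthRootsFinset hr 1).2 hc)
  have hqn : ∀ j, (q ^ j) ^ n = 1 := fun j => by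
    rw [← pow_mul, mul_comm, pow_mul, hq.pow_eq_one, one_pow]
  refine ⟨p, fun c hc => ?_, fun c hc => ?_⟩
  · rw [hp c hc]
    simp only [φ]
    split_ifs <;> simp
  · have h0 : c ≠ 0 := by
      rintro rfl
      rw [zero_pow hr.ne'] at hc
      exact zero_ne_one hc
    have : NeZero n := ⟨hn.ne'⟩
    -- Exactly one of the points q ^ i c with i < n is the representative, so the sum has a single
    -- nonzero term.
    obtain ⟨i, hi, hqi⟩ := hq.eq_pow_of_pow_eq_one (ξ := f (c ^ n) / c) (by
      rw [div_pow, hf, div_self (pow_ne_zero _ h0)])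
    have hi' : q ^ i * c = f (c ^ n) := by rw [hqi, div_mul_cancel₀ _ h0]
    have key : ∀ j, p.eval (q ^ j * c) = if q ^ j * c = f (c ^ n) then 1 else 0 := fun j => by
      rw [hp _ (by rw [mul_pow, hc, mul_one, ← pow_mul, mul_comm, pow_mul, hqr, one_pow])]
      simp only [φ, mul_pow (q ^ j) c n, hqn, one_mul]
    rw [Finset.sum_congr rfl fun j _ => key j, Finset.sum_eq_single i, if_pos hi']
    · intro j hj hji
      rw [← hi', if_neg]
      exact fun h => hji (hq.pow_inj (Finset.mem_range.1 hj) hi (mul_right_cancel₀ h0 h))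
    · exact fun h => absurd (Finset.mem_range.2 hi) h

end FiniteOrder

/-! ### Modules on which y is injective, and the generators of the Green ring. -/

section Decomposition

variable {k : Type u} {G : Type v} [Field k] [Group G] {D : GroupDatum k G}

open GroupDatum GroupDatum.Hopf GroupRep

theorem grpAct_g_comm (M : FDModule k D.Hopf) (h : G) (m : M.carrier) :
    grpAct M h (grpAct M D.g m) = grpAct M D.g (grpAct M h m) := by
  rw [← Module.End.mul_apply, ← Module.End.mul_apply, ← map_mul, ← map_mul,
    Subgroup.mem_center_iff.1 D.g_mem_center h]

theorem chi_g_pow_n (D : GroupDatum k G) : (D.χ D.g : k) ^ D.n = 1 :=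
  (isPrimitiveRoot (D := D)).pow_eq_one

theorem yAct_grpAct_pow_n (M : FDModule k D.Hopf) (m : M.carrier) :
    yAct M (grpAct M (D.g ^ D.n) m) = grpAct M (D.g ^ D.n) (yAct M m) := by
  rw [yAct_grpAct, map_pow, Units.val_pow_eq_pow_val, chi_g_pow_n, one_smul]

variable [Finite G] [CharZero k]

section

open Polynomial

variable [IsAlgClosed k]

/-- A module on which `y` is injective is induced. -/
theorem iso_ind_of_injective (hχ : D.χ ^ D.n = 1) (M : FDModule k D.Hopf)
    (hy : Function.Injective (yAct M)) :
    ∃ W : GroupRep k G, FDModule.Iso M (ind hχ W).module := by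
  set q : k := (D.χ D.g : k) with hq_def
  have hq : IsPrimitiveRoot q D.n := isPrimitiveRoot (D := D)
  have hr : 0 < orderOf D.g := orderOf_pos D.g
  have hqr : q ^ orderOf D.g = 1 := by
    rw [hq_def, ← Units.val_pow_eq_pow_val, ← map_pow, pow_orderOf_eq_one, map_one, Units.val_one]
  obtain ⟨p, hp1, hp2⟩ := exists_transversal_polynomial hq (n_pos D) hr hqr
  let A : Module.End k M.carrier := grpAct M D.g
  have hA : A ^ orderOf D.g = 1 := by
    rw [← map_pow, pow_orderOf_eq_one, map_one]
  -- The operator ε j projects to the eigenvectors of g whose eigenvalue c has q ^ j c in the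
  -- transversal. These projections sum to 1, and y carries ε j to ε (j + 1), cyclically modulo n.
  -- The image of ε 0 is the representation to induce from.
  let ε : ℕ → Module.End k M.carrier := fun j => aeval (q ^ j • A) p
  have hA' : ∀ j, (q ^ j • A) ^ orderOf D.g = 1 := fun j => by
    rw [_root_.smul_pow, hA, ← pow_mul, mul_comm, pow_mul, hqr, one_pow, one_smul]
  have hidem : ε 0 * ε 0 = ε 0 := by
    rw [← map_mul]
    exact aeval_eq_aeval_of_pow_eq_one hr (hA' 0) fun c hc => by rw [eval_mul, hp1 c hc]
  have hsum : ∑ j ∈ Finset.range D.n, ε j = 1 := by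
    have e : ∀ j, ε j = aeval A (p.comp (C (q ^ j) * X)) := fun j => aeval_smul_eq_comp _ _ _
    rw [Finset.sum_congr rfl fun j _ => e j, ← map_sum, ← map_one (aeval (R := k) A)]
    refine aeval_eq_aeval_of_pow_eq_one hr hA fun c hc => ?_
    rw [eval_finsetSum, eval_one, ← hp2 c hc]
    refine Finset.sum_congr rfl fun j _ => ?_
    rw [eval_comp, eval_mul, eval_C, eval_X]
  have hε : ∀ i j, yAct M ^ i * ε j = ε (j + i) * yAct M ^ i := fun i j => by
    refine semiconjBy_aeval (LinearMap.ext fun m => ?_) p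
    change (yAct M ^ i) (q ^ j • A m) = q ^ (j + i) • A ((yAct M ^ i) m)
    rw [map_smul, yAct_pow_grpAct, smul_smul, pow_add]
  have hεn : ε D.n = ε 0 := by
    change aeval (q ^ D.n • A) p = aeval (q ^ 0 • A) p
    rw [hq.pow_eq_one, pow_zero]
  have hεg : ∀ h, grpAct M h * ε 0 = ε 0 * grpAct M h := fun h =>
    semiconjBy_aeval (LinearMap.ext fun m => by
      change grpAct M h (q ^ 0 • A m) = q ^ 0 • A (grpAct M h m)
      rw [map_smul, grpAct_g_comm]) p
  have hpow : ∀ i : ℕ, Function.Injective (yAct M ^ i : Module.End k M.carrier) := fun i => by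
    rw [Module.End.coe_pow]
    exact hy.iterate i
  let P : Submodule k M.carrier := LinearMap.range (ε 0)
  have hP : ∀ h, ∀ m ∈ P, grpAct M h m ∈ P := by
    rintro h _ ⟨m, rfl⟩
    exact ⟨grpAct M h m, (LinearMap.congr_fun (hεg h) m).symm⟩
  let W : GroupRep k G := (res M).sub P hP
  let π : M.carrier →ₗ[k] W.carrier := (ε 0).rangeRestrict
  refine ⟨W, (ind hχ W).iso_module π (fun x => Subtype.ext ?_) (fun h x => Subtype.ext ?_)
    (fun x hx => ?_) ?_⟩
  · change ε 0 ((yAct M ^ D.n) x) = D.μ • (grpAct M (D.g ^ D.n) (ε 0 x) - ε 0 x)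
    rw [yAct_pow_n, map_smul, map_sub]
    exact congrArg (fun t => D.μ • (t - ε 0 x)) (LinearMap.congr_fun (hεg _) x).symm
  · exact (LinearMap.congr_fun (hεg h) x).symm
  · have h1 : ∀ i, i < D.n → ε i x = 0 := fun i hi => by
      rcases Nat.eq_zero_or_pos i with rfl | hi0
      · exact congrArg Subtype.val (hx 0 (n_pos D))
      · refine hpow (D.n - i) ?_
        rw [map_zero, ← Module.End.mul_apply, hε, Nat.add_sub_cancel' hi.le]
        have := congrArg Subtype.val (hx (D.n - i) (Nat.sub_lt (n_pos D) hi0))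
        rw [hεn]
        exact this
    rw [← Module.End.one_apply (R := k) x, ← hsum, LinearMap.sum_apply]
    exact Finset.sum_eq_zero fun i hi => h1 i (Finset.mem_range.1 hi)
  -- The invertible operator y ^ i conjugates ε 0 to ε i, so all n projections have the same trace;
  -- their sum gives dim M = n dim P.
  · have htr : ∀ i, LinearMap.trace k M.carrier (ε i) = LinearMap.trace k M.carrier (ε 0) := by
      intro i
      let e := LinearEquiv.ofInjectiveEndo (yAct M ^ i) (hpow i)
      rw [← LinearMap.trace_conj' (ε 0) e]
      congr 1
      refine LinearMap.ext fun m => ?_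
      obtain ⟨m, rfl⟩ := e.surjective m
      rw [LinearEquiv.conj_apply_apply, e.symm_apply_apply]
      have := LinearMap.congr_fun (hε i 0) m
      rw [zero_add] at this
      exact this.symm
    have h1 : LinearMap.trace k M.carrier (ε 0) = (Module.finrank k P : k) :=
      (LinearMap.IsIdempotentElem.isProj_range _ hidem).trace
    have h2 := congrArg (LinearMap.trace k M.carrier) hsum
    rw [map_sum, Finset.sum_congr rfl fun i _ => htr i, Finset.sum_const, Finset.card_range, h1,
      LinearMap.trace_one, nsmul_eq_mul, ← Nat.cast_mul] at h2
    exact (Nat.cast_injective h2).symm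

end

/-- A module is the sum of a module on which `g ^ n = 1` and a module on which `g ^ n - 1` is
injective. -/
theorem exists_splitting (M : FDModule k D.Hopf) : ∃ M₀ M₁ : FDModule k D.Hopf,
    FDModule.Iso M (M₀.directSum M₁) ∧ (∀ m, grpAct M₀ (D.g ^ D.n) m = m) ∧
      ∀ m, grpAct M₁ (D.g ^ D.n) m = m → m = 0 := by
  let A : Module.End k M.carrier := grpAct M (D.g ^ D.n)
  set r := Nat.card G with hr
  have hr0 : (r : k) ≠ 0 := Nat.cast_ne_zero.2 Nat.card_pos.ne'
  have hA : A ^ r = 1 := by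
    rw [← map_pow, pow_card_eq_one', map_one]
  -- Averaging over the powers of g ^ n projects onto its fixed space. The two summands are this
  -- space and the kernel of e.
  let e : Module.End k M.carrier := (r : k)⁻¹ • ∑ i ∈ Finset.range r, A ^ i
  have he : ∀ m, e m = (r : k)⁻¹ • ∑ i ∈ Finset.range r, (A ^ i) m := fun m => by
    simp [e, LinearMap.sum_apply]
  let p : Submodule k M.carrier := LinearMap.ker (A - 1)
  have hp : ∀ m, m ∈ p ↔ A m = m := fun m => by
    rw [LinearMap.mem_ker, LinearMap.sub_apply, Module.End.one_apply, sub_eq_zero]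
  have hAg : ∀ h m, A (grpAct M h m) = grpAct M h (A m) := fun h m => by
    change grpAct M (D.g ^ D.n) (grpAct M h m) = grpAct M h (grpAct M (D.g ^ D.n) m)
    rw [← Module.End.mul_apply, ← Module.End.mul_apply, ← map_mul, ← map_mul,
      Subgroup.mem_center_iff.1 (pow_mem D.g_mem_center D.n) h]
  have hAy : ∀ m, A (yAct M m) = yAct M (A m) := fun m => (yAct_grpAct_pow_n M m).symm
  have hcomm : ∀ B : Module.End k M.carrier, (∀ m, A (B m) = B (A m)) → ∀ m, e (B m) = B (e m) := by
    intro B hB m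
    have hc : Commute A B := LinearMap.ext hB
    rw [he, he, map_smul, map_sum]
    congr 1
    exact Finset.sum_congr rfl fun i _ => LinearMap.congr_fun (hc.pow_left i) m
  have hmem : ∀ m, e m ∈ p := fun m => by
    rw [hp, he, map_smul, map_sum]
    congr 1
    have h1 := Finset.sum_range_succ' (fun i => (A ^ i) m) r
    rw [Finset.sum_range_succ, hA, pow_zero] at h1
    rw [add_right_cancel h1]
    refine Finset.sum_congr rfl fun i _ => ?_
    rw [pow_succ', Module.End.mul_apply]
  have hid : ∀ m, A m = m → e m = m := fun m hm => by
    have h1 : ∀ i, (A ^ i) m = m := fun i => by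
      induction i with
      | zero => rfl
      | succ i ih => rw [pow_succ, Module.End.mul_apply, hm, ih]
    rw [he, Finset.sum_congr rfl fun i _ => h1 i, Finset.sum_const, Finset.card_range,
      ← Nat.cast_smul_eq_nsmul k, smul_smul, inv_mul_cancel₀ hr0, one_smul]
  have hpy : ∀ m ∈ p, yAct M m ∈ p := fun m hm => by
    rw [hp] at hm ⊢
    rw [hAy, hm]
  have hpg : ∀ h, ∀ m ∈ p, grpAct M h m ∈ p := fun h m hm => by
    rw [hp] at hm ⊢
    rw [hAg, hm]
  let θ : M.carrier →ₗ[k] p := e.codRestrict p hmem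
  refine ⟨subMod M p hpy hpg, _, iso_directSum_ker (L := subMod M p hpy hpg) θ
    (fun m => Subtype.ext ?_) (fun h m => Subtype.ext ?_) p.subtype
    (fun x => coe_yAct_subMod M p hpy hpg x) (fun h x => coe_grpAct_subMod M p hpy hpg h x)
    (fun x => Subtype.ext ?_), fun m => Subtype.ext ?_, fun m hm => Subtype.ext ?_⟩
  · exact (hcomm _ hAy m).trans (coe_yAct_subMod M p hpy hpg (θ m)).symm
  · exact (hcomm _ (hAg h) m).trans (coe_grpAct_subMod M p hpy hpg h (θ m)).symm
  · exact hid _ ((hp _).1 x.2)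
  · exact (coe_grpAct_subMod M p hpy hpg _ m).trans ((hp _).1 m.2)
  · have h1 := congrArg Subtype.val hm
    rw [coe_grpAct_subMod] at h1
    have h2 : θ m.1 = 0 := m.2
    exact (hid _ h1).symm.trans (congrArg Subtype.val h2)

variable [IsAlgClosed k]

/-- Modules of sequences and induced modules generate the Green ring. -/
theorem exists_greenClass_eq (hD : D.IsNonNilpotent) (M : FDModule k D.Hopf) :
    ∃ (V : Fin (D.n - 1) → {V : GroupRep k G // ∀ v, V.ρ (D.g ^ D.n) v = v}) (W W' : GroupRep k G),
      greenClass M = ∑ j : Fin (D.n - 1),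
        greenClass (jord (V j).1 (V j).2 (j + 1) j.1.succ_pos (by omega)).module +
          greenClass (ind hD.2 W).module + greenClass (ind hD.2 W').module := by
  obtain ⟨M₀, M₁, hM, h0, h1⟩ := exists_splitting M
  have hμ : D.μ ≠ 0 := fun h => hD.1 (by rw [h, zero_smul])
  have hn := n_pos D
  -- If y m = 0 then μ(g ^ n - 1) m = y ^ n m = 0; since μ ≠ 0, m is fixed by g ^ n and hence zero.
  obtain ⟨W', hW'⟩ := iso_ind_of_injective hD.2 M₁ (by
    rw [← LinearMap.ker_eq_bot, LinearMap.ker_eq_bot']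
    intro m hm
    refine h1 m (sub_eq_zero.1 ((smul_eq_zero.1 ((yAct_pow_n M₁ m).symm.trans ?_)).resolve_left hμ))
    rw [← Nat.sub_add_cancel hn, pow_succ, Module.End.mul_apply, hm, map_zero])
  have hy : yAct M₀ ^ (D.n - 1 + 1) = 0 := LinearMap.ext fun m => by
    rw [Nat.sub_add_cancel hn, yAct_pow_n, h0, sub_self, smul_zero, LinearMap.zero_apply]
  -- The summand of length n is split off on its own, because it is counted as induced.
  obtain ⟨U, hU, K, hK, hKy, h⟩ := exists_jord_summand M₀ h0 (D.n - 1) (by omega) hy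
  obtain ⟨V, hV⟩ := greenClass_eq_sum_jord (D.n - 1) (by omega) K hK hKy
  refine ⟨V, U, W', ?_⟩
  have e : ∀ l hl hln, l = D.n → greenClass (jord U hU l hl hln).module =
      greenClass (ind hD.2 U).module := by
    rintro l hl hln rfl
    exact greenClass_congr (jord_n_iso_ind hD.2 U hU)
  rw [greenClass_congr hM, greenClass_directSum, h, e _ _ _ (Nat.sub_add_cancel hn), hV, greenClass_congr hW',
    add_comm (greenClass (ind hD.2 U).module)]

end Decomposition

/-! ### Multiplicities read off from the socle, and restriction to G. -/

section Multiplicities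

variable {k : Type u} {G : Type v} [Field k] [Group G] {D : GroupDatum k G}

open GroupDatum GroupDatum.Hopf GroupRep

theorem GroupRep.sub_iso {V W : GroupRep k G} (e : V.carrier ≃ₗ[k] W.carrier)
    (he : ∀ h v, e (V.ρ h v) = W.ρ h (e v)) {p : Submodule k V.carrier} {p' : Submodule k W.carrier}
    (hp : ∀ h, ∀ v ∈ p, V.ρ h v ∈ p) (hp' : ∀ h, ∀ v ∈ p', W.ρ h v ∈ p')
    (h : ∀ v, v ∈ p ↔ e v ∈ p') : Iso (V.sub p hp) (W.sub p' hp') :=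
  ⟨e.ofSubmodules p p' (Submodule.ext fun w => by
    rw [Submodule.mem_map]
    refine ⟨?_, fun hw => ⟨e.symm w, (h _).2 (by rwa [e.apply_symm_apply]), e.apply_symm_apply w⟩⟩
    rintro ⟨v, hv, rfl⟩
    exact (h v).1 hv), fun g v => Subtype.ext (he g v.1)⟩

theorem GroupRep.sub_prod_iso {V W : GroupRep k G} {p : Submodule k (V.prod W).carrier}
    {p₁ : Submodule k V.carrier} {p₂ : Submodule k W.carrier}
    (hp : ∀ h, ∀ v ∈ p, (V.prod W).ρ h v ∈ p) (hp₁ : ∀ h, ∀ v ∈ p₁, V.ρ h v ∈ p₁)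
    (hp₂ : ∀ h, ∀ v ∈ p₂, W.ρ h v ∈ p₂) (h : ∀ v w, (v, w) ∈ p ↔ v ∈ p₁ ∧ w ∈ p₂) :
    Iso ((V.prod W).sub p hp) ((V.sub p₁ hp₁).prod (W.sub p₂ hp₂)) :=
  ⟨{ toFun := fun x => (⟨x.1.1, ((h _ _).1 x.2).1⟩, ⟨x.1.2, ((h _ _).1 x.2).2⟩)
     map_add' := fun _ _ => rfl
     map_smul' := fun _ _ => rfl
     invFun := fun x => ⟨(x.1.1, x.2.1), (h _ _).2 ⟨x.1.2, x.2.2⟩⟩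
     left_inv := fun _ => rfl
     right_inv := fun _ => rfl }, fun _ _ => rfl⟩

theorem GroupRep.vchar_eq_zero {V : GroupRep k G} (h : ∀ v : V.carrier, v = 0) : V.vchar = 0 := by
  refine Subtype.ext (funext fun g => ?_)
  have h1 : V.ρ g = 0 := LinearMap.ext fun v => h _
  change LinearMap.trace k _ (V.ρ g) = 0
  rw [h1, map_zero]

/-- The elements killed by `y` which are divisible by `y ^ i`. -/
noncomputable abbrev socle (i : ℕ) (M : FDModule k D.Hopf) : GroupRep k G :=
  (res M).sub (LinearMap.ker (yAct M) ⊓ LinearMap.range (yAct M ^ i)) fun h m hm => by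
    obtain ⟨h1, m, rfl⟩ := hm
    have hχ : (D.χ h : k) ≠ 0 := (D.χ h).ne_zero
    refine ⟨?_, ((D.χ h : k) ^ i)⁻¹ • grpAct M h m, ?_⟩
    · change yAct M (grpAct M h _) = 0
      rw [yAct_grpAct, LinearMap.mem_ker.1 h1, map_zero, smul_zero]
    · rw [map_smul, yAct_pow_grpAct, smul_smul, inv_mul_cancel₀ (pow_ne_zero _ hχ), one_smul]

theorem socle_congr (i : ℕ) {M N : FDModule k D.Hopf} (h : FDModule.Iso M N) :
    Iso (socle i M) (socle i N) := by
  obtain ⟨f, hf⟩ := h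
  have hy : ∀ m, f (yAct M m) = yAct N (f m) := hf _
  have hyi : ∀ m, f ((yAct M ^ i) m) = (yAct N ^ i) (f m) := fun m => by
    have := hf (Y D ^ i) m
    rwa [map_pow, map_pow] at this
  refine GroupRep.sub_iso f (fun h => hf _) _ _ fun m => ?_
  rw [Submodule.mem_inf, Submodule.mem_inf, LinearMap.mem_ker, LinearMap.mem_ker, ← hy,
    f.map_eq_zero_iff]
  refine and_congr_right fun _ => ⟨?_, ?_⟩
  · rintro ⟨x, rfl⟩
    exact ⟨f x, (hyi x).symm⟩
  · rintro ⟨x, hx⟩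
    refine ⟨f.symm x, f.injective ?_⟩
    rw [hyi, f.apply_symm_apply, hx]

theorem yAct_pow_directSum (M N : FDModule k D.Hopf) (i : ℕ) (m : M.carrier) (n : N.carrier) :
    (yAct (M.directSum N) ^ i) (m, n) = ((yAct M ^ i) m, (yAct N ^ i) n) := by
  induction i generalizing m n with
  | zero => rfl
  | succ i ih =>
    rw [pow_succ, pow_succ, pow_succ]
    exact ih _ _

theorem socle_directSum (i : ℕ) (M N : FDModule k D.Hopf) :
    Iso (socle i (M.directSum N)) ((socle i M).prod (socle i N)) := by
  refine GroupRep.sub_prod_iso (V := res M) (W := res N) _ _ _ fun m n => ?_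
  constructor
  · rintro ⟨h1, x, hx⟩
    have h2 := (yAct_pow_directSum M N i x.1 x.2).symm.trans hx
    have h3 : (yAct M m, yAct N n) = (0, 0) := h1
    exact ⟨⟨congrArg Prod.fst h3, x.1, congrArg Prod.fst h2⟩,
      congrArg Prod.snd h3, x.2, congrArg Prod.snd h2⟩
  · rintro ⟨⟨h1, x, hx⟩, h2, x', hx'⟩
    exact ⟨Prod.ext h1 h2, (x, x'), (yAct_pow_directSum M N i x x').trans (Prod.ext hx hx')⟩

theorem SeqDatum.ker_lam_stable {V : GroupRep k G} (S : SeqDatum D V) (h : G) :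
    ∀ v ∈ LinearMap.ker S.lam, V.ρ h v ∈ LinearMap.ker S.lam := fun v hv => by
  rw [LinearMap.mem_ker] at hv ⊢
  rw [S.lam_rho, hv, map_zero, smul_zero]

/-- A sequence killed by the shift is supported at position 0, and its value u there lies in the
kernel of the monodromy since the term at position l is 0. Conversely, it is y ^ i of the sequence
with value u at position i. So the answer does not depend on i < l. -/
theorem SeqDatum.socle_module {V : GroupRep k G} (S : SeqDatum D V) {i : ℕ} (hi : i < S.l) :
    Iso (socle i S.module) (V.sub (LinearMap.ker S.lam) S.ker_lam_stable) := by
  have h0 : ∀ f : (socle i S.module).carrier, ∀ j, f.1.1 (j + 1) = 0 := fun f j => by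
    rw [← S.yAct_module_apply, LinearMap.mem_ker.1 f.2.1]
    rfl
  let δ : ℕ → V.carrier → ℕ → V.carrier := fun i v j => if j = i then v else 0
  have hδ : ∀ i v, δ i v i = v := fun i v => if_pos rfl
  have hδ' : ∀ i v j, j ≠ i → δ i v j = 0 := fun i v j h => if_neg h
  have hmem : ∀ i < S.l, ∀ v ∈ LinearMap.ker S.lam, δ i v ∈ seqSpace S.l S.lam := by
    intro i hi v hv j
    rw [hδ' _ _ _ (by omega)]
    rcases eq_or_ne j i with rfl | hj
    · rw [hδ, LinearMap.mem_ker.1 hv]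
    · rw [hδ' _ _ _ hj, map_zero]
  refine ⟨{ toFun := fun f => ⟨f.1.1 0, ?_⟩
            map_add' := fun _ _ => rfl
            map_smul' := fun _ _ => rfl
            invFun := fun u => ⟨⟨δ 0 u.1, hmem 0 S.l_pos u.1 u.2⟩, ?_,
              ⟨δ i u.1, hmem i hi u.1 u.2⟩, ?_⟩
            left_inv := fun f => ?_
            right_inv := fun u => ?_ }, fun h f => Subtype.ext ?_⟩
  · have h2 := h0 f (S.l - 1)
    rw [Nat.sub_add_cancel S.l_pos] at h2
    exact (f.1.2 0).symm.trans ((congrArg f.1.1 (zero_add S.l)).trans h2)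
  · refine Subtype.ext (funext fun j => ?_)
    rw [S.yAct_module_apply]
    exact hδ' 0 u.1 _ (Nat.succ_ne_zero j)
  · refine Subtype.ext (funext fun j => ?_)
    rw [S.yAct_module_pow_apply]
    change δ i u.1 (j + i) = δ 0 u.1 j
    rcases eq_or_ne j 0 with rfl | hj
    · rw [zero_add, hδ, hδ]
    · rw [hδ' _ _ _ hj, hδ' _ _ _ (by omega)]
  · refine Subtype.ext (Subtype.ext (funext fun j => ?_))
    rcases j with _ | j
    · exact hδ 0 (f.1.1 0)
    · exact (hδ' 0 (f.1.1 0) _ (Nat.succ_ne_zero j)).trans (h0 f j).symm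
  · exact Subtype.ext (hδ 0 u.1)
  · change (grpAct S.module h f.1).1 0 = V.ρ h (f.1.1 0)
    rw [S.grpAct_module_apply, pow_zero, one_smul]

theorem vchar_socle_jord {V : GroupRep k G} (hV : ∀ v, V.ρ (D.g ^ D.n) v = v) {l : ℕ} (hl : 0 < l)
    (hln : l ≤ D.n) (i : ℕ) :
    (socle i (jord V hV l hl hln).module).vchar = if i < l then V.vchar else 0 := by
  split_ifs with hi
  · refine ((jord V hV l hl hln).socle_module hi).vchar_eq.trans (Iso.vchar_eq ?_)
    refine ⟨{ toFun := fun v => v.1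
              map_add' := fun _ _ => rfl
              map_smul' := fun _ _ => rfl
              invFun := fun v => ⟨v, rfl⟩
              left_inv := fun _ => rfl
              right_inv := fun _ => rfl }, fun _ _ => rfl⟩
  · refine GroupRep.vchar_eq_zero ?_
    rintro ⟨_, _, f, rfl⟩
    refine Subtype.ext (Subtype.ext (funext fun j => ?_))
    change ((yAct (jord V hV l hl hln).module ^ i) f).1 j = 0
    rw [SeqDatum.yAct_module_pow_apply]
    exact jord_apply_of_le f _ (by omega)

variable [Finite G]

variable (D) in
/-- The multiplicity of the modules of sequences of length `j + 1`. -/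
noncomputable def multiplicity (j : ℕ) : GreenRing k D.Hopf →+ virtualChar k G :=
  GreenRing.lift (fun M => (socle j M).vchar - (socle (j + 1) M).vchar)
    (fun M N h => by rw [(socle_congr j h).vchar_eq, (socle_congr (j + 1) h).vchar_eq])
    (fun M N => by
      rw [(socle_directSum j M N).vchar_eq, (socle_directSum (j + 1) M N).vchar_eq,
        GroupRep.vchar_prod, GroupRep.vchar_prod, add_sub_add_comm])

theorem multiplicity_greenClass (j : ℕ) (M : FDModule k D.Hopf) :
    multiplicity D j (greenClass M) = (socle j M).vchar - (socle (j + 1) M).vchar :=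
  GreenRing.lift_greenClass _ _ _ M

theorem multiplicity_jord {V : GroupRep k G} (hV : ∀ v, V.ρ (D.g ^ D.n) v = v) {l : ℕ} (hl : 0 < l)
    (hln : l ≤ D.n) (j : ℕ) : multiplicity D j (greenClass (jord V hV l hl hln).module) =
      if j + 1 = l then V.vchar else 0 := by
  rw [multiplicity_greenClass, vchar_socle_jord, vchar_socle_jord]
  split_ifs <;> first | omega | simp

/-- The layers 0, ..., n - 1 of the socle of an induced module coincide. The bound j + 1 < n keeps
both layers in this range; layer n can be smaller. -/
theorem multiplicity_ind (hχ : D.χ ^ D.n = 1) (W : GroupRep k G) {j : ℕ} (hj : j + 1 < D.n) :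
    multiplicity D j (greenClass (ind hχ W).module) = 0 := by
  rw [multiplicity_greenClass,
    ((ind hχ W).socle_module (i := j) (Nat.lt_of_succ_lt hj)).vchar_eq,
    ((ind hχ W).socle_module (i := j + 1) hj).vchar_eq, sub_self]

variable (D) in
/-- The restriction to the group, as a map from the Green ring to virtual characters. -/
noncomputable def resChar : GreenRing k D.Hopf →+ virtualChar k G :=
  GreenRing.lift (fun M => (res M).vchar)
    (fun M N h => by
      obtain ⟨f, hf⟩ := h
      exact Iso.vchar_eq ⟨f, fun h => hf _⟩)
    (fun M N => GroupRep.vchar_prod (res M) (res N))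

theorem resChar_greenClass (M : FDModule k D.Hopf) : resChar D (greenClass M) = (res M).vchar :=
  GreenRing.lift_greenClass _ _ _ M

theorem resChar_mul (x y : GreenRing k D.Hopf) :
    resChar D (x * y) = resChar D x * resChar D y := by
  obtain ⟨M, N, rfl⟩ := GreenRing.exists_eq_sub x
  obtain ⟨M', N', rfl⟩ := GreenRing.exists_eq_sub y
  have h : ∀ A B : FDModule k D.Hopf, resChar D (greenClass A * greenClass B) =
      resChar D (greenClass A) * resChar D (greenClass B) := fun A B => by
    rw [← greenClass_tensor, resChar_greenClass, resChar_greenClass, resChar_greenClass,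
      (res_tensor A B).vchar_eq, GroupRep.vchar_tensor]
  rw [sub_mul, mul_sub, mul_sub]
  simp only [map_sub, h]
  ring

/-- The character of an induced module vanishes at `g`. -/
theorem resChar_ind_apply_g (hχ : D.χ ^ D.n = 1) (hn : 2 ≤ D.n) (W : GroupRep k G) :
    (resChar D (greenClass (ind hχ W).module)).1 D.g = 0 := by
  rw [resChar_greenClass]
  change LinearMap.trace k _ (grpAct (ind hχ W).module D.g) = 0
  set q : k := (D.χ D.g : k) with hq_def
  have hq : IsPrimitiveRoot q D.n := isPrimitiveRoot (D := D)
  have : NeZero D.n := ⟨(n_pos D).ne'⟩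
  let e : (ind hχ W).module.carrier ≃ₗ[k] (Fin D.n → W.carrier) := seqEquiv (ind hχ W).lam (n_pos D)
  let T : Module.End k (Fin D.n → W.carrier) := e.conj (grpAct (ind hχ W).module D.g)
  have hT : ∀ f j, T f j = q ^ j.1 • W.ρ D.g (f j) := fun f j => by
    obtain ⟨f, rfl⟩ := e.surjective f
    change e (grpAct (ind hχ W).module D.g (e.symm (e f))) j = _
    rw [e.symm_apply_apply]
    exact (ind hχ W).grpAct_module_apply D.g f j
  -- Since g acts at position j by q ^ j times its action on W, a cyclic rotation of the positions
  -- conjugates the operator T to q T; the wrap-around is harmless as q ^ n = 1. Hence tr T = q tr T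
  -- with q ≠ 1.
  let σ : (Fin D.n → W.carrier) ≃ₗ[k] (Fin D.n → W.carrier) :=
    LinearEquiv.funCongrLeft k W.carrier (Equiv.addRight (1 : Fin D.n))
  have hσ : σ.conj T = q • T := by
    refine LinearMap.ext fun f => ?_
    obtain ⟨f, rfl⟩ := σ.surjective f
    rw [LinearEquiv.conj_apply_apply, σ.symm_apply_apply]
    funext j
    have e1 : σ (T f) j = T f (j + 1) := rfl
    have e2 : σ f j = f (j + 1) := rfl
    have e3 : q ^ (j + 1 : Fin D.n).1 = q * q ^ j.1 := by
      rw [Fin.val_add, Fin.val_one', Nat.mod_eq_of_lt (by omega : 1 < D.n),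
        ← pow_eq_pow_mod _ hq.pow_eq_one, pow_succ']
    rw [e1, hT, e3, LinearMap.smul_apply, Pi.smul_apply, hT, e2, smul_smul]
  have h1 := LinearMap.trace_conj' T σ
  rw [hσ, map_smul, smul_eq_mul] at h1
  have h2 := LinearMap.trace_conj' (grpAct (ind hχ W).module D.g) e
  refine h2.symm.trans ((mul_eq_zero.1 (?_ : (q - 1) * _ = 0)).resolve_left
    (sub_ne_zero.2 (hq.ne_one hn)))
  rw [sub_mul, h1, one_mul, sub_self]

end Multiplicities

/-! ### The tridiagonal matrix of the fusion rule. -/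

section Tridiagonal

open Matrix

variable {R : Type*} [CommRing R] {m : ℕ}

/-- The tridiagonal matrix with entries `1` below and `x` above the diagonal. -/
def tridiagonal (m : ℕ) (x : R) : Matrix (Fin (m + 1)) (Fin (m + 1)) R :=
  Matrix.of fun i j => if i.1 = j.1 + 1 then 1 else if j.1 = i.1 + 1 then x else 0

/-- Index j stands for length j + 1, so this is multiplication by U_2 on coefficients r at length l.
With n = m + 2, length n has no index, in agreement with its being induced. -/
theorem tridiagonal_mulVec (x r : R) {l : ℕ} (hl : 0 < l) (hlm : l < m + 2) (i : Fin (m + 1)) :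
    (tridiagonal m x *ᵥ fun j : Fin (m + 1) => if j.1 + 1 = l then r else 0) i =
      (if i.1 + 1 = l + 1 then r else 0) + if i.1 + 1 + 1 = l then x * r else 0 := by
  obtain ⟨l, rfl⟩ := Nat.exists_eq_succ_of_ne_zero hl.ne'
  have h : (tridiagonal m x *ᵥ fun j : Fin (m + 1) => if j.1 + 1 = l + 1 then r else 0) i =
      tridiagonal m x i ⟨l, by omega⟩ * r := by
    rw [mulVec, dotProduct, Finset.sum_eq_single ⟨l, by omega⟩, if_pos rfl]
    · intro j _ hj
      rw [if_neg fun h => hj (Fin.ext (Nat.succ_injective h)), mul_zero]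
    · exact fun h => absurd (Finset.mem_univ _) h
  refine h.trans ?_
  change (if i.1 = l + 1 then 1 else if l = i.1 + 1 then x else 0) * r = _
  split_ifs <;> first | omega | simp

variable [StarRing R]

/-- Transposition puts star x below the diagonal and 1 above, and 1 = star x * x. -/
theorem conjTranspose_tridiagonal {x : R} (hx : star x * x = 1) :
    (tridiagonal m x)ᴴ = star x • tridiagonal m x := by
  ext i j
  rw [conjTranspose_apply, Matrix.smul_apply, tridiagonal, Matrix.of_apply, Matrix.of_apply]
  split_ifs <;> first | omega | simp [hx]

/-- The polynomials in a matrix of this type are normal. -/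
theorem commute_conjTranspose_of_mem_adjoin {x : R} (hx : star x * x = 1)
    {A : Matrix (Fin (m + 1)) (Fin (m + 1)) R} (hA : A ∈ Algebra.adjoin R {tridiagonal m x}) :
    Commute A Aᴴ := by
  -- The adjoint of a polynomial in T is again one, since Tᴴ is a multiple of T; the algebra
  -- generated by T is commutative.
  have h : Aᴴ ∈ Algebra.adjoin R {tridiagonal m x} := by
    induction hA using Algebra.adjoin_induction with
    | mem B hB =>
      rw [Set.mem_singleton_iff.1 hB, conjTranspose_tridiagonal hx]
      exact Subalgebra.smul_mem _ (Algebra.self_mem_adjoin_singleton R _) _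
    | algebraMap r =>
      have : (algebraMap R (Matrix (Fin (m + 1)) (Fin (m + 1)) R) r)ᴴ =
          algebraMap R _ (star r) := by
        rw [Matrix.algebraMap_eq_diagonal, Matrix.algebraMap_eq_diagonal, diagonal_conjTranspose]
        rfl
      rw [this]
      exact Subalgebra.algebraMap_mem _ _
    | add B C _ _ hB hC => rw [conjTranspose_add]; exact add_mem hB hC
    | mul B C _ _ hB hC => rw [conjTranspose_mul]; exact mul_mem hC hB
  exact Algebra.commute_of_mem_adjoin_singleton_of_commute h
    (Algebra.commute_of_mem_adjoin_singleton_of_commute hA (Commute.refl _)).symm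

end Tridiagonal

/-! ### The action of the Green ring on multiplicities, and its idempotents. -/

section GreenRingStructure

variable {k : Type u} {G : Type v} [Field k] [Group G] {D : GroupDatum k G}

open GroupDatum GroupDatum.Hopf GroupRep

theorem star_vchar_ofChar_mul (ψ : G →* kˣ) :
    star (ofChar ψ : GroupRep k G).vchar * (ofChar ψ : GroupRep k G).vchar = 1 := by
  refine Subtype.ext (funext fun h => ?_)
  change (ofChar ψ : GroupRep k G).char h⁻¹ * (ofChar ψ : GroupRep k G).char h = 1
  rw [char_ofChar, char_ofChar, ← Units.val_mul, ← map_mul, inv_mul_cancel, map_one,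
    Units.val_one]

variable [Finite G]

theorem greenClass_ind_mul (hχ : D.χ ^ D.n = 1) (W : GroupRep k G) (M : FDModule k D.Hopf) :
    greenClass (ind hχ W).module * greenClass M =
      greenClass (ind hχ (W.tensor (res M))).module := by
  rw [← greenClass_tensor, greenClass_congr (ind_tensor M hχ)]

theorem greenClass_mul_ind (hχ : D.χ ^ D.n = 1) (W : GroupRep k G) (M : FDModule k D.Hopf) :
    greenClass M * greenClass (ind hχ W).module =
      greenClass (ind hχ ((res M).tensor W)).module := by
  rw [← greenClass_tensor, greenClass_congr (tensor_ind M hχ)]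

theorem greenClass_uniserial_one : greenClass (uniserial D 1 one_pos (n_pos D)) = 1 :=
  (greenClass_congr (trivial_iso_jord (ofChar_one_apply D)).symm).trans greenClass_trivial

theorem greenClass_uniserial_two_mul {l : ℕ} (hl : 0 < l) (hln : l + 1 < D.n) :
    greenClass (uniserial D 2 two_pos (by omega)) *
      greenClass (uniserial D (l + 1) l.succ_pos hln.le) =
    greenClass (uniserial D (l + 1 + 1) (l + 1).succ_pos hln) +
      greenClass (jord (ofChar D.χ) (ofChar_chi_apply D) l hl (by omega)).module := by
  rw [← greenClass_tensor,
    greenClass_congr (uniserial_two_tensor (l + 1) (Nat.succ_lt_succ hl) hln),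
    greenClass_directSum]
  rfl

section jord

variable {V : GroupRep k G} (hV : ∀ v, V.ρ (D.g ^ D.n) v = v) {l : ℕ} (hl : 0 < l) (hln : l ≤ D.n)

theorem multiplicity_jord_one_mul_jord {U : GroupRep k G} (hU : ∀ u, U.ρ (D.g ^ D.n) u = u)
    (j : ℕ) : multiplicity D j (greenClass (jord U hU 1 one_pos (n_pos D)).module *
      greenClass (jord V hV l hl hln).module) =
      U.vchar * multiplicity D j (greenClass (jord V hV l hl hln).module) := by
  rw [← greenClass_tensor, greenClass_congr (jord_one_tensor_jord hU hV l hl hln),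
    multiplicity_jord, multiplicity_jord, GroupRep.vchar_tensor, mul_ite, mul_zero]

theorem multiplicity_jord_mul_jord_one {U : GroupRep k G} (hU : ∀ u, U.ρ (D.g ^ D.n) u = u)
    (j : ℕ) : multiplicity D j (greenClass (jord U hU l hl hln).module *
      greenClass (jord V hV 1 one_pos (n_pos D)).module) =
      if j + 1 = l then U.vchar * V.vchar else 0 := by
  rw [← greenClass_tensor, greenClass_congr (jord_tensor_jord_one hV hU l hl hln),
    multiplicity_jord, GroupRep.vchar_tensor]

end jord

variable [CharZero k]

theorem GroupRep.ofChar_one_tensor_iso (V : GroupRep k G) : Iso ((ofChar 1).tensor V) V := by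
  refine iso_of_char_eq ?_
  rw [char_tensor]
  ext h
  simp [char_ofChar]

theorem GroupRep.tensor_ofChar_one_iso (V : GroupRep k G) : Iso (V.tensor (ofChar 1)) V := by
  refine iso_of_char_eq ?_
  rw [char_tensor]
  ext h
  simp [char_ofChar]

section jord

variable {V : GroupRep k G} (hV : ∀ v, V.ρ (D.g ^ D.n) v = v) {l : ℕ} (hl : 0 < l) (hln : l ≤ D.n)

/-- Coefficients factor out as a module of length one, which reduces products to those of the
modules U_l. -/
theorem greenClass_jord_eq_uniserial_mul : greenClass (jord V hV l hl hln).module =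
    greenClass (uniserial D l hl hln) * greenClass (jord V hV 1 one_pos (n_pos D)).module := by
  rw [← greenClass_tensor]
  exact greenClass_congr (((jord_tensor_jord_one hV (ofChar_one_apply D) l hl hln).trans
    (jord_congr V.ofChar_one_tensor_iso _ hV l hl hln)).symm)

theorem greenClass_jord_eq_mul_uniserial : greenClass (jord V hV l hl hln).module =
    greenClass (jord V hV 1 one_pos (n_pos D)).module * greenClass (uniserial D l hl hln) := by
  rw [← greenClass_tensor]
  exact greenClass_congr (((jord_one_tensor_jord hV (ofChar_one_apply D) l hl hln).trans
    (jord_congr V.tensor_ofChar_one_iso _ hV l hl hln)).symm)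

end jord

/-- For l > 1 this is the fusion rule with coefficients; for l = 1 the module U_1 is the unit and
the second term is absent. -/
theorem multiplicity_uniserial_two_mul_jord {V : GroupRep k G}
    (hV : ∀ v, V.ρ (D.g ^ D.n) v = v) {l : ℕ} (hl : 0 < l) (hln : l < D.n) (j : ℕ) :
    multiplicity D j (greenClass (uniserial D 2 two_pos (by omega)) *
      greenClass (jord V hV l hl hln.le).module) =
    (if j + 1 = l + 1 then V.vchar else 0) +
      if j + 1 + 1 = l then (ofChar D.χ : GroupRep k G).vchar * V.vchar else 0 := by
  rw [greenClass_jord_eq_uniserial_mul hV hl hln.le, ← mul_assoc]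
  obtain ⟨l, rfl⟩ := Nat.exists_eq_succ_of_ne_zero hl.ne'
  rcases Nat.eq_zero_or_pos l with rfl | hl'
  · have h1 : greenClass (uniserial D (Nat.succ 0) hl hln.le) = 1 := greenClass_uniserial_one
    rw [h1, mul_one, multiplicity_jord_mul_jord_one, vchar_ofChar_one, one_mul,
      if_neg (by omega : ¬ j + 1 + 1 = Nat.succ 0), add_zero]
  · have h1 := greenClass_uniserial_two_mul hl' hln
    refine (congrArg (fun t => multiplicity D j
      (t * greenClass (jord V hV 1 one_pos (n_pos D)).module)) h1).trans ?_
    rw [add_mul, map_add, multiplicity_jord_mul_jord_one, multiplicity_jord_mul_jord_one,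
      vchar_ofChar_one, one_mul]
    simp only [Nat.succ_eq_add_one, add_left_inj]

variable [IsAlgClosed k]

/-- Subgroups of the Green ring which contain the modules of sequences and the induced modules. -/
theorem GreenRing.induction_jord_ind (hD : D.IsNonNilpotent) (S : AddSubgroup (GreenRing k D.Hopf))
    (hj : ∀ (V : GroupRep k G) (hV : ∀ v, V.ρ (D.g ^ D.n) v = v) (l : ℕ) (hl : 0 < l)
      (hln : l < D.n), greenClass (jord V hV l hl hln.le).module ∈ S)
    (hi : ∀ W, greenClass (ind hD.2 W).module ∈ S) (x : GreenRing k D.Hopf) : x ∈ S := by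
  induction x using GreenRing.induction with
  | hs x y hx hy => exact sub_mem hx hy
  | hm M =>
    obtain ⟨V, W, W', h⟩ := exists_greenClass_eq hD M
    rw [h]
    exact add_mem (add_mem (sum_mem fun j _ => hj _ (V j).2 _ _ (by omega)) (hi W)) (hi W')

open Matrix

variable (D) in
/-- The elements which act on the multiplicities by a matrix in the algebra generated by the
tridiagonal matrix. -/
def matrixActionSubring (m : ℕ) : Subring (GreenRing k D.Hopf) where
  carrier := {x | ∃ A ∈ Algebra.adjoin (virtualChar k G)
    {tridiagonal m (ofChar D.χ : GroupRep k G).vchar}, ∀ y,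
      (fun j : Fin (m + 1) => multiplicity D j (x * y)) =
        A *ᵥ fun j : Fin (m + 1) => multiplicity D j y}
  zero_mem' := ⟨0, zero_mem _, fun y => by
    rw [zero_mulVec]
    funext j
    rw [zero_mul, map_zero]
    rfl⟩
  one_mem' := ⟨1, one_mem _, fun y => by rw [one_mul, one_mulVec]⟩
  add_mem' := by
    rintro x x' ⟨A, hA, h⟩ ⟨A', hA', h'⟩
    refine ⟨A + A', add_mem hA hA', fun y => ?_⟩
    rw [add_mulVec, ← h, ← h']
    funext j
    rw [add_mul, map_add]
    rfl
  neg_mem' := by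
    rintro x ⟨A, hA, h⟩
    refine ⟨-A, neg_mem hA, fun y => ?_⟩
    rw [neg_mulVec, ← h]
    funext j
    rw [neg_mul, map_neg]
    rfl
  mul_mem' := by
    rintro x x' ⟨A, hA, h⟩ ⟨A', hA', h'⟩
    refine ⟨A * A', mul_mem hA hA', fun y => ?_⟩
    rw [mul_assoc, h, h', mulVec_mulVec]

/-- Both sides are additive in the element acted upon, so generators suffice. Induced classes have
multiplicity vector 0, hence on them the product must have none either. -/
theorem mem_matrixActionSubring_of_forall (hD : D.IsNonNilpotent) {m : ℕ} (hm : D.n = m + 2)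
    {x : GreenRing k D.Hopf} {A : Matrix (Fin (m + 1)) (Fin (m + 1)) (virtualChar k G)}
    (hA : A ∈ Algebra.adjoin (virtualChar k G)
      {tridiagonal m (ofChar D.χ : GroupRep k G).vchar})
    (hj : ∀ (V : GroupRep k G) (hV : ∀ v, V.ρ (D.g ^ D.n) v = v) (l : ℕ) (hl : 0 < l)
      (hln : l < D.n) (i : Fin (m + 1)),
      multiplicity D i (x * greenClass (jord V hV l hl hln.le).module) =
        (A *ᵥ fun j : Fin (m + 1) => if j.1 + 1 = l then V.vchar else 0) i)
    (hi : ∀ W (i : Fin (m + 1)), multiplicity D i (x * greenClass (ind hD.2 W).module) = 0) :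
    x ∈ matrixActionSubring D m := by
  refine ⟨A, hA, fun y => ?_⟩
  let S : AddSubgroup (GreenRing k D.Hopf) :=
    { carrier := {y | (fun j : Fin (m + 1) => multiplicity D j (x * y)) =
        A *ᵥ fun j : Fin (m + 1) => multiplicity D j y}
      zero_mem' := by
        change _ = _
        simp only [mul_zero, map_zero]
        exact (mulVec_zero A).symm
      add_mem' := fun {y z} hy hz => by
        change _ = _ at hy hz
        change _ = _
        simp only [mul_add, map_add]
        refine Eq.trans ?_ (mulVec_add A _ _).symm
        rw [← hy, ← hz]
        rfl
      neg_mem' := fun {y} hy => by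
        change _ = _ at hy
        change _ = _
        simp only [mul_neg, map_neg]
        refine Eq.trans ?_ (mulVec_neg _ A).symm
        rw [← hy]
        rfl }
  refine GreenRing.induction_jord_ind hD S (fun V hV l hl hln => ?_) (fun W => ?_) y
  · change _ = _
    funext i
    refine (hj V hV l hl hln i).trans (congrFun (congrArg (fun f => A *ᵥ f) ?_) i)
    funext j
    rw [multiplicity_jord]
  · change _ = _
    have h : (fun j : Fin (m + 1) => multiplicity D j (greenClass (ind hD.2 W).module)) = 0 :=
      funext fun j => multiplicity_ind hD.2 W (by omega)
    rw [h, mulVec_zero]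
    exact funext fun i => hi W i

/-- The class U_2 acts by T, a class of length one by a scalar, and an induced class by 0. The
recursion U_(l+3) = U_2 U_(l+2) - χ U_(l+1) yields all U_l, and products with classes of length one
yield the rest. -/
theorem mem_matrixActionSubring (hD : D.IsNonNilpotent) {m : ℕ} (hm : D.n = m + 2)
    (x : GreenRing k D.Hopf) : x ∈ matrixActionSubring D m := by
  have hz : greenClass (uniserial D 2 two_pos (by omega)) ∈ matrixActionSubring D m :=
    mem_matrixActionSubring_of_forall hD hm (Algebra.self_mem_adjoin_singleton _ _)
      (fun V hV l hl hln i => by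
        rw [multiplicity_uniserial_two_mul_jord hV hl hln, tridiagonal_mulVec _ _ hl (by omega)])
      (fun W i => by
        rw [greenClass_mul_ind, multiplicity_ind hD.2 _ (by omega)])
  have h1 : ∀ (V : GroupRep k G) (hV : ∀ v, V.ρ (D.g ^ D.n) v = v),
      greenClass (jord V hV 1 one_pos (n_pos D)).module ∈ matrixActionSubring D m := fun V hV =>
    mem_matrixActionSubring_of_forall hD hm (Subalgebra.algebraMap_mem _ V.vchar)
      (fun U hU l hl hln i => by
        rw [multiplicity_jord_one_mul_jord, multiplicity_jord, Algebra.algebraMap_eq_smul_one,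
          smul_mulVec, one_mulVec]
        rfl)
      (fun W i => by
        rw [greenClass_mul_ind, multiplicity_ind hD.2 _ (by omega)])
  have h2 : ∀ l (hl : 0 < l) (hln : l ≤ D.n),
      greenClass (uniserial D l hl hln) ∈ matrixActionSubring D m := by
    intro l
    induction l using Nat.strong_induction_on with
    | _ l ih =>
      intro hl hln
      match l, hl with
      | 1, _ => exact greenClass_uniserial_one (D := D) ▸ one_mem _
      | 2, _ => exact hz
      | l + 3, _ =>
        rw [eq_sub_of_add_eq (greenClass_uniserial_two_mul (Nat.succ_pos l) hln).symm]
        refine sub_mem (mul_mem hz (ih _ (by omega) _ _)) ?_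
        rw [greenClass_jord_eq_mul_uniserial]
        exact mul_mem (h1 _ _) (ih _ (by omega) _ _)
  refine GreenRing.induction_jord_ind hD (matrixActionSubring D m).toAddSubgroup
    (fun V hV l hl hln => ?_) (fun W => ?_) x
  · rw [greenClass_jord_eq_mul_uniserial]
    exact (matrixActionSubring D m).mul_mem (h1 V hV) (h2 l hl hln.le)
  · exact mem_matrixActionSubring_of_forall hD hm (zero_mem _)
      (fun U hU l hl hln i => by
        rw [greenClass_ind_mul, multiplicity_ind hD.2 _ (by omega), zero_mulVec]
        rfl)
      (fun U i => by
        rw [greenClass_ind_mul, multiplicity_ind hD.2 _ (by omega)])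

/-- The multiplicities of an idempotent vanish, or its first multiplicity has mean `1`. -/
theorem multiplicity_idempotent (hD : D.IsNonNilpotent) {m : ℕ} (hm : D.n = m + 2)
    {E : GreenRing k D.Hopf} (hE : E * E = E) :
    (virtualChar.mean (multiplicity D 0 E) = 0 ∧ ∀ j < m + 1, multiplicity D j E = 0) ∨
      virtualChar.mean (multiplicity D 0 E) = 1 := by
  obtain ⟨A, hA, h⟩ := mem_matrixActionSubring hD hm E
  -- The classes U_(j+1) realize the standard basis as multiplicity vectors, so A is determined by
  -- the action of E and inherits its idempotence.
  have hcol : ∀ j : Fin (m + 1), ∃ y, (fun i : Fin (m + 1) => multiplicity D i y) =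
      Pi.single j 1 := fun j => by
    refine ⟨greenClass (uniserial D (j + 1) j.1.succ_pos (by omega)), funext fun i => ?_⟩
    rw [multiplicity_jord, vchar_ofChar_one, Pi.single_apply]
    congr 1
    rw [add_left_inj, Fin.ext_iff]
  have hAA : A * A = A := by
    refine Matrix.ext_of_mulVec_single fun j => ?_
    obtain ⟨y, hy⟩ := hcol j
    rw [← hy, ← mulVec_mulVec, ← h, ← h, ← mul_assoc, hE]
  -- The unit U_1 has multiplicity vector e₀, so the first column of A consists of the
  -- multiplicities of E.
  have h1 : ∀ i : Fin (m + 1), A i 0 = multiplicity D i E := fun i => by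
    have h2 := congrFun (h 1) i
    have h3 : (fun i : Fin (m + 1) => multiplicity D i 1) = Pi.single 0 1 := by
      funext i
      rw [← greenClass_uniserial_one (D := D), multiplicity_jord, vchar_ofChar_one, Pi.single_apply]
      congr 1
      rw [add_eq_right, Fin.ext_iff]
      rfl
    rw [mul_one, h3, mulVec_single_one] at h2
    exact h2.symm
  have hc : Commute A Aᴴ :=
    commute_conjTranspose_of_mem_adjoin (star_vchar_ofChar_mul D.χ) hA
  have h4 := matrix_idempotent_corner (R := virtualChar k G) virtualChar.mean
    virtualChar.mean_one virtualChar.mean_star virtualChar.mean_star_mul_self A hAA hc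
  have h0 : A 0 0 = multiplicity D 0 E := h1 0
  rw [h0] at h4
  rcases h4 with h5 | h5
  · exact Or.inl ⟨h5.1, fun j hj => (h1 ⟨j, hj⟩).symm.trans (h5.2 _)⟩
  · exact Or.inr h5

/-- An idempotent without multiplicities vanishes. -/
theorem eq_zero_of_multiplicity_eq_zero (hD : D.IsNonNilpotent) (hn : 2 ≤ D.n)
    {E : GreenRing k D.Hopf} (hE : E * E = E) (h : ∀ j, j + 1 < D.n → multiplicity D j E = 0) :
    E = 0 := by
  obtain ⟨M, N, hMN⟩ := GreenRing.exists_eq_sub E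
  obtain ⟨V, W₁, W₂, hM⟩ := exists_greenClass_eq hD M
  obtain ⟨V', W₃, W₄, hN⟩ := exists_greenClass_eq hD N
  have hmult : ∀ (j : Fin (D.n - 1)) (U : Fin (D.n - 1) →
      {V : GroupRep k G // ∀ v, V.ρ (D.g ^ D.n) v = v}) (W W' : GroupRep k G),
      multiplicity D j (∑ j : Fin (D.n - 1),
        greenClass (jord (U j).1 (U j).2 (j + 1) j.1.succ_pos (by omega)).module +
          greenClass (ind hD.2 W).module + greenClass (ind hD.2 W').module) = (U j).1.vchar := by
    intro j U W W'
    rw [map_add, map_add, map_sum, multiplicity_ind hD.2 _ (by omega),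
      multiplicity_ind hD.2 _ (by omega), add_zero, add_zero, Finset.sum_eq_single j,
      multiplicity_jord, if_pos rfl]
    · intro i _ hij
      rw [multiplicity_jord, if_neg fun h => hij (Fin.ext (by omega))]
    · exact fun h => absurd (Finset.mem_univ _) h
  -- Equal multiplicities mean isomorphic coefficients, so the Jordan parts of M and N cancel and E
  -- is a combination of induced classes.
  have hV : ∀ j, Iso (V j).1 (V' j).1 := fun j => by
    have h1 := h j.1 (by omega)
    rw [hMN, hM, hN, map_sub, hmult, hmult, sub_eq_zero] at h1
    exact iso_of_char_eq (congrArg Subtype.val h1)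
  have hE' : E = greenClass (ind hD.2 W₁).module + greenClass (ind hD.2 W₂).module -
      greenClass (ind hD.2 W₃).module - greenClass (ind hD.2 W₄).module := by
    rw [hMN, hM, hN, Finset.sum_congr rfl fun j _ =>
      greenClass_congr (jord_congr (hV j) (V j).2 (V' j).2 (j + 1) j.1.succ_pos (by omega))]
    abel
  have hres : resChar D E = 0 := by
    refine virtualChar.eq_zero_of_idempotent (g := D.g) (by rw [← resChar_mul, hE]) ?_
    have h0 := resChar_ind_apply_g hD.2 hn
    rw [hE', map_sub, map_sub, map_add]
    change (resChar D _).1 D.g + (resChar D _).1 D.g - (resChar D _).1 D.g -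
      (resChar D _).1 D.g = 0
    rw [h0, h0, h0, h0, add_zero, sub_zero, sub_zero]
  have hiso : Iso (res M) (res N) := by
    rw [hMN, map_sub, resChar_greenClass, resChar_greenClass, sub_eq_zero] at hres
    exact iso_of_char_eq (congrArg Subtype.val hres)
  -- A product with an induced class depends only on the restriction to G, where M and N agree.
  have hind : ∀ W, greenClass (ind hD.2 W).module * E = 0 := fun W => by
    rw [hMN, mul_sub, greenClass_ind_mul, greenClass_ind_mul, sub_eq_zero]
    exact greenClass_congr (ind_congr hD.2 (GroupRep.tensor_congr (Iso.refl W) hiso))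
  rw [← hE]
  nth_rewrite 1 [hE']
  rw [sub_mul, sub_mul, add_mul, hind, hind, hind, hind, add_zero, sub_zero, sub_zero]

/-- The Green ring has no idempotents other than `0` and `1`. -/
theorem GreenRing.eq_zero_or_eq_one_of_idempotent (hD : D.IsNonNilpotent) (hn : 2 ≤ D.n)
    {E : GreenRing k D.Hopf} (hE : E * E = E) : E = 0 ∨ E = 1 := by
  obtain ⟨m, hm⟩ := Nat.exists_eq_add_of_le' hn
  rcases multiplicity_idempotent hD hm hE with h | h
  · exact Or.inl (eq_zero_of_multiplicity_eq_zero hD hn hE fun j hj => h.2 j (by omega))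
  · right
    have hE' : (1 - E) * (1 - E) = 1 - E := (IsIdempotentElem.one_sub hE).eq
    refine (sub_eq_zero.1 (eq_zero_of_multiplicity_eq_zero hD hn hE' fun j hj => ?_)).symm
    have h1 : multiplicity D 0 (1 : GreenRing k D.Hopf) = 1 := by
      rw [← greenClass_uniserial_one (D := D), multiplicity_jord, vchar_ofChar_one, if_pos rfl]
    -- The corner mean of 1 - E is 1 - 1 = 0, so the second alternative is impossible.
    rcases multiplicity_idempotent hD hm hE' with h' | h'
    · exact h'.2 j (by omega)
    · rw [map_sub, map_sub, h, h1, virtualChar.mean_one] at h'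
      norm_num at h'

end GreenRingStructure

end PointedHopf

theorem mainTheorem8 {k : Type u} [Field k] [IsAlgClosed k] [CharZero k]
    {G : Type v} [Group G] [Finite G]
    (D : PointedHopf.GroupDatum k G) (hD : D.IsNonNilpotent) (hn : 2 ≤ D.n)
    (E : PointedHopf.GreenRing k D.Hopf) (hE : E * E = E) :
    E = 0 ∨ E = 1 :=
  PointedHopf.GreenRing.eq_zero_or_eq_one_of_idempotent hD hn hE
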